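/- Let $M$ be a compact complex manifold of complex dimension $n$. For a Hermitian metric $g$ on $M$, in local holomorphic coordinates let $\Gamma_{ij}^k=g^{k\bar l}\partial_i g_{j\bar l}$ be the Christoffel symbols of the Chern connection, $R_{i\bar jk}{}^{l}=-\partial_{\bar j}\Gamma_{ik}^l$ and $R_{i\bar jk\bar l}=g_{p\bar l}R_{i\bar jk}{}^{p}$ its curvature, $R_{i\bar j}=g^{k\bar l}R_{i\bar jk\bar l}$ the first Ricci curvature $\mathrm{Ric}$, and $S_{i\bar j}=g^{k\bar l}R_{k\bar li\bar j}$ the second Ricci curvature. Let $T>0$ and let $g(t)$, $t\in[0,T]$, be a solution, smooth on $M\times[0,T]$, of the Hermitian curvature flow $$\partial_t g_{i\bar j}=-S_{i\bar j}(g(t)),\qquad g(0)=g_0 .$$ Assume that $g_0$ has Griffiths non-positive Chern curvature: there is a function $\kappa\le 0$ on $M$ such that for all $p\in M$ and $X,Y\in T^{1,0}_pM$, $$R(X,\bar X,Y,\bar Y)\le \kappa(p)\,B(X,\bar X,Y,\bar Y),\qquad B_{i\bar jk\bar l}=g_{i\bar j}g_{k\bar l}+g_{i\bar l}g_{k\bar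 j},$$ where $R$ and $B$ are taken with respect to $g_0$. Then there are $t_0\in(0,T]$ and $K>0$ such that for all $t\in[0,t_0]$ the curvature of $g(t)$ satisfies 1. $\mathrm{Ric}\le 0$, that is, $R_{u\bar u}\le 0$ for all $p\in M$ and $u\in T^{1,0}_pM$; 2. $|R_{u\bar v x\bar x}|^2\le (1+Kt)\,R_{u\bar u}R_{v\bar v}$ for all $p\in M$ and $x,u,v\in T^{1,0}_pM$ with $|x|_{g(t)}=1$. -/

import Mathlib

open scoped Manifold ContDiff ComplexConjugate

noncomputable section

namespace ChernGeom

/-! ### Wirtinger derivatives in `ℂⁿ` -/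

/-- `∂f/∂zⁱ = ½ (∂f/∂xⁱ - √-1 ∂f/∂yⁱ)`, where `zⁱ = xⁱ + √-1 yⁱ`. -/
def dz {n : ℕ} (i : Fin n) (f : (Fin n → ℂ) → ℂ) (z : Fin n → ℂ) : ℂ :=
  (1 / 2 : ℂ) * (fderiv ℝ f z (Pi.single i 1) - Complex.I * fderiv ℝ f z (Pi.single i Complex.I))

/-- `∂f/∂z̄ⁱ = ½ (∂f/∂xⁱ + √-1 ∂f/∂yⁱ)`. -/
def dzbar {n : ℕ} (i : Fin n) (f : (Fin n → ℂ) → ℂ) (z : Fin n → ℂ) : ℂ :=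
  (1 / 2 : ℂ) * (fderiv ℝ f z (Pi.single i 1) + Complex.I * fderiv ℝ f z (Pi.single i Complex.I))

/-! ### The Chern connection in local holomorphic coordinates

Here `G` is the coordinate expression of a Hermitian metric: `G z i j = g_{i j̄}(z)`. -/

/-- The inverse metric `g^{k l̄}`, characterised by `∑_l g^{k l̄} g_{j l̄} = δ^k_j`. -/
def invMetric {n : ℕ} (G : (Fin n → ℂ) → Matrix (Fin n) (Fin n) ℂ) (z : Fin n → ℂ)
    (k l : Fin n) : ℂ :=
  (G z)⁻¹ l k

/-- `Γ_{ij}^k = g^{k l̄} ∂_i g_{j l̄}`. -/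
def christoffel {n : ℕ} (G : (Fin n → ℂ) → Matrix (Fin n) (Fin n) ℂ) (z : Fin n → ℂ)
    (i j k : Fin n) : ℂ :=
  ∑ l, invMetric G z k l * dz i (fun w => G w j l) z

/-- `R_{i j̄ k}^l = - ∂_{j̄} Γ_{ik}^l`. -/
def curvUp {n : ℕ} (G : (Fin n → ℂ) → Matrix (Fin n) (Fin n) ℂ) (z : Fin n → ℂ)
    (i j k l : Fin n) : ℂ :=
  - dzbar j (fun w => christoffel G w i k l) z

/-- The Chern curvature tensor `R_{i j̄ k l̄} = g_{p l̄} R_{i j̄ k}^p`. -/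
def curv {n : ℕ} (G : (Fin n → ℂ) → Matrix (Fin n) (Fin n) ℂ) (z : Fin n → ℂ)
    (i j k l : Fin n) : ℂ :=
  ∑ p, G z p l * curvUp G z i j k p

/-- The first (Chern-)Ricci curvature `R_{i j̄} = g^{k l̄} R_{i j̄ k l̄}`. -/
def ricci {n : ℕ} (G : (Fin n → ℂ) → Matrix (Fin n) (Fin n) ℂ) (z : Fin n → ℂ)
    (i j : Fin n) : ℂ :=
  ∑ k, ∑ l, invMetric G z k l * curv G z i j k l

/-- The second Ricci curvature `S_{i j̄} = g^{k l̄} R_{k l̄ i j̄}`. -/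
def secondRicci {n : ℕ} (G : (Fin n → ℂ) → Matrix (Fin n) (Fin n) ℂ) (z : Fin n → ℂ)
    (i j : Fin n) : ℂ :=
  ∑ k, ∑ l, invMetric G z k l * curv G z k l i j

/-- `g(X, Ȳ) = g_{i j̄} X^i Ȳ^j` for the `(1,0)`-vectors `X = X^i ∂_i`, `Y = Y^i ∂_i`. -/
def metricForm {n : ℕ} (G : (Fin n → ℂ) → Matrix (Fin n) (Fin n) ℂ) (z X Y : Fin n → ℂ) : ℂ :=
  ∑ i, ∑ j, G z i j * X i * conj (Y j)

/-- `R(X, Ȳ, Z, W̄) = R_{i j̄ k l̄} X^i Ȳ^j Z^k W̄^l`. -/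
def curvForm {n : ℕ} (G : (Fin n → ℂ) → Matrix (Fin n) (Fin n) ℂ)
    (z X Y Z W : Fin n → ℂ) : ℂ :=
  ∑ i, ∑ j, ∑ k, ∑ l, curv G z i j k l * X i * conj (Y j) * Z k * conj (W l)

/-- `Ric(X, Ȳ) = R_{i j̄} X^i Ȳ^j`. -/
def ricciForm {n : ℕ} (G : (Fin n → ℂ) → Matrix (Fin n) (Fin n) ℂ) (z X Y : Fin n → ℂ) : ℂ :=
  ∑ i, ∑ j, ricci G z i j * X i * conj (Y j)

/-- `B(X, Ȳ, Z, W̄)` for `B_{i j̄ k l̄} = g_{i j̄} g_{k l̄} + g_{i l̄} g_{k j̄}`. -/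
def bForm {n : ℕ} (G : (Fin n → ℂ) → Matrix (Fin n) (Fin n) ℂ)
    (z X Y Z W : Fin n → ℂ) : ℂ :=
  metricForm G z X Y * metricForm G z Z W + metricForm G z X W * metricForm G z Z Y

/-! ### Hermitian metrics on a complex manifold

`M` is a complex manifold modelled on `ℂⁿ`. The holomorphic tangent space `T^{1,0}_p M` is the
complex tangent space of `M` at `p`. -/

section Manifold

variable {n : ℕ} {M : Type*} [TopologicalSpace M] [ChartedSpace (Fin n → ℂ) M]

/-- The coordinate vector `∂_i` of the holomorphic chart `e` at the point with coordinates `z`. -/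
def coordVector (e : OpenPartialHomeomorph M (Fin n → ℂ)) (z : Fin n → ℂ) (i : Fin n) :
    TangentSpace 𝓘(ℂ, Fin n → ℂ) (e.symm z) :=
  mfderiv 𝓘(ℂ, Fin n → ℂ) 𝓘(ℂ, Fin n → ℂ) e.symm z (Pi.single i 1 : Fin n → ℂ)

/-- `g_{i j̄} = g(∂_i, ∂_{j̄})` in the holomorphic chart `e`. -/
def localExpr
    (g : ∀ p : M, TangentSpace 𝓘(ℂ, Fin n → ℂ) p →ₗ[ℂ] TangentSpace 𝓘(ℂ, Fin n → ℂ) p →ₗ⋆[ℂ] ℂ)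
    (e : OpenPartialHomeomorph M (Fin n → ℂ)) (z : Fin n → ℂ) : Matrix (Fin n) (Fin n) ℂ :=
  Matrix.of fun i j => g (e.symm z) (coordVector e z i) (coordVector e z j)

variable (n M) in
/-- A smooth Hermitian metric on the complex manifold `M`: `form p X Y` is `g_p(X, Ȳ)`, linear in
`X` and conjugate-linear in `Y`. Smoothness is real smoothness of the coefficients `g_{i j̄}`. -/
structure HermitianMetric where
  form : ∀ p : M,
    TangentSpace 𝓘(ℂ, Fin n → ℂ) p →ₗ[ℂ] TangentSpace 𝓘(ℂ, Fin n → ℂ) p →ₗ⋆[ℂ] ℂ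
  conj_symm : ∀ (p : M) (X Y : TangentSpace 𝓘(ℂ, Fin n → ℂ) p),
    conj (form p X Y) = form p Y X
  pos : ∀ (p : M) (X : TangentSpace 𝓘(ℂ, Fin n → ℂ) p), X ≠ 0 → 0 < (form p X X).re
  smooth : ∀ e ∈ atlas (Fin n → ℂ) M, ∀ i j : Fin n,
    ContDiffOn ℝ ∞ (fun z => localExpr form e z i j) e.target

/-- The matrix `(g_{i j̄})` of a Hermitian metric in the holomorphic chart `e`. -/
def HermitianMetric.inChart (g : HermitianMetric n M)
    (e : OpenPartialHomeomorph M (Fin n → ℂ)) : (Fin n → ℂ) → Matrix (Fin n) (Fin n) ℂ :=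
  localExpr g.form e

/-- Griffiths non-positive Chern curvature: there is a non-positive function `κ` on `M` such that
`R(X, X̄, Y, Ȳ) ≤ κ B(X, X̄, Y, Ȳ)` for all `X, Y ∈ T^{1,0} M`. Both sides are real numbers. -/
def HermitianMetric.GriffithsNonpos (g : HermitianMetric n M) : Prop :=
  ∃ κ : M → ℝ, (∀ p, κ p ≤ 0) ∧
    ∀ e ∈ atlas (Fin n → ℂ) M, ∀ p ∈ e.source, ∀ X Y : Fin n → ℂ,
      (curvForm (g.inChart e) (e p) X X Y Y).re ≤ κ p * (bForm (g.inChart e) (e p) X X Y Y).re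

/-- `Ric ≤ 0`: the first Ricci curvature satisfies `Ric(X, X̄) ≤ 0` for all `X ∈ T^{1,0} M`. -/
def HermitianMetric.RicciNonpos (g : HermitianMetric n M) : Prop :=
  ∀ e ∈ atlas (Fin n → ℂ) M, ∀ p ∈ e.source, ∀ X : Fin n → ℂ,
    (ricciForm (g.inChart e) (e p) X X).re ≤ 0

/-- `|R_{u v̄ x x̄}|² ≤ c R_{u ū} R_{v v̄}` for all `x, u, v ∈ T^{1,0} M` with `|x| = 1`. -/
def HermitianMetric.CurvatureBound (g : HermitianMetric n M) (c : ℝ) : Prop :=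
  ∀ e ∈ atlas (Fin n → ℂ) M, ∀ p ∈ e.source, ∀ x u v : Fin n → ℂ,
    metricForm (g.inChart e) (e p) x x = 1 →
    ‖curvForm (g.inChart e) (e p) u v x x‖ ^ 2 ≤
      c * (ricciForm (g.inChart e) (e p) u u).re * (ricciForm (g.inChart e) (e p) v v).re

/-- `g(t)`, `t ∈ [0, T]`, is a smooth solution of the Hermitian curvature flow
`∂_t g_{i j̄} = - S_{i j̄}`, `g(0) = g₀`. (The values `g t` for `t ∉ [0, T]` play no role.) -/
structure IsHermitianCurvatureFlow (g₀ : HermitianMetric n M) (T : ℝ)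
    (g : ℝ → HermitianMetric n M) : Prop where
  smooth : ∀ e ∈ atlas (Fin n → ℂ) M, ∀ i j : Fin n,
    ContDiffOn ℝ ∞ (fun q : (Fin n → ℂ) × ℝ => (g q.2).inChart e q.1 i j)
      (e.target ×ˢ Set.Icc 0 T)
  evolution : ∀ e ∈ atlas (Fin n → ℂ) M, ∀ p ∈ e.source, ∀ t ∈ Set.Icc 0 T, ∀ i j : Fin n,
    HasDerivWithinAt (fun s => (g s).inChart e (e p) i j)
      (- secondRicci ((g t).inChart e) (e p) i j) (Set.Icc 0 T) t
  initial : g 0 = g₀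

end Manifold

end ChernGeom

end

/-!
The theorem is a maximum principle for Hermitian curvature flow. In a holomorphic chart write
`H = (g_{ij̄})`, `Γ_i = (∂_i H) H⁻¹` and `F_{ij̄} = -∂_{j̄} Γ_i`, so that `R_{ij̄kl̄} = (F_{ij̄} H)_{kl}`,
`Ric_{ij̄} = tr F_{ij̄}`, and the flow is `∂_t H = -σ H` with `σ = g^{pq̄} F_{pq̄}`. For signs `s = ±1`
and `0 < ε ≤ 1` consider the barrier
`Q(u, x) = (1 + κ t) g(x, x̄) (-Ric + ε g)(u, ū) + s R(u, ū, x, x̄)`.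
Non-negativity of both barriers is the pinching condition `Pinched`. Tracing it over `x` bounds
`ε g` by `-Ric + ε g`, and polarising it in `u` gives
`|R(u, v̄, x, x̄)|² ≤ (1 + κ t)² g(x, x̄)² (-Ric + ε g)(u, ū) (-Ric + ε g)(v, v̄)`; both conclusions of
the theorem follow when `ε → 0`, since `(1 + κ t)² ≤ 1 + (2 κ + κ²) t` for `t ≤ 1`.

It remains to keep `Q` non-negative. At time zero it is positive for non-zero `u`, `x`, because a
non-negative Hermitian form is bounded by its trace (`barrierAt_pos_of_griffiths`). Suppose that it
vanishes for the first time at some point, for some `u`, `x`. Extend `x` and `u` to sections that are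
parallel there, `x` for the Chern connection and `u` for the connection with coefficients `Γ_{ip}^r`
in place of `Γ_{pi}^r`. Then `(∂_t - g^{pq̄} ∂_p ∂_{q̄}) Q ≤ 0` at that point. On the other hand this
quantity is `κ g(x, x̄) (-Ric + ε g)(u, ū)` plus reaction terms (`ev_heat_sandwich`,
`ev_heat_contract`). The point of the twisted connection is that no first derivatives of the
curvature are left and that the reaction terms of `F_{ij̄}`, by `heatOp_curvEnd`, are
`(H⁻¹ F_{ij̄})_{qp} F_{pq̄} + g^{pq̄} [F_{pj̄}, F_{iq̄}]`: each term contains either `F_{uū}` or both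
`F_{uq̄}` and `F_{pū}`. By the pinching condition these are bounded by multiples of `p` and of `√p`,
where `p = (-Ric + ε g)(u, ū)`, so the reaction is at most `C p g(x, x̄)`, with `C` independent of
`ε` (`Pinched.reaction_pos`). For `κ > C` this is a contradiction (`SmoothFn.barrier_no_first_zero`).

The constant `C` comes from bounds of the geometry on finitely many compact pieces of charts that
cover `M`. The barriers transform as tensors between charts (`curvMat_change`), so the first zero can
be looked for on these pieces (`IsHermitianCurvatureFlow.barrierNonneg`). The computations take place
in the `*`-algebra `SmoothFn` of smooth functions on `U × [0, T]`, whose Wirtinger derivatives form a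
`WirtingerCalculus`.
-/

noncomputable section

namespace ChernGeom

/-! ### The differential algebra of smooth functions on a set -/

/-- A set on which derivatives up to the boundary are unique and second derivatives are symmetric,
such as `U × [0, T]` with `U` open. -/
class SmoothDomain {E : Type*} [NormedAddCommGroup E] [NormedSpace ℝ E] (S : Set E) : Prop where
  uniqueDiffOn : UniqueDiffOn ℝ S
  subset_closure_interior : S ⊆ closure (interior S)

section SmoothFn

variable {E : Type*} [NormedAddCommGroup E] [NormedSpace ℝ E]

/-- The `*`-algebra of smooth complex functions on `S`. Elements are functions on the subtype `S`,
so that equality in the algebra is equality on `S`. -/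
def SmoothFn (S : Set E) : StarSubalgebra ℂ (S → ℂ) where
  carrier := {f | ∃ F : E → ℂ, ContDiffOn ℝ ∞ F S ∧ ∀ q : S, F q = f q}
  mul_mem' := by
    rintro f g ⟨F, hF, hFf⟩ ⟨G, hG, hGg⟩
    exact ⟨fun q => F q * G q, hF.mul hG, fun q => by simp [hFf, hGg]⟩
  add_mem' := by
    rintro f g ⟨F, hF, hFf⟩ ⟨G, hG, hGg⟩
    exact ⟨fun q => F q + G q, hF.add hG, fun q => by simp [hFf, hGg]⟩
  algebraMap_mem' := fun c => ⟨fun _ => c, contDiffOn_const, fun q => by simp⟩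
  star_mem' := by
    rintro f ⟨F, hF, hFf⟩
    refine ⟨fun q => conj (F q), ?_, fun q => by simp [hFf]⟩
    exact (Complex.conjCLE.contDiff (n := ∞)).comp_contDiffOn hF

namespace SmoothFn

variable {S : Set E}

/-- The smooth function on `S` with a given smooth representative. -/
def mk (F : E → ℂ) (hF : ContDiffOn ℝ ∞ F S) : SmoothFn S :=
  ⟨fun q => F q, F, hF, fun _ => rfl⟩

/-- Extension by zero to the whole space. -/
def ext (f : SmoothFn S) : E → ℂ := Function.extend Subtype.val f.1 0

/-- Evaluation at a point of `S`. -/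
def ev (q : S) : SmoothFn S →+* ℂ :=
  (Pi.evalRingHom (fun _ : S => ℂ) q).comp (SmoothFn S).subtype.toRingHom

lemma ev_mk (q : S) (F : E → ℂ) (hF : ContDiffOn ℝ ∞ F S) : ev q (mk F hF) = F q := rfl

lemma ev_star (q : S) (f : SmoothFn S) : ev q (star f) = conj (ev q f) := rfl

lemma ev_smul (q : S) (c : ℂ) (f : SmoothFn S) : ev q (c • f) = c * ev q f := rfl

lemma ev_algebraMap (q : S) (c : ℂ) : ev q (algebraMap ℂ (SmoothFn S) c) = c := rfl

lemma ext_ev {f g : SmoothFn S} (h : ∀ q, ev q f = ev q g) : f = g :=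
  Subtype.ext (funext h)

lemma ext_apply (f : SmoothFn S) (q : S) : ext f q = ev q f :=
  Subtype.val_injective.extend_apply _ _ _

lemma eqOn_ext {f : SmoothFn S} {F : E → ℂ} (h : ∀ q : S, F q = ev q f) : Set.EqOn (ext f) F S :=
  fun q hq => (ext_apply f ⟨q, hq⟩).trans (h ⟨q, hq⟩).symm

lemma contDiffOn_ext (f : SmoothFn S) : ContDiffOn ℝ ∞ (ext f) S := by
  obtain ⟨F, hF, hFf⟩ := f.2
  exact hF.congr (eqOn_ext hFf)

lemma continuous_ev (f : SmoothFn S) : Continuous fun q : S => ev q f := by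
  have := continuousOn_iff_continuous_domRestrict.1 (contDiffOn_ext f).continuousOn
  convert this using 2 with q
  exact (ext_apply f q).symm

lemma differentiableWithinAt_ext (f : SmoothFn S) (q : S) :
    DifferentiableWithinAt ℝ (ext f) S q :=
  (contDiffOn_ext f).differentiableOn (by simp) q q.2

variable [hS : SmoothDomain S]

lemma contDiffOn_fderivWithin (f : SmoothFn S) (v : E) :
    ContDiffOn ℝ ∞ (fun q => fderivWithin ℝ (ext f) S q v) S :=
  ((contDiffOn_ext f).fderivWithin hS.uniqueDiffOn (m := ∞) (by simp)).clm_apply contDiffOn_const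

/-- The derivative of a smooth function in the direction `v`, taken within `S`. -/
def dirDeriv (v : E) : Derivation ℂ (SmoothFn S) (SmoothFn S) :=
  Derivation.mk'
    { toFun := fun f => mk (fun q => fderivWithin ℝ (ext f) S q v) (contDiffOn_fderivWithin f v)
      map_add' := fun f g => ext_ev fun q => by
        have h : Set.EqOn (ext (f + g)) (ext f + ext g) S :=
          eqOn_ext fun q => by simp [ext_apply]
        rw [map_add, ev_mk, ev_mk, ev_mk, fderivWithin_congr h (h q.2),
          fderivWithin_add (hS.uniqueDiffOn q q.2) (differentiableWithinAt_ext f q)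
            (differentiableWithinAt_ext g q)]
        rfl
      map_smul' := fun c f => ext_ev fun q => by
        have h : Set.EqOn (ext (c • f)) (fun q => c * ext f q) S :=
          eqOn_ext fun q => by simp [ext_apply, ev_smul]
        rw [RingHom.id_apply, ev_smul, ev_mk, ev_mk, fderivWithin_congr h (h q.2),
          fderivWithin_const_mul (hS.uniqueDiffOn q q.2) (differentiableWithinAt_ext f q)]
        rfl }
    (fun f g => ext_ev fun q => by
      have h : Set.EqOn (ext (f * g)) (ext f * ext g) S :=
        eqOn_ext fun q => by simp [ext_apply]
      change fderivWithin ℝ (ext (f * g)) S q v =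
        ev q f * fderivWithin ℝ (ext g) S q v + ev q g * fderivWithin ℝ (ext f) S q v
      rw [fderivWithin_congr h (h q.2), fderivWithin_mul (hS.uniqueDiffOn q q.2)
        (differentiableWithinAt_ext f q) (differentiableWithinAt_ext g q)]
      simp [ext_apply])

lemma ev_dirDeriv (q : S) (v : E) (f : SmoothFn S) :
    ev q (dirDeriv v f) = fderivWithin ℝ (ext f) S q v := rfl

lemma ev_dirDeriv_of_eq {q : S} {v : E} {f : SmoothFn S} {F : E → ℂ}
    (h : ∀ q : S, F q = ev q f) : ev q (dirDeriv v f) = fderivWithin ℝ F S q v := by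
  rw [ev_dirDeriv, fderivWithin_congr (eqOn_ext h) (eqOn_ext h q.2)]

lemma dirDeriv_comm (v w : E) (f : SmoothFn S) :
    dirDeriv v (dirDeriv w f) = dirDeriv w (dirDeriv v f) := ext_ev fun q => by
  have key : ∀ v w : E, ev q (dirDeriv v (dirDeriv w f)) =
      fderivWithin ℝ (fderivWithin ℝ (ext f) S) S q v w := by
    intro v w
    rw [ev_dirDeriv_of_eq (F := fun q => fderivWithin ℝ (ext f) S q w) fun q => rfl]
    have h1 : DifferentiableWithinAt ℝ (fderivWithin ℝ (ext f) S) S q :=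
      ((contDiffOn_ext f).fderivWithin hS.uniqueDiffOn (m := ∞) (by simp)).differentiableOn
        (by simp) q q.2
    rw [fderivWithin_clm_apply (hS.uniqueDiffOn q q.2) h1 (differentiableWithinAt_const _)]
    simp
  rw [key, key]
  exact ((contDiffOn_ext f q) q.2).isSymmSndFDerivWithinAt
    (by simpa using WithTop.coe_le_coe.2 (le_top : (2 : ℕ∞) ≤ ⊤)) hS.uniqueDiffOn
    (hS.subset_closure_interior q.2) q.2 v w

lemma dirDeriv_star (v : E) (f : SmoothFn S) :
    dirDeriv v (star f) = star (dirDeriv v f) := ext_ev fun q => by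
  rw [ev_star, ev_dirDeriv (f := f), ev_dirDeriv_of_eq (F := fun q => conj (ext f q))
    (f := star f) fun q => by rw [ext_apply, ev_star]]
  have := (Complex.conjCLE.toContinuousLinearMap.hasFDerivAt (x := ext f q)).comp_hasFDerivWithinAt
    (q : E) (differentiableWithinAt_ext f q).hasFDerivWithinAt
  have h2 := this.fderivWithin (hS.uniqueDiffOn q q.2)
  exact DFunLike.congr_fun h2 v

lemma ev_dirDeriv_of_hasFDerivWithinAt {q : S} {v : E} {f : SmoothFn S} {F : E → ℂ}
    {F' : E →L[ℝ] ℂ} (h : ∀ q : S, F q = ev q f) (hF : HasFDerivWithinAt F F' S q) :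
    ev q (dirDeriv v f) = F' v := by
  rw [ev_dirDeriv_of_eq h, hF.fderivWithin (hS.uniqueDiffOn q q.2)]

end SmoothFn

end SmoothFn

/-! ### Differential algebra of the Chern connection -/

open Matrix

section Abstract

variable {ι A : Type*} [CommRing A] [StarRing A] [Algebra ℂ A]

variable (ι A) in
/-- Commuting derivations of a commutative `*`-algebra that play the roles of `∂_i`, `∂_{j̄}`
and `∂_t`. -/
structure WirtingerCalculus where
  dz : ι → Derivation ℂ A A
  db : ι → Derivation ℂ A A
  dt : Derivation ℂ A A
  dz_dz : ∀ i j f, dz i (dz j f) = dz j (dz i f)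
  db_db : ∀ i j f, db i (db j f) = db j (db i f)
  db_dz : ∀ i j f, db i (dz j f) = dz j (db i f)
  dt_dz : ∀ i f, dt (dz i f) = dz i (dt f)
  dt_db : ∀ i f, dt (db i f) = db i (dt f)
  star_dz : ∀ i f, star (dz i f) = db i (star f)
  star_dt : ∀ f, star (dt f) = dt (star f)

/-- Entrywise application of a derivation to a matrix. -/
def dM {m k : Type*} (D : Derivation ℂ A A) : Matrix m k A →+ Matrix m k A :=
  D.toLinearMap.toAddMonoidHom.mapMatrix

section dM

variable {m k l : Type*} (D : Derivation ℂ A A)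

omit [StarRing A]

lemma dM_apply (M : Matrix m k A) (i : m) (j : k) : dM D M i j = D (M i j) := rfl

lemma dM_mul [Fintype k] (M : Matrix m k A) (N : Matrix k l A) :
    dM D (M * N) = dM D M * N + M * dM D N := by
  ext i j
  simp only [dM_apply, Matrix.mul_apply, Matrix.add_apply, map_sum, Derivation.leibniz,
    smul_eq_mul, ← Finset.sum_add_distrib]
  exact Finset.sum_congr rfl fun _ _ => by ring

lemma dM_smul (f : A) (M : Matrix m k A) : dM D (f • M) = D f • M + f • dM D M := by
  ext i j
  simp [dM_apply]
  ring

lemma dM_one [DecidableEq m] : dM D (1 : Matrix m m A) = 0 := by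
  ext i j
  by_cases h : i = j <;> simp [dM_apply, h]

lemma dM_comm {D D' : Derivation ℂ A A} (h : ∀ f, D (D' f) = D' (D f)) (M : Matrix m k A) :
    dM D (dM D' M) = dM D' (dM D M) := by
  ext i j
  exact h _

lemma trace_dM [Fintype m] (M : Matrix m m A) : (dM D M).trace = D M.trace := by
  simp [Matrix.trace, dM_apply, map_sum]

end dM

namespace WirtingerCalculus

variable (W : WirtingerCalculus ι A)

lemma star_db (i : ι) (f : A) : star (W.db i f) = W.dz i (star f) := by
  rw [← star_inj, star_star, W.star_dz, star_star]

variable {m k : Type*}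

lemma dM_dz_conjTranspose (i : ι) (M : Matrix m k A) :
    dM (W.dz i) Mᴴ = (dM (W.db i) M)ᴴ := by
  ext a b; simp [dM_apply, star_db]

lemma dM_db_conjTranspose (i : ι) (M : Matrix m k A) :
    dM (W.db i) Mᴴ = (dM (W.dz i) M)ᴴ := by
  ext a b; simp [dM_apply, star_dz]

lemma dM_dt_conjTranspose (M : Matrix m k A) :
    dM W.dt Mᴴ = (dM W.dt M)ᴴ := by
  ext a b; simp [dM_apply, star_dt]

variable [Fintype ι] (H Hi : Matrix ι ι A)

/-- The connection matrix `Γ_i = (∂_i H) H⁻¹`, with entries `(Γ_i)_{jk} = Γ_{ij}^k`. -/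
def conn (i : ι) : Matrix ι ι A := dM (W.dz i) H * Hi

/-- The curvature endomorphism `F_{ij̄} = -∂_{j̄} Γ_i`, with entries `R_{ij̄k}^l`. -/
def curvEnd (i j : ι) : Matrix ι ι A := -dM (W.db j) (W.conn H Hi i)

/-- The mean curvature endomorphism `g^{pq̄} F_{pq̄}`, that is, `S_k^l`. -/
def meanCurv : Matrix ι ι A := ∑ p, ∑ q, Hi q p • W.curvEnd H Hi p q

/-- The Chern covariant derivative `∇_i` on endomorphisms. -/
def nabla (i : ι) (N : Matrix ι ι A) : Matrix ι ι A :=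
  dM (W.dz i) N + N * W.conn H Hi i - W.conn H Hi i * N

/-- The heat operator on `End E`-valued tensors `N_{ij̄}`: the Laplacian is that of the
torsion-twisted connection, whose coefficients `Γ_{ip}^r` in place of `Γ_{pi}^r` act on the
base indices `i`, `j̄`. -/
def heatOp (N : ι → ι → Matrix ι ι A) (i j : ι) : Matrix ι ι A :=
  dM W.dt (N i j) - ∑ p, ∑ q, Hi q p •
    (W.nabla H Hi p (dM (W.db q) (N i j))
      - ∑ r, W.conn H Hi i p r • dM (W.db q) (N r j)
      - ∑ s, star (W.conn H Hi j q s) • W.nabla H Hi p (N i s)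
      + ∑ r, ∑ s, (W.conn H Hi i p r * star (W.conn H Hi j q s)) • N r s)

section nabla

variable {W H Hi}

lemma nabla_sum {κ : Type*} (s : Finset κ) (i : ι) (N : κ → Matrix ι ι A) :
    W.nabla H Hi i (∑ a ∈ s, N a) = ∑ a ∈ s, W.nabla H Hi i (N a) := by
  simp only [nabla, map_sum, Finset.sum_mul, Finset.mul_sum, Finset.sum_add_distrib,
    Finset.sum_sub_distrib]

lemma nabla_add (i : ι) (N N' : Matrix ι ι A) :
    W.nabla H Hi i (N + N') = W.nabla H Hi i N + W.nabla H Hi i N' := by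
  simp only [nabla, map_add]; noncomm_ring

lemma nabla_smul (i : ι) (f : A) (N : Matrix ι ι A) :
    W.nabla H Hi i (f • N) = W.dz i f • N + f • W.nabla H Hi i N := by
  simp only [nabla, dM_smul, Matrix.smul_mul, Matrix.mul_smul, smul_add, smul_sub]
  abel

/-- The commutator `[∇_{j̄}, ∇_i]` is the curvature. -/
lemma db_nabla (i j : ι) (N : Matrix ι ι A) :
    dM (W.db j) (W.nabla H Hi i N) = W.nabla H Hi i (dM (W.db j) N)
      - N * W.curvEnd H Hi i j + W.curvEnd H Hi i j * N := by
  simp only [nabla, curvEnd, map_add, map_sub, dM_mul, dM_comm (W.db_dz j i)]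
  noncomm_ring

end nabla

variable [DecidableEq ι]
variable {H Hi} (h1 : H * Hi = 1) (h2 : Hi * H = 1)

include h1

omit [StarRing A] in
lemma dM_inv (D : Derivation ℂ A A) (h2 : Hi * H = 1) :
    dM D Hi = -(Hi * dM D H * Hi) := by
  have h := dM_mul D Hi H
  rw [h2, dM_one] at h
  calc dM D Hi = dM D Hi * (H * Hi) := by rw [h1, mul_one]
    _ = (dM D Hi * H + Hi * dM D H) * Hi - Hi * dM D H * Hi := by noncomm_ring
    _ = _ := by rw [← h]; simp

include h2

lemma dz_inv (i : ι) : dM (W.dz i) Hi = -(Hi * W.conn H Hi i) := by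
  rw [dM_inv h1 _ h2, conn, Matrix.mul_assoc]

omit h1 in
lemma dz_metric (i : ι) : dM (W.dz i) H = W.conn H Hi i * H := by
  rw [conn, Matrix.mul_assoc, h2, Matrix.mul_one]

/-- Flatness of the `(1,0)`-part of the Chern connection. -/
lemma conn_flat (i p : ι) :
    dM (W.dz i) (W.conn H Hi p) + W.conn H Hi p * W.conn H Hi i =
      dM (W.dz p) (W.conn H Hi i) + W.conn H Hi i * W.conn H Hi p := by
  have key : ∀ i p, dM (W.dz i) (W.conn H Hi p) + W.conn H Hi p * W.conn H Hi i =
      dM (W.dz i) (dM (W.dz p) H) * Hi := by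
    intro i p
    conv_lhs => enter [1]; rw [conn]
    rw [dM_mul, W.dz_inv h1 h2 i]
    simp only [conn]
    noncomm_ring
  rw [key, key, dM_comm (W.dz_dz i p)]

/-- The second Bianchi identity in the fibre-covariant form `∇_i F_{pj̄} = ∇_p F_{ij̄}`; no torsion
appears because the base indices are differentiated by partial derivatives. -/
lemma bianchi (i p j : ι) :
    W.nabla H Hi i (W.curvEnd H Hi p j) = W.nabla H Hi p (W.curvEnd H Hi i j) := by
  have h := congrArg (dM (W.db j)) (W.conn_flat h1 h2 i p)
  simp only [map_add, dM_mul, dM_comm (W.db_dz j _)] at h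
  simp only [nabla, curvEnd, map_neg]
  have h' : ∀ a b c d e f : Matrix ι ι A, a + (b + c) = d + (e + f) →
      -a + -b - -f = -d + -e - -c := by
    intro a b c d e f h
    have : a = d + (e + f) - (b + c) := by rw [← h]; abel
    rw [this]; abel
  simpa using h' _ _ _ _ _ _ h

omit h1 h2 [DecidableEq ι] in
lemma bianchi_bar (i j q : ι) :
    dM (W.db q) (W.curvEnd H Hi i j) = dM (W.db j) (W.curvEnd H Hi i q) := by
  simp only [curvEnd, map_neg, dM_comm (W.db_db q j)]

variable (hflow : dM W.dt H = -(W.meanCurv H Hi * H))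
include hflow

/-- The variation of the Chern connection along the flow. -/
lemma dt_conn (i : ι) :
    dM W.dt (W.conn H Hi i) = -W.nabla H Hi i (W.meanCurv H Hi) := by
  set σ := W.meanCurv H Hi
  rw [conn, dM_mul, dM_comm (W.dt_dz i), hflow, dM_inv h1 _ h2, hflow, nabla, map_neg, dM_mul, conn]
  have e : σ * H * Hi = σ := by rw [Matrix.mul_assoc, h1, Matrix.mul_one]
  simp only [Matrix.neg_mul, Matrix.mul_neg, neg_neg, Matrix.add_mul, Matrix.mul_assoc, h1,
    Matrix.mul_one]
  abel

/-- The evolution of the curvature: up to the reaction terms on the right, the curvature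
endomorphism solves the heat equation. -/
lemma dt_curvEnd (i j : ι) :
    dM W.dt (W.curvEnd H Hi i j) = ∑ p, ∑ q,
      (Hi q p • W.nabla H Hi p (dM (W.db q) (W.curvEnd H Hi i j))
        + W.dz i (Hi q p) • dM (W.db q) (W.curvEnd H Hi p j)
        + W.db j (Hi q p) • W.nabla H Hi p (W.curvEnd H Hi i q)
        + W.db j (W.dz i (Hi q p)) • W.curvEnd H Hi p q
        + Hi q p • (W.curvEnd H Hi p j * W.curvEnd H Hi i q
          - W.curvEnd H Hi i q * W.curvEnd H Hi p j)) := by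
  have e : dM W.dt (W.curvEnd H Hi i j) = dM (W.db j) (W.nabla H Hi i (W.meanCurv H Hi)) := by
    conv_lhs => rw [curvEnd]
    rw [map_neg, dM_comm (W.dt_db j), W.dt_conn h1 h2 hflow, map_neg, neg_neg]
  rw [e, meanCurv, nabla_sum, map_sum]
  refine Finset.sum_congr rfl fun p _ => ?_
  rw [nabla_sum, map_sum]
  refine Finset.sum_congr rfl fun q _ => ?_
  rw [nabla_smul, W.bianchi h1 h2, map_add, dM_smul, dM_smul, db_nabla, W.bianchi_bar p q j,
    W.bianchi_bar i q j]
  simp only [smul_add, smul_sub]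
  abel

end WirtingerCalculus

end Abstract

/-! ### The evolution of the curvature in terms of the heat operator -/

section Abstract

variable {ι A : Type*} [CommRing A] [StarRing A] [Algebra ℂ A]

omit [StarRing A] in
lemma dM_smul_one [DecidableEq ι] (D : Derivation ℂ A A) (f : A) :
    dM D (f • (1 : Matrix ι ι A)) = D f • 1 := by
  rw [dM_smul, dM_one, smul_zero, add_zero]

lemma sum_comm_pairs {ι B : Type*} [Fintype ι] [AddCommMonoid B] (f : ι → ι → ι → ι → B) :
    ∑ p, ∑ q, ∑ r, ∑ s, f r s p q = ∑ p, ∑ q, ∑ r, ∑ s, f p q r s := by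
  have := Finset.sum_comm (s := (Finset.univ : Finset (ι × ι)))
    (t := (Finset.univ : Finset (ι × ι))) (f := fun x y => f y.1 y.2 x.1 x.2)
  simpa only [Fintype.sum_prod_type] using this

namespace WirtingerCalculus

variable (W : WirtingerCalculus ι A) [Fintype ι] [DecidableEq ι]
variable {H Hi : Matrix ι ι A} (h1 : H * Hi = 1) (h2 : Hi * H = 1) (hH : Hᴴ = H)

include h1 h2 hH

omit [Algebra ℂ A] h2 in
lemma conjTranspose_inv : Hiᴴ = Hi := by
  have e : Hiᴴ * H = 1 := by
    have := congrArg conjTranspose h1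
    rwa [conjTranspose_mul, hH, conjTranspose_one] at this
  calc Hiᴴ = Hiᴴ * (H * Hi) := by rw [h1, mul_one]
    _ = _ := by rw [← Matrix.mul_assoc, e, one_mul]

lemma db_inv (j : ι) : dM (W.db j) Hi = -((W.conn H Hi j)ᴴ * Hi) := by
  have := W.dM_db_conjTranspose j Hi
  rw [conjTranspose_inv h1 hH] at this
  rw [this, W.dz_inv h1 h2, conjTranspose_neg, conjTranspose_mul, conjTranspose_inv h1 hH]

omit h1 in
lemma db_metric (j : ι) : dM (W.db j) H = H * (W.conn H Hi j)ᴴ := by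
  have := W.dM_db_conjTranspose j H
  rw [hH] at this
  rw [this, W.dz_metric h2, conjTranspose_mul, hH]

/-- Second derivatives of the inverse metric: the curvature with one index pair raised, plus
the term that completes the square in the twisted Laplacian. -/
lemma db_dz_inv (i j : ι) : dM (W.db j) (dM (W.dz i) Hi) =
    (W.conn H Hi j)ᴴ * Hi * W.conn H Hi i + Hi * W.curvEnd H Hi i j := by
  rw [W.dz_inv h1 h2, map_neg, dM_mul, W.db_inv h1 h2 hH, curvEnd]
  noncomm_ring

omit [DecidableEq ι] h1 h2 in
lemma metric_mul_meanCurv_conjTranspose (hflow : dM W.dt H = -(W.meanCurv H Hi * H)) :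
    H * (W.meanCurv H Hi)ᴴ = W.meanCurv H Hi * H := by
  have h := W.dM_dt_conjTranspose H
  rw [hH, hflow, conjTranspose_neg, neg_inj, conjTranspose_mul, hH] at h
  exact h.symm

/-- The reaction terms of the curvature: they contain `F_{ij̄}`, `F_{iq̄}` or `F_{pj̄}` with the base
indices `i`, `j̄` in their original slots. -/
theorem heatOp_curvEnd (hflow : dM W.dt H = -(W.meanCurv H Hi * H)) (i j : ι) :
    W.heatOp H Hi (W.curvEnd H Hi) i j = ∑ p, ∑ q,
      ((Hi * W.curvEnd H Hi i j) q p • W.curvEnd H Hi p q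
        + Hi q p • (W.curvEnd H Hi p j * W.curvEnd H Hi i q
          - W.curvEnd H Hi i q * W.curvEnd H Hi p j)) := by
  have e1 : ∀ p q, W.dz i (Hi q p) = -∑ r, Hi q r * W.conn H Hi i r p := fun p q => by
    have := congrFun (congrFun (W.dz_inv h1 h2 i) q) p
    simpa [dM_apply, Matrix.mul_apply] using this
  have e2 : ∀ p q, W.db j (Hi q p) = -∑ s, star (W.conn H Hi j s q) * Hi s p := fun p q => by
    have := congrFun (congrFun (W.db_inv h1 h2 hH j) q) p
    simpa [dM_apply, Matrix.mul_apply] using this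
  have e3 : ∀ p q, W.db j (W.dz i (Hi q p)) = (∑ r, ∑ s, Hi s r *
      (W.conn H Hi i r p * star (W.conn H Hi j s q))) + (Hi * W.curvEnd H Hi i j) q p :=
    fun p q => by
    have := congrFun (congrFun (W.db_dz_inv h1 h2 hH i j) q) p
    rw [dM_apply, dM_apply] at this
    rw [this, Matrix.add_apply, Matrix.mul_apply]
    congr 1
    refine Finset.sum_congr rfl fun r _ => ?_
    rw [Matrix.mul_apply, Finset.sum_mul]
    refine Finset.sum_congr rfl fun s _ => ?_
    rw [conjTranspose_apply]
    ring
  -- the derivatives of the inverse metric become the connection terms of the heat operator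
  have s1 : ∑ p, ∑ q, W.dz i (Hi q p) • dM (W.db q) (W.curvEnd H Hi p j) =
      -∑ p, ∑ q, Hi q p • ∑ r, W.conn H Hi i p r • dM (W.db q) (W.curvEnd H Hi r j) := by
    simp only [e1, neg_smul, Finset.sum_neg_distrib, Finset.sum_smul, Finset.smul_sum, smul_smul]
    rw [neg_inj, Finset.sum_comm, Finset.sum_comm (s := Finset.univ)
      (f := fun p q => ∑ r, (Hi q p * W.conn H Hi i p r) • _)]
    exact Finset.sum_congr rfl fun q _ => Finset.sum_comm
  have s2 : ∑ p, ∑ q, W.db j (Hi q p) • W.nabla H Hi p (W.curvEnd H Hi i q) =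
      -∑ p, ∑ q, Hi q p • ∑ s, star (W.conn H Hi j q s) •
        W.nabla H Hi p (W.curvEnd H Hi i s) := by
    simp only [e2, neg_smul, Finset.sum_neg_distrib, Finset.sum_smul, Finset.smul_sum, smul_smul]
    rw [neg_inj]
    refine Finset.sum_congr rfl fun p _ => ?_
    rw [Finset.sum_comm]
    simp only [mul_comm]
  have s3 : ∑ p, ∑ q, W.db j (W.dz i (Hi q p)) • W.curvEnd H Hi p q =
      (∑ p, ∑ q, Hi q p • ∑ r, ∑ s, (W.conn H Hi i p r * star (W.conn H Hi j q s)) •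
        W.curvEnd H Hi r s) + ∑ p, ∑ q, (Hi * W.curvEnd H Hi i j) q p • W.curvEnd H Hi p q := by
    simp only [e3, add_smul, Finset.sum_add_distrib, Finset.sum_smul, Finset.smul_sum, smul_smul]
    rw [add_left_inj]
    exact sum_comm_pairs _
  rw [heatOp, W.dt_curvEnd h1 h2 hflow]
  simp only [Finset.sum_add_distrib, smul_add, smul_sub, Finset.sum_sub_distrib, s1, s2, s3]
  abel

omit h1 h2 hH

omit [DecidableEq ι] in
lemma heatOp_add (N N' : ι → ι → Matrix ι ι A) (i j : ι) :
    W.heatOp H Hi (fun i j => N i j + N' i j) i j =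
      W.heatOp H Hi N i j + W.heatOp H Hi N' i j := by
  simp only [heatOp, map_add, nabla_add, smul_add, smul_sub, Finset.sum_add_distrib,
    Finset.sum_sub_distrib]
  abel

omit [DecidableEq ι] in
/-- The product rule for functions of time alone. -/
lemma heatOp_smul (c : A) (hz : ∀ i, W.dz i c = 0) (hb : ∀ i, W.db i c = 0)
    (N : ι → ι → Matrix ι ι A) (i j : ι) :
    W.heatOp H Hi (fun i j => c • N i j) i j = W.dt c • N i j + c • W.heatOp H Hi N i j := by
  simp only [heatOp, dM_smul, nabla_smul, hz, hb, zero_smul, zero_add, smul_add, smul_sub,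
    Finset.smul_sum, smul_comm c]
  abel

lemma nabla_smul_one (i : ι) (f : A) :
    W.nabla H Hi i (f • (1 : Matrix ι ι A)) = W.dz i f • 1 := by
  simp [nabla, dM_smul_one]

omit [DecidableEq ι] in
lemma trace_nabla (i : ι) (N : Matrix ι ι A) :
    (W.nabla H Hi i N).trace = W.dz i N.trace := by
  rw [nabla, trace_sub, trace_add, trace_dM, Matrix.trace_mul_comm N]
  abel

lemma heatOp_trace (N : ι → ι → Matrix ι ι A) (i j : ι) :
    W.heatOp H Hi (fun i j => (N i j).trace • (1 : Matrix ι ι A)) i j =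
      (W.heatOp H Hi N i j).trace • 1 := by
  simp only [heatOp, dM_smul_one, nabla_smul_one, smul_smul, ← Finset.sum_smul, ← sub_smul,
    ← add_smul, trace_nabla, trace_sub, trace_sum, trace_smul, trace_add, trace_dM, smul_eq_mul]

end WirtingerCalculus

end Abstract

/-! ### Contraction with sections that are parallel at a point -/

section Abstract

variable {ι A : Type*} [CommRing A] [StarRing A] [Algebra ℂ A]

lemma sum_contract_left {ι A X : Type*} [Fintype ι] [CommRing A] [AddCommGroup X] [Module A X]
    (a b : ι → A) (G : ι → ι → A) (D : ι → ι → X) :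
    ∑ i, ∑ j, (a i * b j) • ∑ r, G i r • D r j =
      ∑ i, ∑ j, ((∑ k, a k * G k i) * b j) • D i j := by
  simp only [Finset.smul_sum, smul_smul, Finset.sum_mul, Finset.sum_smul]
  rw [Finset.sum_comm]
  conv_rhs => rw [Finset.sum_comm]
  refine Finset.sum_congr rfl fun j _ => ?_
  rw [Finset.sum_comm]
  refine Finset.sum_congr rfl fun i _ => Finset.sum_congr rfl fun k _ => ?_
  rw [mul_right_comm]

lemma sum_contract_right {ι A X : Type*} [Fintype ι] [CommRing A] [AddCommGroup X] [Module A X]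
    (a b : ι → A) (K : ι → ι → A) (D : ι → ι → X) :
    ∑ i, ∑ j, (a i * b j) • ∑ s, K j s • D i s =
      ∑ i, ∑ j, (a i * ∑ k, b k * K k j) • D i j := by
  refine Finset.sum_congr rfl fun i _ => ?_
  simp only [Finset.smul_sum, smul_smul, Finset.mul_sum, Finset.sum_smul]
  rw [Finset.sum_comm]
  simp only [mul_assoc]

namespace WirtingerCalculus

variable (W : WirtingerCalculus ι A) [Fintype ι] [DecidableEq ι]
variable {H Hi : Matrix ι ι A} (h1 : H * Hi = 1) (h2 : Hi * H = 1) (hH : Hᴴ = H)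

/-- The contraction `u^i ū^j N_{ij̄}` over the base indices. -/
def contract (u : ι → A) (N : ι → ι → Matrix ι ι A) : Matrix ι ι A :=
  ∑ i, ∑ j, (u i * star (u j)) • N i j

/-- The parabolic operator `∂_t - g^{pq̄} ∂_p ∂_{q̄}`. -/
def heat (Hi : Matrix ι ι A) {m k : Type*} (M : Matrix m k A) : Matrix m k A :=
  dM W.dt M - ∑ p, ∑ q, Hi q p • dM (W.dz p) (dM (W.db q) M)

variable {B : Type*} [CommRing B] (ev : A →+* B)

omit [StarRing A] [Algebra ℂ A] in
lemma map_smul_ev {m k : Type*} (f : A) (M : Matrix m k A) :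
    (f • M).map ev = ev f • M.map ev := by
  ext; simp

omit [StarRing A] [Algebra ℂ A] in
lemma map_sum_ev {m k κ : Type*} (s : Finset κ) (M : κ → Matrix m k A) :
    (∑ a ∈ s, M a).map ev = ∑ a ∈ s, (M a).map ev :=
  map_sum (AddMonoidHom.mapMatrix (m := m) (n := k) ev.toAddMonoidHom) M s

include h1 h2 hH in
/-- For a section `x` of the fibre that is parallel at the evaluation point, the heat operator acts
on `x M H x*` through the covariant heat operator of `M`: under the flow the evolution of the
fibre metric cancels the curvature produced by `∂_p ∂_{q̄}` of `x`. -/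
lemma ev_heat_sandwich (hflow : dM W.dt H = -(W.meanCurv H Hi * H)) {m : Type*}
    (x : Matrix m ι A) (hxb : ∀ q, dM (W.db q) x = 0) (hxt : dM W.dt x = 0)
    (hx : ∀ p, (dM (W.dz p) x + x * W.conn H Hi p).map ev = 0)
    (hx' : ∀ p, (dM (W.dz p) x + x * W.conn H Hi p)ᴴ.map ev = 0) (M : Matrix ι ι A) :
    (W.heat Hi (x * M * H * xᴴ)).map ev =
      (x * (dM W.dt M - ∑ p, ∑ q, Hi q p • W.nabla H Hi p (dM (W.db q) M)) * H * xᴴ).map ev := by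
  -- `δ` is the covariant derivative of `x`, which vanishes at the evaluation point
  set δ : ι → Matrix m ι A := fun p => dM (W.dz p) x + x * W.conn H Hi p with hδ
  set σ := W.meanCurv H Hi with hσ
  have hdz : ∀ p, dM (W.dz p) x = δ p - x * W.conn H Hi p := fun p => by simp [hδ]
  have hdzs : ∀ p, dM (W.dz p) xᴴ = 0 := fun p => by
    rw [W.dM_dz_conjTranspose, hxb, conjTranspose_zero]
  have hdbs : ∀ q, dM (W.db q) xᴴ = (δ q)ᴴ - (W.conn H Hi q)ᴴ * xᴴ := fun q => by
    rw [W.dM_db_conjTranspose, hdz, conjTranspose_sub, conjTranspose_mul]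
  have hdts : dM W.dt xᴴ = 0 := by rw [W.dM_dt_conjTranspose, hxt, conjTranspose_zero]
  have hδs : ∀ p q, dM (W.dz p) (δ q)ᴴ = -((W.curvEnd H Hi q p)ᴴ * xᴴ) := fun p q => by
    rw [W.dM_dz_conjTranspose]
    simp only [hδ, map_add, dM_comm (W.db_dz p q), dM_mul, hxb, map_zero, zero_add,
      Matrix.zero_mul]
    rw [← conjTranspose_mul, ← conjTranspose_neg, curvEnd, Matrix.mul_neg, neg_neg]
  have hb : ∀ q, dM (W.db q) (x * M * H * xᴴ) =
      x * dM (W.db q) M * H * xᴴ + x * M * H * (δ q)ᴴ := fun q => by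
    simp only [dM_mul, hxb, hdbs, W.db_metric h2 hH, Matrix.zero_mul, zero_add, Matrix.mul_add,
      Matrix.mul_sub, Matrix.mul_assoc]
    abel
  have hzb : ∀ p q, dM (W.dz p) (dM (W.db q) (x * M * H * xᴴ)) =
      x * W.nabla H Hi p (dM (W.db q) M) * H * xᴴ - x * M * H * ((W.curvEnd H Hi q p)ᴴ * xᴴ)
        + (δ p * dM (W.db q) M * H * xᴴ + dM (W.dz p) (x * M * H) * (δ q)ᴴ) := fun p q => by
    rw [hb, map_add, dM_mul _ (x * M * H), hδs]
    simp only [dM_mul, hdzs, W.dz_metric h2, hdz, nabla, Matrix.add_mul, Matrix.mul_add,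
      Matrix.sub_mul, Matrix.mul_sub, Matrix.mul_assoc, Matrix.mul_zero, add_zero,
      Matrix.mul_neg]
    abel
  -- the curvature terms add up to the mean curvature, which the flow compensates
  have hcurv : ∑ p, ∑ q, Hi q p • (x * M * H * ((W.curvEnd H Hi q p)ᴴ * xᴴ)) =
      x * M * (σ * H) * xᴴ := by
    rw [← W.metric_mul_meanCurv_conjTranspose hH hflow]
    have hs : (W.meanCurv H Hi)ᴴ = ∑ p, ∑ q, Hi q p • (W.curvEnd H Hi q p)ᴴ := by
      rw [meanCurv, conjTranspose_sum]
      simp only [conjTranspose_sum, conjTranspose_smul]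
      rw [Finset.sum_comm]
      refine Finset.sum_congr rfl fun p _ => Finset.sum_congr rfl fun q _ => ?_
      rw [← conjTranspose_apply Hi, conjTranspose_inv h1 hH]
    rw [hs]
    simp only [Matrix.mul_sum, Matrix.sum_mul, Matrix.mul_smul, Matrix.smul_mul,
      Matrix.mul_assoc]
  have ht : dM W.dt (x * M * H * xᴴ) = x * dM W.dt M * H * xᴴ - x * M * (σ * H) * xᴴ := by
    simp only [dM_mul, hxt, hdts, hflow, Matrix.zero_mul, zero_add, Matrix.mul_zero, add_zero,
      Matrix.add_mul, Matrix.mul_neg, Matrix.neg_mul]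
    abel
  have hzero : (∑ p, ∑ q, Hi q p • (δ p * dM (W.db q) M * H * xᴴ
      + dM (W.dz p) (x * M * H) * (δ q)ᴴ)).map ev = 0 := by
    rw [map_sum_ev]
    refine Finset.sum_eq_zero fun p _ => ?_
    rw [map_sum_ev]
    refine Finset.sum_eq_zero fun q _ => ?_
    rw [map_smul_ev, Matrix.map_add _ (map_add ev), Matrix.map_mul, Matrix.map_mul, Matrix.map_mul,
      Matrix.map_mul, hx, hx']
    simp
  have hfin : W.heat Hi (x * M * H * xᴴ) =
      x * (dM W.dt M - ∑ p, ∑ q, Hi q p • W.nabla H Hi p (dM (W.db q) M)) * H * xᴴ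
      - ∑ p, ∑ q, Hi q p • (δ p * dM (W.db q) M * H * xᴴ
      + dM (W.dz p) (x * M * H) * (δ q)ᴴ) := by
    rw [heat, ht]
    simp only [hzb, smul_add, smul_sub, Finset.sum_add_distrib, Finset.sum_sub_distrib, hcurv,
      Matrix.mul_sub, Matrix.sub_mul, Matrix.mul_sum, Matrix.sum_mul, Matrix.mul_smul,
      Matrix.smul_mul]
    abel
  rw [hfin, Matrix.map_sub _ (map_sub ev), hzero, sub_zero]

omit [DecidableEq ι] in
/-- For a base vector field `u` that is parallel for the torsion-twisted connection at the
evaluation point, the covariant heat operator acts on `u^i ū^j N_{ij̄}` through `heatOp`. -/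
lemma ev_heat_contract (u : ι → A) (hub : ∀ q r, W.db q (u r) = 0) (hut : ∀ r, W.dt (u r) = 0)
    (hu : ∀ p r, ev (W.dz p (u r)) = -ev (∑ i, u i * W.conn H Hi i p r))
    (hu' : ∀ p r, ev (star (W.dz p (u r))) = -ev (star (∑ i, u i * W.conn H Hi i p r)))
    (N : ι → ι → Matrix ι ι A) :
    (dM W.dt (contract u N) - ∑ p, ∑ q, Hi q p •
      W.nabla H Hi p (dM (W.db q) (contract u N))).map ev =
      (contract u (W.heatOp H Hi N)).map ev := by
  have hus : ∀ p r, W.dz p (star (u r)) = 0 := fun p r => by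
    rw [← W.star_db, hub, star_zero]
  have huts : ∀ r, W.dt (star (u r)) = 0 := fun r => by rw [← W.star_dt, hut, star_zero]
  have hubs : ∀ q r, W.db q (star (u r)) = star (W.dz q (u r)) := fun q r => by rw [W.star_dz]
  have hdd : ∀ p q r, W.dz p (star (W.dz q (u r))) = 0 := fun p q r => by
    rw [← W.star_db, W.db_dz, hub, map_zero, star_zero]
  have ht : dM W.dt (contract u N) = contract u (fun i j => dM W.dt (N i j)) := by
    simp [contract, dM_smul, hut, huts]
  have hzb : ∀ p q, W.nabla H Hi p (dM (W.db q) (contract u N)) =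
      ∑ i, ∑ j, ((u i * star (u j)) • W.nabla H Hi p (dM (W.db q) (N i j))
        + (W.dz p (u i) * star (u j)) • dM (W.db q) (N i j)
        + (u i * star (W.dz q (u j))) • W.nabla H Hi p (N i j)
        + (W.dz p (u i) * star (W.dz q (u j))) • N i j) := fun p q => by
    rw [contract, map_sum, nabla_sum]
    refine Finset.sum_congr rfl fun i _ => ?_
    rw [map_sum, nabla_sum]
    refine Finset.sum_congr rfl fun j _ => ?_
    simp only [dM_smul, nabla_add, nabla_smul, Derivation.leibniz, hub, hus, hubs, hdd,
      smul_eq_mul, mul_zero, zero_mul, add_zero, zero_add, mul_comm (star _)]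
    module
  have key : ∀ p q, (W.nabla H Hi p (dM (W.db q) (contract u N))).map ev =
      (contract u fun i j => W.nabla H Hi p (dM (W.db q) (N i j))
      - ∑ r, W.conn H Hi i p r • dM (W.db q) (N r j)
      - ∑ s, star (W.conn H Hi j q s) • W.nabla H Hi p (N i s)
      + ∑ r, ∑ s, (W.conn H Hi i p r * star (W.conn H Hi j q s)) • N r s).map ev := fun p q => by
    rw [hzb]
    simp only [mul_smul (W.conn H Hi _ p _), ← Finset.smul_sum]
    simp only [contract, smul_add, smul_sub, Finset.sum_add_distrib, Finset.sum_sub_distrib,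
      sum_contract_left u, sum_contract_right _ (fun j => star (u j))]
    ext a b
    simp only [Matrix.map_apply, Matrix.add_apply, Matrix.sub_apply, Matrix.sum_apply,
      Matrix.smul_apply, smul_eq_mul, map_add, map_sub, map_sum, map_mul, hu, hu', star_sum,
      star_mul', neg_mul, mul_neg, neg_neg, Finset.sum_neg_distrib]
    ring
  have hsplit : contract u (W.heatOp H Hi N) = contract u (fun i j => dM W.dt (N i j))
      - ∑ p, ∑ q, Hi q p • contract u (fun i j => W.nabla H Hi p (dM (W.db q) (N i j))
      - ∑ r, W.conn H Hi i p r • dM (W.db q) (N r j)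
      - ∑ s, star (W.conn H Hi j q s) • W.nabla H Hi p (N i s)
      + ∑ r, ∑ s, (W.conn H Hi i p r * star (W.conn H Hi j q s)) • N r s) := by
    simp only [contract, heatOp, smul_sub _ (dM W.dt _), Finset.sum_sub_distrib]
    rw [sub_right_inj]
    simp only [Finset.smul_sum (r := (_ * star _ : A)), Finset.smul_sum (r := Hi _ _)]
    rw [sum_comm_pairs]
    simp only [smul_comm (Hi _ _)]
  rw [ht, hsplit, Matrix.map_sub _ (map_sub ev), Matrix.map_sub _ (map_sub ev), map_sum_ev,
    map_sum_ev]
  congr 1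
  refine Finset.sum_congr rfl fun p _ => ?_
  rw [map_sum_ev, map_sum_ev]
  refine Finset.sum_congr rfl fun q _ => ?_
  rw [map_smul_ev, map_smul_ev, key]

end WirtingerCalculus

end Abstract

/-! ### Sesquilinear forms -/

section LinearAlgebra

variable {ι : Type*} [Fintype ι]

/-- The sesquilinear form `A_{kl̄} x^k ȳ^l` of a matrix. -/
def sesq (A : Matrix ι ι ℂ) (x y : ι → ℂ) : ℂ := ∑ i, ∑ j, A i j * x i * conj (y j)

lemma sesq_eq_dotProduct (A : Matrix ι ι ℂ) (x y : ι → ℂ) :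
    sesq A x y = x ⬝ᵥ (A *ᵥ star y) := by
  simp only [sesq, dotProduct, mulVec, Finset.mul_sum, Pi.star_apply, RCLike.star_def]
  exact Finset.sum_congr rfl fun i _ => Finset.sum_congr rfl fun j _ => by ring

lemma sesq_add (A B : Matrix ι ι ℂ) (x y : ι → ℂ) :
    sesq (A + B) x y = sesq A x y + sesq B x y := by
  simp only [sesq, Matrix.add_apply, add_mul, Finset.sum_add_distrib]

lemma sesq_smul (c : ℂ) (A : Matrix ι ι ℂ) (x y : ι → ℂ) :
    sesq (c • A) x y = c * sesq A x y := by
  simp only [sesq, Matrix.smul_apply, smul_eq_mul, Finset.mul_sum, mul_assoc]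

lemma sesq_neg (A : Matrix ι ι ℂ) (x y : ι → ℂ) : sesq (-A) x y = -sesq A x y := by
  simp [sesq]

lemma sesq_add_left (A : Matrix ι ι ℂ) (x x' y : ι → ℂ) :
    sesq A (x + x') y = sesq A x y + sesq A x' y := by
  simp only [sesq_eq_dotProduct, add_dotProduct]

lemma sesq_smul_left (A : Matrix ι ι ℂ) (c : ℂ) (x y : ι → ℂ) :
    sesq A (c • x) y = c * sesq A x y := by
  simp only [sesq_eq_dotProduct, smul_dotProduct, smul_eq_mul]

lemma sesq_add_right (A : Matrix ι ι ℂ) (x y y' : ι → ℂ) :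
    sesq A x (y + y') = sesq A x y + sesq A x y' := by
  simp only [sesq_eq_dotProduct, star_add, mulVec_add, dotProduct_add]

lemma sesq_smul_right (A : Matrix ι ι ℂ) (c : ℂ) (x y : ι → ℂ) :
    sesq A x (c • y) = conj c * sesq A x y := by
  simp only [sesq_eq_dotProduct, star_smul, mulVec_smul, dotProduct_smul, smul_eq_mul]
  rfl

lemma conj_sesq {A : Matrix ι ι ℂ} (hA : Aᴴ = A) (x y : ι → ℂ) :
    conj (sesq A x y) = sesq A y x := by
  simp only [sesq, map_sum, map_mul, Complex.conj_conj]
  rw [Finset.sum_comm]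
  refine Finset.sum_congr rfl fun i _ => Finset.sum_congr rfl fun j _ => ?_
  have : conj (A j i) = A i j := by
    conv_rhs => rw [← hA]
    rfl
  rw [this]; ring

lemma sesq_single [DecidableEq ι] (A : Matrix ι ι ℂ) (k l : ι) :
    sesq A (Pi.single k 1) (Pi.single l 1) = A k l := by
  have : star (Pi.single l 1 : ι → ℂ) = Pi.single l 1 := by
    ext i; by_cases h : i = l
    · subst h; simp
    · simp [h]
  rw [sesq_eq_dotProduct, this]
  simp

lemma sesq_vecMul (A C : Matrix ι ι ℂ) (x y : ι → ℂ) :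
    sesq A (x ᵥ* C) (y ᵥ* C) = sesq (C * A * Cᴴ) x y := by
  rw [sesq_eq_dotProduct, sesq_eq_dotProduct, star_vecMul, ← dotProduct_mulVec, mulVec_mulVec,
    mulVec_mulVec, Matrix.mul_assoc]

/-- Polarisation: a Hermitian form dominated on the diagonal by a quadratic form satisfies the
Cauchy–Schwarz inequality with respect to it. -/
lemma norm_sesq_sq_le {A P : Matrix ι ι ℂ} (hA : Aᴴ = A)
    (h : ∀ u, |(sesq A u u).re| ≤ (sesq P u u).re) (u v : ι → ℂ) :
    ‖sesq A u v‖ ^ 2 ≤ (sesq P u u).re * (sesq P v v).re := by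
  have hpol : ∀ u v, 2 * (sesq A u v).re ≤ (sesq P u u).re + (sesq P v v).re := by
    intro u v
    have h1 := (le_abs_self _).trans (h (u + v))
    have h2 := (neg_le_abs _).trans (h (u + (-1 : ℂ) • v))
    have h3 : (sesq A v u).re = (sesq A u v).re := by rw [← conj_sesq hA u v, Complex.conj_re]
    simp only [sesq_add_left, sesq_add_right, sesq_smul_left, sesq_smul_right, map_neg, map_one,
      neg_mul, one_mul, Complex.add_re, Complex.neg_re] at h1 h2
    linarith
  set N := ‖sesq A u v‖ ^ 2 with hN
  have hq : ∀ s : ℝ, 0 ≤ (N * (sesq P u u).re) * (s * s) + (-(2 * N)) * s + (sesq P v v).re := by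
    intro s
    -- rotate `u` by the phase of `sesq A u v` and scale it by `s`
    have h1 := hpol (((s : ℂ) * conj (sesq A u v)) • u) v
    have e1 : (s : ℂ) * conj (sesq A u v) * sesq A u v = ((s * N : ℝ) : ℂ) := by
      rw [mul_assoc, ← Complex.normSq_eq_conj_mul_self, Complex.normSq_eq_norm_sq, ← hN]
      push_cast; rfl
    have e2 : conj ((s : ℂ) * conj (sesq A u v)) * ((s : ℂ) * conj (sesq A u v) * sesq P u u) =
        ((s * s * N : ℝ) : ℂ) * sesq P u u := by
      rw [map_mul, Complex.conj_conj, Complex.conj_ofReal]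
      have : (s : ℂ) * sesq A u v * (s * conj (sesq A u v) * sesq P u u) =
        s * (s * conj (sesq A u v) * sesq A u v) * sesq P u u := by ring
      rw [this, e1]; push_cast; ring
    simp only [sesq_smul_left, sesq_smul_right, e1, e2, Complex.re_ofReal_mul,
      Complex.ofReal_re] at h1
    linarith
  have hd := discrim_le_zero hq
  have h0 : ∀ u, 0 ≤ (sesq P u u).re := fun u => (abs_nonneg _).trans (h u)
  have hN0 : 0 ≤ N := by positivity
  rcases hN0.eq_or_lt with h' | h'
  · rw [← h']; exact mul_nonneg (h0 u) (h0 v)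
  · unfold discrim at hd
    have : N * N ≤ N * ((sesq P u u).re * (sesq P v v).re) := by linarith
    exact le_of_mul_le_mul_left this h'

lemma norm_sesq_sq_le_self {A : Matrix ι ι ℂ} (hA : Aᴴ = A) (h : ∀ u, 0 ≤ (sesq A u u).re)
    (u v : ι → ℂ) : ‖sesq A u v‖ ^ 2 ≤ (sesq A u u).re * (sesq A v v).re :=
  norm_sesq_sq_le hA (fun u => (abs_of_nonneg (h u)).le) u v

variable [DecidableEq ι]

/-- `H` is a Hermitian inner product with inverse `Hi`. -/
structure IsInnerPair (H Hi : Matrix ι ι ℂ) : Prop where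
  herm : Hᴴ = H
  pos : ∀ x, x ≠ 0 → 0 < (sesq H x x).re
  mul_inv : H * Hi = 1
  inv_mul : Hi * H = 1

namespace IsInnerPair

variable {H Hi : Matrix ι ι ℂ} (h : IsInnerPair H Hi)
include h

lemma nonneg (x : ι → ℂ) : 0 ≤ (sesq H x x).re := by
  by_cases hx : x = 0
  · simp [hx, sesq]
  · exact (h.pos x hx).le

lemma inv_herm : Hiᴴ = Hi := by
  have e : Hiᴴ * H = 1 := by
    have := congrArg conjTranspose h.mul_inv
    rwa [conjTranspose_mul, h.herm, conjTranspose_one] at this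
  calc Hiᴴ = Hiᴴ * (H * Hi) := by rw [h.mul_inv, mul_one]
    _ = _ := by rw [← Matrix.mul_assoc, e, one_mul]

open scoped ComplexOrder MatrixOrder in
/-- The rows of `C` are an orthonormal basis, and they factorise the inverse metric. -/
lemma exists_basis : ∃ C : Matrix ι ι ℂ, Hi = Cᴴ * C := by
  have hps : H.PosSemidef := by
    refine Matrix.PosSemidef.of_dotProduct_mulVec_nonneg h.herm fun x => ?_
    have e : star x ⬝ᵥ (H *ᵥ x) = sesq H (star x) (star x) := by
      rw [sesq_eq_dotProduct, star_star]
    rw [e, Complex.nonneg_iff]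
    refine ⟨h.nonneg _, ?_⟩
    have := congrArg Complex.im (conj_sesq h.herm (star x) (star x))
    rw [Complex.conj_im] at this
    linarith
  have hi : Hi.PosSemidef := by
    rw [← Matrix.inv_eq_right_inv h.mul_inv]
    exact hps.inv
  obtain ⟨C, hC⟩ := CStarAlgebra.nonneg_iff_eq_star_mul_self.1 hi.nonneg
  exact ⟨C, hC⟩

omit h in
lemma trace_mul_eq_sum_sesq {C : Matrix ι ι ℂ} (hC : Hi = Cᴴ * C) (R : Matrix ι ι ℂ) :
    (R * Hi).trace = ∑ a, sesq R (C a) (C a) := by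
  rw [hC, ← Matrix.mul_assoc, Matrix.trace_mul_comm, ← Matrix.mul_assoc, Matrix.trace]
  refine Finset.sum_congr rfl fun a _ => ?_
  rw [diag_apply, ← sesq_single (C * R * Cᴴ), ← sesq_vecMul]
  simp [Matrix.row_def]

/-- Components are controlled by the inner product and its inverse. -/
lemma norm_sq_apply_le (x : ι → ℂ) (k : ι) :
    ‖x k‖ ^ 2 ≤ (sesq H x x).re * (Hi k k).re := by
  have e1 : sesq H x (star fun j => Hi j k) = x k := by
    rw [sesq_eq_dotProduct, star_star]
    have : H *ᵥ (fun j => Hi j k) = Pi.single k 1 := by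
      ext i
      have := congrFun (congrFun h.mul_inv i) k
      rw [Matrix.mul_apply, Matrix.one_apply] at this
      simpa [mulVec, dotProduct, Pi.single_apply] using this
    rw [this]; simp
  have e2 : sesq H (star fun j => Hi j k) (star fun j => Hi j k) = Hi k k := by
    rw [sesq_eq_dotProduct, star_star]
    have : H *ᵥ (fun j => Hi j k) = Pi.single k 1 := by
      ext i
      have := congrFun (congrFun h.mul_inv i) k
      rw [Matrix.mul_apply, Matrix.one_apply] at this
      simpa [mulVec, dotProduct, Pi.single_apply] using this
    rw [this]
    have := congrFun (congrFun h.inv_herm k) k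
    simpa using this
  have := norm_sesq_sq_le_self h.herm h.nonneg x (star fun j => Hi j k)
  rwa [e1, e2] at this

/-- A non-negative Hermitian form is bounded by its trace. -/
lemma sesq_le_trace {A : Matrix ι ι ℂ} (hA : Aᴴ = A) (hpos : ∀ x, 0 ≤ (sesq A x x).re)
    (x : ι → ℂ) : (sesq A x x).re ≤ (sesq H x x).re * (A * Hi).trace.re := by
  obtain ⟨C, hC⟩ := h.exists_basis
  set ξ : ι → ℂ := x ᵥ* (H * Cᴴ) with hξ
  have hx : x = ξ ᵥ* C := by
    rw [hξ, vecMul_vecMul, Matrix.mul_assoc, ← hC, h.mul_inv, vecMul_one]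
  have hnorm : (sesq H x x).re = ∑ a, ‖ξ a‖ ^ 2 := by
    have e : sesq 1 ξ ξ = sesq H x x := by
      rw [hξ, sesq_vecMul, conjTranspose_mul, conjTranspose_conjTranspose, h.herm, Matrix.mul_one,
        Matrix.mul_assoc, ← Matrix.mul_assoc Cᴴ, ← hC, h.inv_mul, Matrix.mul_one]
    rw [← e]
    simp only [sesq, Matrix.one_apply, ite_mul, one_mul, zero_mul, Finset.sum_ite_eq,
      Finset.mem_univ, if_true, Complex.re_sum]
    refine Finset.sum_congr rfl fun a _ => ?_
    rw [mul_comm, ← Complex.normSq_eq_conj_mul_self, Complex.ofReal_re, Complex.normSq_eq_norm_sq]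
  have hab : ∀ a b, (C * A * Cᴴ) a b = sesq A (C a) (C b) := fun a b => by
    rw [← sesq_single (C * A * Cᴴ), ← sesq_vecMul]; simp [Matrix.row_def]
  rw [trace_mul_eq_sum_sesq hC, hnorm, Complex.re_sum]
  calc (sesq A x x).re ≤ ‖sesq (C * A * Cᴴ) ξ ξ‖ := by
        rw [hx, sesq_vecMul]; exact Complex.re_le_norm _
    _ ≤ ∑ a, ∑ b, (‖ξ a‖ * √(sesq A (C a) (C a)).re) * (‖ξ b‖ * √(sesq A (C b) (C b)).re) := by
        refine (norm_sum_le _ _).trans (Finset.sum_le_sum fun a _ => (norm_sum_le _ _).trans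
          (Finset.sum_le_sum fun b _ => ?_))
        rw [hab, norm_mul, norm_mul, RCLike.norm_conj]
        have := Real.le_sqrt_of_sq_le (norm_sesq_sq_le_self hA hpos (C a) (C b))
        rw [Real.sqrt_mul (hpos _)] at this
        calc _ ≤ (√(sesq A (C a) (C a)).re * √(sesq A (C b) (C b)).re) * ‖ξ a‖ * ‖ξ b‖ := by gcongr
          _ = _ := by ring
    _ = (∑ a, ‖ξ a‖ * √(sesq A (C a) (C a)).re) ^ 2 := by
        rw [sq, Finset.sum_mul_sum]
    _ ≤ (∑ a, ‖ξ a‖ ^ 2) * ∑ a, (√(sesq A (C a) (C a)).re) ^ 2 :=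
        Finset.sum_mul_sq_le_sq_mul_sq _ _ _
    _ = _ := by simp only [Real.sq_sqrt (hpos _)]

end IsInnerPair

end LinearAlgebra

open WirtingerCalculus

/-! ### The reaction estimate -/

section Reaction

variable {ι : Type*} [Fintype ι]

lemma norm_mul_apply_le {M N : Matrix ι ι ℂ} {a b : ℝ} (ha : 0 ≤ a)
    (hM : ∀ k l, ‖M k l‖ ≤ a) (hN : ∀ k l, ‖N k l‖ ≤ b) (k l : ι) :
    ‖(M * N) k l‖ ≤ Fintype.card ι * (a * b) := by
  rw [Matrix.mul_apply]
  refine (norm_sum_le_of_le _ (f := fun j => M k j * N j l) (n := fun _ => a * b)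
    fun j _ => ?_).trans (by simp)
  rw [norm_mul]
  exact mul_le_mul (hM k j) (hN j l) (norm_nonneg _) ha

lemma norm_trace_le {M : Matrix ι ι ℂ} {a : ℝ} (hM : ∀ k l, ‖M k l‖ ≤ a) :
    ‖M.trace‖ ≤ Fintype.card ι * a :=
  (norm_sum_le_of_le _ (f := fun j => M j j) (n := fun _ => a) fun j _ => hM j j).trans (by simp)

lemma contract_mul {A : Type*} [CommRing A] [StarRing A] (u : ι → A)
    (F : ι → ι → Matrix ι ι A) (H : Matrix ι ι A) :
    contract u (fun i j => F i j * H) = contract u F * H := by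
  simp only [contract, Finset.sum_mul, Matrix.smul_mul]

lemma sesq_contract (u x y : ι → ℂ) (R : ι → ι → Matrix ι ι ℂ) :
    sesq (contract u R) x y = sesq (Matrix.of fun i j => sesq (R i j) x y) u u := by
  simp only [contract, sesq, Matrix.sum_apply, Matrix.smul_apply, smul_eq_mul, Matrix.of_apply,
    Finset.sum_mul]
  rw [sum_comm_pairs (fun i j k l => u i * star (u j) * R i j k l * x k * conj (y l))]
  refine Finset.sum_congr rfl fun i _ => Finset.sum_congr rfl fun j _ =>
    Finset.sum_congr rfl fun k _ => Finset.sum_congr rfl fun l _ => ?_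
  simp only [RCLike.star_def]
  ring

lemma trace_contract (u : ι → ℂ) (F : ι → ι → Matrix ι ι ℂ) :
    (contract u F).trace = sesq (Matrix.of fun i j => (F i j).trace) u u := by
  simp only [contract, sesq, trace_sum, trace_smul, smul_eq_mul, Matrix.of_apply, RCLike.star_def]
  exact Finset.sum_congr rfl fun i _ => Finset.sum_congr rfl fun j _ => by ring

/-- The contraction with `u` of the reaction term of the curvature evolution. -/
lemma contract_reaction (u : ι → ℂ) (Hi : Matrix ι ι ℂ) (F : ι → ι → Matrix ι ι ℂ) :
    contract u (fun i j => ∑ p, ∑ q, ((Hi * F i j) q p • F p q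
      + Hi q p • (F p j * F i q - F i q * F p j))) =
    ∑ p, ∑ q, ((Hi * contract u F) q p • F p q
      + Hi q p • ((∑ j, conj (u j) • F p j) * (∑ i, u i • F i q)
        - (∑ i, u i • F i q) * ∑ j, conj (u j) • F p j)) := by
  have e : ∀ p q, (Hi * contract u F) q p • F p q = ∑ i, ∑ j,
      (u i * star (u j)) • ((Hi * F i j) q p • F p q) := fun p q => by
    simp only [contract, Matrix.mul_sum, Matrix.mul_smul, Matrix.sum_apply, Matrix.smul_apply,
      Finset.sum_smul, smul_smul, smul_eq_mul]
  simp only [e]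
  simp only [contract, Finset.smul_sum]
  rw [← sum_comm_pairs]
  refine Finset.sum_congr rfl fun p _ => Finset.sum_congr rfl fun q _ => ?_
  simp only [smul_add, Finset.sum_add_distrib, smul_sub, Finset.sum_sub_distrib]
  congr 2
  · rw [Finset.sum_mul_sum, Finset.sum_comm, Finset.smul_sum]
    refine Finset.sum_congr rfl fun j _ => ?_
    rw [Finset.smul_sum]
    refine Finset.sum_congr rfl fun i _ => ?_
    rw [Matrix.smul_mul, Matrix.mul_smul, RCLike.star_def]
    module
  · rw [Finset.sum_mul_sum, Finset.smul_sum]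
    refine Finset.sum_congr rfl fun j _ => ?_
    rw [Finset.smul_sum]
    refine Finset.sum_congr rfl fun i _ => ?_
    rw [Matrix.smul_mul, Matrix.mul_smul, RCLike.star_def]
    module

variable [DecidableEq ι]

/-- Polarisation for a general sesquilinear form, in coordinates. -/
lemma norm_apply_le_of_diag {B H : Matrix ι ι ℂ} {a Λ : ℝ} (ha : 0 ≤ a)
    (hH : ∀ k l, ‖H k l‖ ≤ Λ)
    (hB : ∀ x, ‖sesq B x x‖ ≤ a * (sesq H x x).re) (k l : ι) : ‖B k l‖ ≤ 4 * a * Λ := by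
  set e : ι → ι → ℂ := fun k => Pi.single k 1
  have hpol : 4 * B k l = sesq B (e k + e l) (e k + e l)
      - sesq B (e k + (-1 : ℂ) • e l) (e k + (-1 : ℂ) • e l)
      + Complex.I * sesq B (e k + Complex.I • e l) (e k + Complex.I • e l)
      - Complex.I * sesq B (e k + (-Complex.I) • e l) (e k + (-Complex.I) • e l) := by
    simp only [sesq_add_left, sesq_add_right, sesq_smul_left, sesq_smul_right, e, sesq_single,
      map_neg, map_one, Complex.conj_I]
    linear_combination (2 * B k l - 2 * B l k) * Complex.I_mul_I
  have hb : ∀ w : ℂ, ‖w‖ = 1 → ‖sesq B (e k + w • e l) (e k + w • e l)‖ ≤ a * (4 * Λ) := by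
    intro w hw
    refine (hB _).trans (mul_le_mul_of_nonneg_left ?_ ha)
    refine (Complex.re_le_norm _).trans ?_
    simp only [sesq_add_left, sesq_add_right, sesq_smul_left, sesq_smul_right, e, sesq_single, mul_add]
    refine (norm_add_le_of_le (norm_add_le _ _) (norm_add_le _ _)).trans ?_
    simp only [norm_mul, RCLike.norm_conj, hw, one_mul]
    linarith [hH k k, hH k l, hH l k, hH l l]
  have h1 := hb 1 (by simp)
  have h2 := hb (-1) (by simp)
  have h3 := hb Complex.I (by simp)
  have h4 := hb (-Complex.I) (by simp)
  rw [one_smul] at h1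
  have : ‖4 * B k l‖ ≤ 4 * (a * (4 * Λ)) := by
    rw [hpol]
    refine (norm_sub_le_of_le (norm_add_le_of_le (norm_sub_le _ _) le_rfl) le_rfl).trans ?_
    simp only [norm_mul, Complex.norm_I, one_mul]
    linarith
  rw [norm_mul] at this
  norm_num at this
  linarith

end Reaction

section Reaction

variable {ι : Type*} [Fintype ι]

lemma sesq_self_im {A : Matrix ι ι ℂ} (hA : Aᴴ = A) (x : ι → ℂ) : (sesq A x x).im = 0 := by
  have := congrArg Complex.im (conj_sesq hA x x)
  rw [Complex.conj_im] at this
  linarith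

lemma norm_sesq_self {A : Matrix ι ι ℂ} (hA : Aᴴ = A) (x : ι → ℂ) :
    ‖sesq A x x‖ = |(sesq A x x).re| := by
  rw [← Complex.re_add_im (sesq A x x), sesq_self_im hA]
  simp

lemma contract_conjTranspose {R : ι → ι → Matrix ι ι ℂ} (hR : ∀ i j, (R i j)ᴴ = R j i)
    (u : ι → ℂ) : (contract u R)ᴴ = contract u R := by
  simp only [contract, conjTranspose_sum, conjTranspose_smul, hR, star_mul', star_star]
  rw [Finset.sum_comm]
  simp only [mul_comm]

lemma contract_single_right [DecidableEq ι] (R : ι → ι → Matrix ι ι ℂ) (x v : ι → ℂ) (q : ι) :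
    sesq (Matrix.of fun i j => sesq (R i j) x x) v (Pi.single q 1) =
      sesq (∑ i, v i • R i q) x x := by
  have e : star (Pi.single q 1 : ι → ℂ) = Pi.single q 1 := by
    ext i; by_cases h : i = q
    · subst h; simp
    · simp [h]
  rw [sesq_eq_dotProduct, e]
  simp only [mulVec_single, MulOpposite.op_one, one_smul, dotProduct, sesq, Matrix.sum_apply,
    Matrix.smul_apply, smul_eq_mul, Finset.sum_mul, Finset.mul_sum, Matrix.col_apply,
    Matrix.of_apply]
  rw [Finset.sum_comm]
  refine Finset.sum_congr rfl fun i _ => ?_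
  rw [Finset.sum_comm]
  refine Finset.sum_congr rfl fun j _ => Finset.sum_congr rfl fun k _ => by ring

lemma contract_single_left [DecidableEq ι] (R : ι → ι → Matrix ι ι ℂ) (x w : ι → ℂ) (p : ι) :
    sesq (Matrix.of fun i j => sesq (R i j) x x) (Pi.single p 1) w =
      sesq (∑ j, conj (w j) • R p j) x x := by
  rw [sesq_eq_dotProduct, single_dotProduct, one_mul]
  simp only [mulVec, dotProduct, sesq, Matrix.sum_apply,
    Matrix.smul_apply, smul_eq_mul, Finset.sum_mul, Matrix.of_apply, Pi.star_apply,
    RCLike.star_def]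
  rw [Finset.sum_comm]
  refine Finset.sum_congr rfl fun i _ => ?_
  rw [Finset.sum_comm]
  refine Finset.sum_congr rfl fun j _ => Finset.sum_congr rfl fun k _ => by ring

lemma contract_add (u : ι → ℂ) (N N' : ι → ι → Matrix ι ι ℂ) :
    contract u (fun i j => N i j + N' i j) = contract u N + contract u N' := by
  simp only [contract, smul_add, Finset.sum_add_distrib]

lemma contract_smul (u : ι → ℂ) (c : ℂ) (N : ι → ι → Matrix ι ι ℂ) :
    contract u (fun i j => c • N i j) = c • contract u N := by
  simp only [contract, Finset.smul_sum, smul_comm c]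

lemma contract_mul_smul_one [DecidableEq ι] (u : ι → ℂ) (c : ℂ) (P : Matrix ι ι ℂ) :
    contract u (fun i j => (c * P i j) • (1 : Matrix ι ι ℂ)) = (c * sesq P u u) • 1 := by
  simp only [contract, sesq, smul_smul, ← Finset.sum_smul, Finset.mul_sum]
  congr 1
  exact Finset.sum_congr rfl fun i _ => Finset.sum_congr rfl fun j _ => by
    rw [RCLike.star_def]; ring

lemma contract_neg_trace_smul_one [DecidableEq ι] (u : ι → ℂ) (X : ι → ι → Matrix ι ι ℂ) :
    contract u (fun i j => -(X i j).trace • (1 : Matrix ι ι ℂ)) = -(contract u X).trace • 1 := by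
  simp only [contract, trace_sum, trace_smul, neg_smul, smul_neg, smul_smul, Finset.sum_smul,
    Finset.sum_neg_distrib, smul_eq_mul]

/-- The perturbed form `-Ric + ε g`, where `Ric_{ij̄} = tr F_{ij̄}`. -/
def ricPert (F : ι → ι → Matrix ι ι ℂ) (H : Matrix ι ι ℂ) (ε : ℝ) : Matrix ι ι ℂ :=
  Matrix.of fun i j => -(F i j).trace + ε * H i j

lemma sesq_ricPert (F : ι → ι → Matrix ι ι ℂ) (H : Matrix ι ι ℂ) (ε : ℝ) (u : ι → ℂ) :
    (sesq (ricPert F H ε) u u).re = -(contract u F).trace.re + ε * (sesq H u u).re := by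
  have : ricPert F H ε = -(Matrix.of fun i j => (F i j).trace) + (ε : ℂ) • H := by
    ext i j; simp [ricPert]
  rw [this, sesq_add, sesq_neg, sesq_smul, trace_contract]
  simp

variable [DecidableEq ι]

/-- The pinching condition `± R(u, ū, x, x̄) ≤ c g(x, x̄) (-Ric + ε g)(u, ū)`. -/
def Pinched (F : ι → ι → Matrix ι ι ℂ) (H : Matrix ι ι ℂ) (ε c : ℝ) : Prop :=
  ∀ u x : ι → ℂ, |(sesq (contract u F * H) x x).re| ≤
    c * (sesq H x x).re * (sesq (ricPert F H ε) u u).re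

section

variable {H Hi : Matrix ι ι ℂ} (h : IsInnerPair H Hi) {F : ι → ι → Matrix ι ι ℂ}
  (hF : ∀ i j, (F i j * H)ᴴ = F j i * H) {ε c : ℝ} (hQ : Pinched F H ε c)
include h hQ

omit hQ in
lemma IsInnerPair.trace_eq (R : Matrix ι ι ℂ) : R.trace = (R * H * Hi).trace := by
  rw [Matrix.mul_assoc, h.mul_inv, Matrix.mul_one]

/-- Tracing the pinching condition over the fibre bounds the metric by `-Ric + ε g`. -/
lemma Pinched.eps_mul_le (u : ι → ℂ) :
    ε * (sesq H u u).re ≤ (Fintype.card ι * c + 1) * (sesq (ricPert F H ε) u u).re := by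
  obtain ⟨C, hC⟩ := h.exists_basis
  set p := (sesq (ricPert F H ε) u u).re with hp
  have e1 : (contract u F).trace.re = ε * (sesq H u u).re - p := by
    rw [hp, sesq_ricPert]; ring
  have e2 : (∑ a, (sesq H (C a) (C a)).re) = Fintype.card ι := by
    rw [← Complex.re_sum, ← IsInnerPair.trace_mul_eq_sum_sesq hC, h.mul_inv, trace_one]
    simp
  have e3 : (contract u F).trace.re ≤ c * Fintype.card ι * p := by
    rw [h.trace_eq, IsInnerPair.trace_mul_eq_sum_sesq hC, Complex.re_sum, ← e2, Finset.mul_sum,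
      Finset.sum_mul]
    exact Finset.sum_le_sum fun a _ => (le_abs_self _).trans (hQ u (C a))
  linarith

/-- For `ε = 0` the pinching condition implies `Ric ≤ 0`. -/
lemma Pinched.nonneg (hε : 0 ≤ ε) (hc : 0 ≤ c) (u : ι → ℂ) :
    0 ≤ (sesq (ricPert F H ε) u u).re := by
  have h1 := hQ.eps_mul_le h u
  have h2 := mul_nonneg hε (h.nonneg u)
  exact nonneg_of_mul_nonneg_right (h2.trans h1) (by positivity)

lemma Pinched.pos (hε : 0 < ε) (hc : 0 ≤ c) {u : ι → ℂ} (hu : u ≠ 0) :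
    0 < (sesq (ricPert F H ε) u u).re := by
  have h1 := hQ.eps_mul_le h u
  have h2 := mul_pos hε (h.pos u hu)
  exact pos_of_mul_pos_right (h2.trans_le h1) (by positivity)

omit h [DecidableEq ι] in
include hF in
/-- Polarising the pinching condition in the base vector gives
`|R(u, v̄, x, x̄)|² ≤ (c g(x, x̄))² (-Ric + ε g)(u, ū) (-Ric + ε g)(v, v̄)`. -/
lemma Pinched.norm_mixed_sq_le (u v x : ι → ℂ) :
    ‖sesq (Matrix.of fun i j => sesq (F i j * H) x x) u v‖ ^ 2 ≤
      (c * (sesq H x x).re) ^ 2 *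
        ((sesq (ricPert F H ε) u u).re * (sesq (ricPert F H ε) v v).re) := by
  have hA : (Matrix.of fun i j => sesq (F i j * H) x x)ᴴ =
      Matrix.of fun i j => sesq (F i j * H) x x := by
    ext i j
    have : star (sesq (F j i * H) x x) = sesq (F i j * H) x x := by
      simp only [sesq, star_sum, star_mul']
      rw [Finset.sum_comm]
      refine Finset.sum_congr rfl fun k _ => Finset.sum_congr rfl fun l _ => ?_
      rw [← hF j i, conjTranspose_apply]
      simp only [RCLike.star_def, Complex.conj_conj]
      ring
    exact this
  have := norm_sesq_sq_le (P := ((c * (sesq H x x).re : ℝ) : ℂ) • ricPert F H ε) hA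
    (fun w => ?_) u v
  · simp only [sesq_smul, Complex.re_ofReal_mul] at this
    calc _ ≤ _ := this
      _ = _ := by ring
  · rw [sesq_smul, Complex.re_ofReal_mul, ← sesq_contract, contract_mul]
    exact hQ w x

include hF in
lemma Pinched.norm_mixed_le (hε : 0 ≤ ε) (hc : 0 ≤ c) (u v x : ι → ℂ) :
    ‖sesq (Matrix.of fun i j => sesq (F i j * H) x x) u v‖ ≤
      c * (√(sesq (ricPert F H ε) u u).re * √(sesq (ricPert F H ε) v v).re) *
        (sesq H x x).re := by
  refine (Real.le_sqrt_of_sq_le (hQ.norm_mixed_sq_le hF u v x)).trans ?_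
  rw [Real.sqrt_mul (sq_nonneg _), Real.sqrt_sq (mul_nonneg hc (h.nonneg x)),
    Real.sqrt_mul (hQ.nonneg h hε hc u)]
  exact le_of_eq (by ring)

end

/-- The reaction constant, in terms of the dimension `N` and a bound `Λ` for the geometry. With
`p = (-Ric + ε g)(u, ū)`, the entries of `F_{uū}` are bounded by `f₁ p`, those of `F_{uq̄}` by `f₂ √p`,
those of the reaction terms contracted with `u` by `c₁ p`, and those of the corresponding terms in
the evolution of the barrier by `c₂ p`. -/
def reactionConst (N Λ : ℝ) : ℝ :=
  let f₁ := 8 * N * Λ ^ 2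
  let f₂ := N * (8 * Λ * √((N + 1) * Λ) * Λ)
  let c₁ := N ^ 2 * (N * (Λ * f₁) * Λ + Λ * (2 * N * f₂ ^ 2))
  let c₂ := 2 * (N * c₁ + N ^ 2 * Λ ^ 2 * (2 * N + 1)) + c₁
  N ^ 2 * (N * (c₂ * Λ) * Λ)

lemma reactionConst_nonneg {N Λ : ℝ} (hN : 0 ≤ N) (hΛ : 0 ≤ Λ) : 0 ≤ reactionConst N Λ := by
  unfold reactionConst
  positivity

set_option maxHeartbeats 1000000 in
/-- The reaction estimate: under the pinching condition the reaction terms are bounded by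
`(-Ric + ε g)(u, ū) g(x, x̄)`, so they are beaten by a growth rate `κ` of the pinching constant. -/
theorem Pinched.reaction_pos {H Hi : Matrix ι ι ℂ} (h : IsInnerPair H Hi)
    {F X Θ : ι → ι → Matrix ι ι ℂ} (hF : ∀ i j, (F i j * H)ᴴ = F j i * H)
    (hX : ∀ i j, X i j = ∑ p, ∑ q, ((Hi * F i j) q p • F p q
      + Hi q p • (F p j * F i q - F i q * F p j)))
    {Λ : ℝ} (bH : ∀ k l, ‖H k l‖ ≤ Λ) (bHi : ∀ k l, ‖Hi k l‖ ≤ Λ)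
    (bF : ∀ i j k l, ‖F i j k l‖ ≤ Λ) (bΘ : ∀ i j k l, ‖Θ i j k l‖ ≤ Λ) (hΛ : 0 ≤ Λ)
    {ε c κ s : ℝ} (hε : 0 < ε) (hε1 : ε ≤ 1) (hc : 0 ≤ c) (hc2 : c ≤ 2) (hs : |s| ≤ 1)
    (hQ : Pinched F H ε c) (hκ : reactionConst (Fintype.card ι) Λ < κ)
    {u x : ι → ℂ} (hu : u ≠ 0) (hx : x ≠ 0) :
    0 < (sesq (contract u (fun i j => ((κ : ℂ) * ricPert F H ε i j) • (1 : Matrix ι ι ℂ)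
      + ((c : ℂ) • (-(X i j).trace • (1 : Matrix ι ι ℂ) + (ε : ℂ) • Θ i j)
      + (s : ℂ) • X i j)) * H) x x).re := by
  set N : ℝ := (Fintype.card ι : ℝ) with hN
  have hN0 : 0 ≤ N := by positivity
  set p := (sesq (ricPert F H ε) u u).re with hp
  have hp0 : 0 < p := hQ.pos h hε hc hu
  have hh0 : 0 < (sesq H x x).re := h.pos x hx
  set f₁ := 8 * N * Λ ^ 2 with hf₁
  set f₂ := N * (8 * Λ * √((N + 1) * Λ) * Λ) with hf₂
  set c₁ := N ^ 2 * (N * (Λ * f₁) * Λ + Λ * (2 * N * f₂ ^ 2)) with hc₁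
  set c₂ := 2 * (N * c₁ + N ^ 2 * Λ ^ 2 * (2 * N + 1)) + c₁ with hc₂
  have hκ' : N ^ 2 * (N * (c₂ * Λ) * Λ) < κ := hκ
  have f₁0 : 0 ≤ f₁ := by positivity
  have f₂0 : 0 ≤ f₂ := by positivity
  have c₁0 : 0 ≤ c₁ := by positivity
  have c₂0 : 0 ≤ c₂ := by positivity
  have sum2 : ∀ (f : ι → ι → ℂ) (b : ℝ), (∀ i j, ‖f i j‖ ≤ b) → ‖∑ i, ∑ j, f i j‖ ≤ N ^ 2 * b := by
    intro f b hf
    refine (norm_sum_le_of_le _ (n := fun _ => N * b) fun i _ =>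
      (norm_sum_le_of_le _ (n := fun _ => b) fun j _ => hf i j).trans (by simp [hN])).trans ?_
    simp only [Finset.sum_const, Finset.card_univ, nsmul_eq_mul, ← hN]
    exact le_of_eq (by ring)
  have unH : ∀ M : Matrix ι ι ℂ, M = M * H * Hi := fun M => by
    rw [Matrix.mul_assoc, h.mul_inv, Matrix.mul_one]
  -- the curvature contracted with `u` in both base slots is `O(p)`
  have bFu : ∀ k l, ‖contract u F k l‖ ≤ f₁ * p := by
    have hherm : (contract u F * H)ᴴ = contract u F * H := by
      rw [← contract_mul]; exact contract_conjTranspose hF u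
    have hd : ∀ y, ‖sesq (contract u F * H) y y‖ ≤ (2 * p) * (sesq H y y).re := fun y => by
      rw [norm_sesq_self hherm]
      have := h.nonneg y
      calc _ ≤ c * (sesq H y y).re * p := hQ u y
        _ ≤ 2 * (sesq H y y).re * p := by gcongr
        _ = _ := by ring
    intro k l
    rw [unH (contract u F)]
    refine (norm_mul_apply_le (by positivity)
      (norm_apply_le_of_diag (by positivity) bH hd) bHi k l).trans (le_of_eq ?_)
    rw [hf₁, hN]; ring
  -- contracted with `u` in one base slot it is `O(√p)`
  have bdiag : ∀ q, (sesq (ricPert F H ε) (Pi.single q 1) (Pi.single q 1)).re ≤ (N + 1) * Λ := by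
    intro q
    rw [sesq_single]
    refine (Complex.re_le_norm _).trans ?_
    rw [ricPert, Matrix.of_apply]
    refine (norm_add_le _ _).trans ?_
    rw [norm_neg, norm_mul, Complex.norm_real, Real.norm_of_nonneg hε.le, add_mul, one_mul]
    have h1 := norm_trace_le (bF q q)
    have h2 : ε * ‖H q q‖ ≤ 1 * Λ := mul_le_mul hε1 (bH q q) (norm_nonneg _) zero_le_one
    linarith
  have hmix : ∀ v w y : ι → ℂ, ∀ b : ℝ, √(sesq (ricPert F H ε) v v).re *
      √(sesq (ricPert F H ε) w w).re ≤ b →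
      ‖sesq (Matrix.of fun i j => sesq (F i j * H) y y) v w‖ ≤ (2 * b) * (sesq H y y).re := by
    intro v w y b hb
    refine (hQ.norm_mixed_le h hF hε.le hc v w y).trans
      (mul_le_mul_of_nonneg_right ?_ (h.nonneg y))
    exact mul_le_mul hc2 hb (by positivity) (by norm_num)
  have bR : ∀ q k l, ‖(∑ i, u i • F i q) k l‖ ≤ f₂ * √p := by
    intro q k l
    have hd : ∀ y, ‖sesq ((∑ i, u i • F i q) * H) y y‖ ≤
        (2 * (√p * √((N + 1) * Λ))) * (sesq H y y).re := fun y => by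
      have e : (∑ i, u i • F i q) * H = ∑ i, u i • (F i q * H) := by
        simp only [Finset.sum_mul, Matrix.smul_mul]
      rw [e, ← contract_single_right (fun i j => F i j * H)]
      exact hmix _ _ _ _ (mul_le_mul_of_nonneg_left (Real.sqrt_le_sqrt (bdiag q)) (by positivity))
    rw [unH (∑ i, u i • F i q)]
    refine (norm_mul_apply_le (by positivity)
      (norm_apply_le_of_diag (by positivity) bH hd) bHi k l).trans (le_of_eq ?_)
    rw [hf₂, hN]; ring
  have bL : ∀ p' k l, ‖(∑ j, conj (u j) • F p' j) k l‖ ≤ f₂ * √p := by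
    intro q k l
    have hd : ∀ y, ‖sesq ((∑ j, conj (u j) • F q j) * H) y y‖ ≤
        (2 * (√p * √((N + 1) * Λ))) * (sesq H y y).re := fun y => by
      have e : (∑ j, conj (u j) • F q j) * H = ∑ j, conj (u j) • (F q j * H) := by
        simp only [Finset.sum_mul, Matrix.smul_mul]
      rw [e, ← contract_single_left (fun i j => F i j * H)]
      refine hmix _ _ _ _ ?_
      rw [mul_comm]
      exact mul_le_mul_of_nonneg_left (Real.sqrt_le_sqrt (bdiag q)) (by positivity)
    rw [unH (∑ j, conj (u j) • F q j)]
    refine (norm_mul_apply_le (by positivity)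
      (norm_apply_le_of_diag (by positivity) bH hd) bHi k l).trans (le_of_eq ?_)
    rw [hf₂, hN]; ring
  -- each reaction term contains `F_{uū}` once or two factors contracted once with `u`
  have bX : ∀ k l, ‖contract u X k l‖ ≤ c₁ * p := by
    intro k l
    have e : X = fun i j => ∑ p, ∑ q, ((Hi * F i j) q p • F p q
      + Hi q p • (F p j * F i q - F i q * F p j)) := by ext1 i; ext1 j; exact hX i j
    rw [e, contract_reaction, Matrix.sum_apply]
    simp only [Matrix.sum_apply]
    refine (sum2 _ ((N * (Λ * (f₁ * p))) * Λ + Λ * (2 * (N * ((f₂ * √p) * (f₂ * √p)))))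
      fun i j => ?_).trans (le_of_eq ?_)
    · rw [Matrix.add_apply, Matrix.smul_apply, Matrix.smul_apply, Matrix.sub_apply, smul_eq_mul,
        smul_eq_mul]
      refine norm_add_le_of_le ?_ ?_
      · rw [norm_mul]
        exact mul_le_mul (norm_mul_apply_le hΛ bHi bFu j i) (bF i j k l) (norm_nonneg _)
          (by positivity)
      · rw [norm_mul]
        refine mul_le_mul (bHi j i) ((norm_sub_le _ _).trans ?_) (norm_nonneg _) hΛ
        have h1 := norm_mul_apply_le (by positivity) (bL i) (bR j) k l
        have h2 := norm_mul_apply_le (by positivity) (bR j) (bL i) k l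
        linarith
    · have : √p * √p = p := Real.mul_self_sqrt hp0.le
      rw [hc₁]
      linear_combination (N ^ 2 * Λ * 2 * N * f₂ ^ 2) * this
  -- the evolution of `ε g` is controlled since `ε g(u, ū)` is `O(p)`
  have bΘ' : ∀ k l, ‖(ε : ℂ) * contract u Θ k l‖ ≤ N ^ 2 * Λ ^ 2 * (2 * N + 1) * p := by
    intro k l
    have hcomp : ∀ i, ‖u i‖ ≤ √((sesq H u u).re * Λ) := fun i => by
      refine Real.le_sqrt_of_sq_le ((h.norm_sq_apply_le u i).trans ?_)
      exact mul_le_mul_of_nonneg_left ((Complex.re_le_norm _).trans (bHi i i)) (h.nonneg u)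
    have hun := h.nonneg u
    have h1 : ‖contract u Θ k l‖ ≤ N ^ 2 * ((sesq H u u).re * Λ * Λ) := by
      rw [contract, Matrix.sum_apply]
      simp only [Matrix.sum_apply]
      refine sum2 _ _ fun i j => ?_
      rw [Matrix.smul_apply, smul_eq_mul, norm_mul, norm_mul, norm_star,
        ← Real.mul_self_sqrt (mul_nonneg hun hΛ)]
      have := hcomp i
      have := hcomp j
      have := bΘ i j k l
      gcongr
    have h2 := hQ.eps_mul_le h u
    have h3 : (N * c + 1) * p ≤ (2 * N + 1) * p := by
      refine mul_le_mul_of_nonneg_right ?_ hp0.le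
      nlinarith
    rw [norm_mul, Complex.norm_real, Real.norm_of_nonneg hε.le]
    calc ε * ‖contract u Θ k l‖ ≤ ε * (N ^ 2 * ((sesq H u u).re * Λ * Λ)) := by gcongr
      _ = N ^ 2 * Λ ^ 2 * (ε * (sesq H u u).re) := by ring
      _ ≤ N ^ 2 * Λ ^ 2 * ((2 * N + 1) * p) := by
        have := h2.trans h3
        gcongr
      _ = _ := by ring
  set M : Matrix ι ι ℂ := (c : ℂ) • (-(contract u X).trace • (1 : Matrix ι ι ℂ)
    + (ε : ℂ) • contract u Θ) + (s : ℂ) • contract u X with hM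
  have bM : ∀ k l, ‖M k l‖ ≤ c₂ * p := by
    intro k l
    have h1 : ‖(-(contract u X).trace • (1 : Matrix ι ι ℂ)) k l‖ ≤ N * (c₁ * p) := by
      rw [Matrix.smul_apply, smul_eq_mul, norm_mul, norm_neg]
      have h1 := norm_trace_le bX
      have h2 : ‖(1 : Matrix ι ι ℂ) k l‖ ≤ 1 := by
        rw [Matrix.one_apply]; split <;> simp
      calc _ ≤ N * (c₁ * p) * 1 := mul_le_mul h1 h2 (norm_nonneg _) (by positivity)
        _ = _ := mul_one _
    rw [hM, Matrix.add_apply, Matrix.smul_apply, Matrix.smul_apply, Matrix.add_apply,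
      Matrix.smul_apply (ε : ℂ), smul_eq_mul, smul_eq_mul, smul_eq_mul]
    calc _ ≤ 2 * (N * (c₁ * p) + N ^ 2 * Λ ^ 2 * (2 * N + 1) * p) + 1 * (c₁ * p) := by
          refine norm_add_le_of_le ?_ ?_
          · rw [norm_mul, Complex.norm_real, Real.norm_of_nonneg hc]
            exact mul_le_mul hc2 (norm_add_le_of_le h1 (bΘ' k l)) (norm_nonneg _) (by norm_num)
          · rw [norm_mul, Complex.norm_real]
            exact mul_le_mul hs (bX k l) (norm_nonneg _) zero_le_one
      _ = _ := by rw [hc₂]; ring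
  have bS : ‖sesq (M * H) x x‖ ≤ N ^ 2 * (N * (c₂ * Λ) * Λ) * p * (sesq H x x).re := by
    have hcomp : ∀ i, ‖x i‖ ≤ √((sesq H x x).re * Λ) := fun i => by
      refine Real.le_sqrt_of_sq_le ((h.norm_sq_apply_le x i).trans ?_)
      exact mul_le_mul_of_nonneg_left ((Complex.re_le_norm _).trans (bHi i i)) (h.nonneg x)
    refine (sum2 _ ((N * (c₂ * p * Λ)) * ((sesq H x x).re * Λ)) fun i j => ?_).trans
      (le_of_eq (by ring))
    have h1 := norm_mul_apply_le (by positivity) bM bH i j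
    have h4 := mul_le_mul (hcomp i) (hcomp j) (norm_nonneg _) (Real.sqrt_nonneg _)
    rw [Real.mul_self_sqrt (mul_nonneg hh0.le hΛ)] at h4
    rw [norm_mul, norm_mul, RCLike.norm_conj, mul_assoc ‖(M * H) i j‖]
    exact mul_le_mul h1 h4 (by positivity) (by positivity)
  have hsplit : contract u (fun i j => ((κ : ℂ) * ricPert F H ε i j) • (1 : Matrix ι ι ℂ)
      + ((c : ℂ) • (-(X i j).trace • (1 : Matrix ι ι ℂ) + (ε : ℂ) • Θ i j)
      + (s : ℂ) • X i j)) =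
      ((κ : ℂ) * sesq (ricPert F H ε) u u) • (1 : Matrix ι ι ℂ) + M := by
    rw [hM, contract_add, contract_add, contract_smul, contract_smul, contract_add,
      contract_smul, contract_mul_smul_one, contract_neg_trace_smul_one]
  rw [hsplit, Matrix.add_mul, sesq_add, Matrix.smul_mul, Matrix.one_mul, sesq_smul,
    Complex.add_re, mul_assoc, Complex.re_ofReal_mul, Complex.mul_re, sesq_self_im h.herm,
    mul_zero, sub_zero, ← hp]
  have h1 := (abs_le.1 ((Complex.abs_re_le_norm _).trans bS)).1
  have h2 : N ^ 2 * (N * (c₂ * Λ) * Λ) * (p * (sesq H x x).re) < κ * (p * (sesq H x x).re) :=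
    mul_lt_mul_of_pos_right hκ' (mul_pos hp0 hh0)
  linarith

end Reaction

/-! ### Wirtinger calculus on space-time -/

section Calculus

variable {n : ℕ}

/-- The space-time cylinder `U × [0, T]`. -/
abbrev cylinder (U : Set (Fin n → ℂ)) (T : ℝ) : Set ((Fin n → ℂ) × ℝ) := U ×ˢ Set.Icc 0 T

lemma smoothDomain_cylinder {U : Set (Fin n → ℂ)} (hU : IsOpen U) {T : ℝ} (hT : 0 < T) :
    SmoothDomain (cylinder U T) where
  uniqueDiffOn := hU.uniqueDiffOn.prod (uniqueDiffOn_Icc hT)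
  subset_closure_interior := by
    rw [interior_prod_eq, hU.interior_eq, interior_Icc, closure_prod_eq, closure_Ioo hT.ne]
    exact Set.prod_mono subset_closure le_rfl

namespace SmoothFn

section dirDeriv

variable {E : Type*} [NormedAddCommGroup E] [NormedSpace ℝ E] {S : Set E} [SmoothDomain S]

lemma dirDeriv_add (v w : E) (f : SmoothFn S) :
    dirDeriv (v + w) f = dirDeriv v f + dirDeriv w f := ext_ev fun q => by
  exact map_add (fderivWithin ℝ (ext f) S q) v w

lemma dirDeriv_smul (r : ℝ) (v : E) (f : SmoothFn S) :
    dirDeriv (r • v) f = (r : ℂ) • dirDeriv v f := ext_ev fun q => by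
  rw [ev_smul]
  exact (map_smul (fderivWithin ℝ (ext f) S q) r v).trans (Complex.real_smul)

end dirDeriv

variable {S : Set ((Fin n → ℂ) × ℝ)} [SmoothDomain S]

/-- `∂/∂xⁱ` and, with `c = √-1`, `∂/∂yⁱ`. -/
def coordDeriv (c : ℂ) (i : Fin n) : Derivation ℂ (SmoothFn S) (SmoothFn S) :=
  dirDeriv ((Pi.single i c : Fin n → ℂ), (0 : ℝ))

lemma coordDeriv_comm {c d : ℂ} {i j : Fin n} (f : SmoothFn S) :
    coordDeriv c i (coordDeriv d j f) = coordDeriv d j (coordDeriv c i f) := dirDeriv_comm _ _ f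

lemma timeDeriv_coordDeriv {c : ℂ} {i : Fin n} (f : SmoothFn S) :
    dirDeriv ((0 : Fin n → ℂ), (1 : ℝ)) (coordDeriv c i f) =
      coordDeriv c i (dirDeriv ((0 : Fin n → ℂ), (1 : ℝ)) f) := dirDeriv_comm _ _ f

lemma coordDeriv_star {c : ℂ} {i : Fin n} (f : SmoothFn S) :
    coordDeriv c i (star f) = star (coordDeriv c i f) := dirDeriv_star _ f

variable (S) in
/-- The Wirtinger derivatives in space and the time derivative on `S ⊆ ℂⁿ × ℝ`. -/
def calculus : WirtingerCalculus (Fin n) (SmoothFn S) where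
  dz i := (1 / 2 : ℂ) • (coordDeriv 1 i - Complex.I • coordDeriv Complex.I i)
  db i := (1 / 2 : ℂ) • (coordDeriv 1 i + Complex.I • coordDeriv Complex.I i)
  dt := dirDeriv ((0 : Fin n → ℂ), (1 : ℝ))
  dz_dz i j f := by
    simp only [Derivation.smul_apply, Derivation.sub_apply, Derivation.map_smul, map_sub,
      coordDeriv_comm (i := i) (j := j)]
    module
  db_db i j f := by
    simp only [Derivation.smul_apply, Derivation.add_apply, Derivation.map_smul, map_add,
      coordDeriv_comm (i := i) (j := j)]
    module
  db_dz i j f := by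
    simp only [Derivation.smul_apply, Derivation.sub_apply, Derivation.add_apply,
      Derivation.map_smul, map_sub, map_add, coordDeriv_comm (i := i) (j := j)]
    module
  dt_dz i f := by
    simp only [Derivation.smul_apply, Derivation.sub_apply, Derivation.map_smul, map_sub,
      timeDeriv_coordDeriv]
  dt_db i f := by
    simp only [Derivation.smul_apply, Derivation.add_apply, Derivation.map_smul, map_add,
      timeDeriv_coordDeriv]
  star_dz i f := by
    simp only [Derivation.smul_apply, Derivation.sub_apply, Derivation.add_apply,
      star_smul, star_sub, coordDeriv_star, RCLike.star_def, Complex.conj_I, map_div₀, map_one,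
      map_ofNat]
    module
  star_dt f := (dirDeriv_star _ f).symm

lemma dz_apply (i : Fin n) (f : SmoothFn S) : (calculus S).dz i f =
    (1 / 2 : ℂ) • (coordDeriv 1 i f - Complex.I • coordDeriv Complex.I i f) := rfl

lemma db_apply (i : Fin n) (f : SmoothFn S) : (calculus S).db i f =
    (1 / 2 : ℂ) • (coordDeriv 1 i f + Complex.I • coordDeriv Complex.I i f) := rfl

lemma coordDeriv_apply (c : ℂ) (i : Fin n) (f : SmoothFn S) :
    coordDeriv c i f = c • (calculus S).dz i f + conj c • (calculus S).db i f := by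
  have h : coordDeriv c i f =
      (c.re : ℂ) • coordDeriv 1 i f + (c.im : ℂ) • coordDeriv Complex.I i f := by
    simp only [coordDeriv, ← dirDeriv_smul, ← dirDeriv_add]
    have e : ((Pi.single i c : Fin n → ℂ), (0 : ℝ)) = c.re • ((Pi.single i 1 : Fin n → ℂ), (0 : ℝ))
        + c.im • ((Pi.single i Complex.I : Fin n → ℂ), (0 : ℝ)) := by
      rw [Prod.ext_iff]
      refine ⟨?_, by simp⟩
      ext j
      by_cases hj : j = i
      · subst hj; simp
      · simp [hj]
    rw [e]
  rw [h, dz_apply, db_apply]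
  have e1 : (c.re : ℂ) = (c + conj c) / 2 := Complex.re_eq_add_conj c
  have e2 : (c.im : ℂ) = (c - conj c) / (2 * Complex.I) := Complex.im_eq_sub_conj c
  rw [e1, e2]
  match_scalars
  · field_simp
  · field_simp; simp; ring

/-- Real directional derivatives in space in terms of Wirtinger derivatives. -/
lemma dirDeriv_space (v : Fin n → ℂ) (f : SmoothFn S) :
    dirDeriv (v, (0 : ℝ)) f =
      ∑ i, (v i • (calculus S).dz i f + conj (v i) • (calculus S).db i f) := by
  simp only [← coordDeriv_apply]
  have h : (v, (0 : ℝ)) = ∑ i, ((Pi.single i (v i) : Fin n → ℂ), (0 : ℝ)) := by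
    rw [Prod.ext_iff]
    refine ⟨?_, ?_⟩
    · rw [Prod.fst_sum]; exact (Finset.univ_sum_single v).symm
    · rw [Prod.snd_sum]; simp
  rw [h]
  have : ∀ s : Finset (Fin n), dirDeriv (∑ i ∈ s, ((Pi.single i (v i) : Fin n → ℂ), (0 : ℝ))) f =
      ∑ i ∈ s, coordDeriv (v i) i f := by
    intro s
    induction s using Finset.induction_on with
    | empty =>
      refine ext_ev fun q => ?_
      rw [Finset.sum_empty, Finset.sum_empty, map_zero, ev_dirDeriv, map_zero]
    | insert a s ha ih => rw [Finset.sum_insert ha, Finset.sum_insert ha, dirDeriv_add, ih]; rfl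
  exact this _

/-- The complex Hessian in the direction `v` is a mean of real second derivatives. -/
lemma hessian_eq (v : Fin n → ℂ) (f : SmoothFn S) :
    ∑ p, ∑ q, (v p * conj (v q)) • (calculus S).dz p ((calculus S).db q f) =
      (1 / 4 : ℂ) • (dirDeriv (v, (0 : ℝ)) (dirDeriv (v, (0 : ℝ)) f)
        + dirDeriv (Complex.I • v, (0 : ℝ)) (dirDeriv (Complex.I • v, (0 : ℝ)) f)) := by
  set a : SmoothFn S → SmoothFn S := fun f => ∑ i, v i • (calculus S).dz i f with ha
  set b : SmoothFn S → SmoothFn S := fun f => ∑ i, conj (v i) • (calculus S).db i f with hb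
  have e1 : ∀ f, dirDeriv (v, (0 : ℝ)) f = a f + b f := fun f => by
    rw [dirDeriv_space, Finset.sum_add_distrib]
  have e2 : ∀ f, dirDeriv (Complex.I • v, (0 : ℝ)) f = Complex.I • a f - Complex.I • b f :=
    fun f => by
    rw [dirDeriv_space]
    simp only [ha, hb, Finset.smul_sum, ← Finset.sum_sub_distrib]
    refine Finset.sum_congr rfl fun i _ => ?_
    simp only [Pi.smul_apply, smul_eq_mul, map_mul, Complex.conj_I]
    module
  have aadd : ∀ f g, a (f + g) = a f + a g := fun f g => by
    simp only [ha, map_add, smul_add, Finset.sum_add_distrib]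
  have badd : ∀ f g, b (f + g) = b f + b g := fun f g => by
    simp only [hb, map_add, smul_add, Finset.sum_add_distrib]
  have asub : ∀ f g, a (f - g) = a f - a g := fun f g => by
    simp only [ha, map_sub, smul_sub, Finset.sum_sub_distrib]
  have bsub : ∀ f g, b (f - g) = b f - b g := fun f g => by
    simp only [hb, map_sub, smul_sub, Finset.sum_sub_distrib]
  have asm : ∀ (c : ℂ) f, a (c • f) = c • a f := fun c f => by
    simp only [ha, Derivation.map_smul, Finset.smul_sum, smul_comm c]
  have bsm : ∀ (c : ℂ) f, b (c • f) = c • b f := fun c f => by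
    simp only [hb, Derivation.map_smul, Finset.smul_sum, smul_comm c]
  have hab : a (b f) = ∑ p, ∑ q, (v p * conj (v q)) • (calculus S).dz p ((calculus S).db q f) := by
    simp only [ha, hb, map_sum, Derivation.map_smul, Finset.smul_sum, smul_smul]
  have hba : b (a f) = a (b f) := by
    rw [hab]
    simp only [ha, hb, map_sum, Derivation.map_smul, Finset.smul_sum, smul_smul, (calculus S).db_dz]
    rw [Finset.sum_comm]
    simp only [mul_comm]
  rw [← hab, e1 (dirDeriv _ f), e1 f, e2 (dirDeriv _ f), e2 f, aadd, badd, asub, bsub, asm, asm, bsm,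
    bsm, hba]
  simp only [smul_add, smul_sub, smul_smul, Complex.I_mul_I]
  module

end SmoothFn

end Calculus

/-! ### Derivative tests in space and time -/

section Calculus

variable {n : ℕ}

namespace SmoothFn

section evaluation

variable {U : Set (Fin n → ℂ)} {T : ℝ}

/-- The point with the same time and another position. -/
def spacePt (q : cylinder U T) (w : Fin n → ℂ) (hw : w ∈ U) : cylinder U T :=
  ⟨(w, q.1.2), hw, q.2.2⟩

/-- The point with the same position and another time. -/
def timePt (q : cylinder U T) (t : ℝ) (ht : t ∈ Set.Icc 0 T) : cylinder U T :=
  ⟨(q.1.1, t), q.2.1, ht⟩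

variable [SmoothDomain (cylinder U T)]

omit [SmoothDomain (cylinder U T)] in
lemma hasFDerivAt_slice (hU : IsOpen U) (q : cylinder U T)
    (f : SmoothFn (cylinder U T)) {F : (Fin n → ℂ) → ℂ}
    (hF : ∀ w (hw : w ∈ U), F w = ev (spacePt q w hw) f) :
    HasFDerivAt F ((fderivWithin ℝ (ext f) (cylinder U T) q).comp
      (ContinuousLinearMap.inl ℝ (Fin n → ℂ) ℝ)) q.1.1 := by
  have h1 := (differentiableWithinAt_ext f q).hasFDerivWithinAt
  have h2 : HasFDerivWithinAt (fun w : Fin n → ℂ => (w, q.1.2))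
      (ContinuousLinearMap.inl ℝ (Fin n → ℂ) ℝ) U q.1.1 :=
    (hasFDerivAt_prodMk_left q.1.1 q.1.2).hasFDerivWithinAt
  have h3 := (HasFDerivWithinAt.comp (g := ext f) (t := cylinder U T) q.1.1 h1 h2
    fun w hw => ⟨hw, q.2.2⟩).hasFDerivAt (hU.mem_nhds q.2.1)
  refine h3.congr_of_eventuallyEq ?_
  filter_upwards [hU.mem_nhds q.2.1] with w hw
  rw [hF w hw]
  exact (ext_apply f (spacePt q w hw)).symm

lemma fderiv_slice (hU : IsOpen U) (q : cylinder U T)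
    (f : SmoothFn (cylinder U T)) {F : (Fin n → ℂ) → ℂ}
    (hF : ∀ w (hw : w ∈ U), F w = ev (spacePt q w hw) f) (v : Fin n → ℂ) :
    fderiv ℝ F q.1.1 v = ev q (dirDeriv (v, (0 : ℝ)) f) := by
  rw [(hasFDerivAt_slice hU q f hF).fderiv, ev_dirDeriv]
  rfl

lemma dz_slice (hU : IsOpen U) (q : cylinder U T)
    (f : SmoothFn (cylinder U T)) {F : (Fin n → ℂ) → ℂ}
    (hF : ∀ w (hw : w ∈ U), F w = ev (spacePt q w hw) f) (i : Fin n) :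
    ChernGeom.dz i F q.1.1 = ev q ((calculus _).dz i f) := by
  rw [ChernGeom.dz, fderiv_slice hU q f hF, fderiv_slice hU q f hF, dz_apply, ev_smul, map_sub,
    ev_smul]
  rfl

lemma dzbar_slice (hU : IsOpen U) (q : cylinder U T)
    (f : SmoothFn (cylinder U T)) {F : (Fin n → ℂ) → ℂ}
    (hF : ∀ w (hw : w ∈ U), F w = ev (spacePt q w hw) f) (i : Fin n) :
    ChernGeom.dzbar i F q.1.1 = ev q ((calculus _).db i f) := by
  rw [ChernGeom.dzbar, fderiv_slice hU q f hF, fderiv_slice hU q f hF, db_apply, ev_smul, map_add,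
    ev_smul]
  rfl

lemma hasDerivWithinAt_time (q : cylinder U T)
    (f : SmoothFn (cylinder U T)) {F : ℝ → ℂ}
    (hF : ∀ t (ht : t ∈ Set.Icc 0 T), F t = ev (timePt q t ht) f) :
    HasDerivWithinAt F (ev q ((calculus _).dt f)) (Set.Icc 0 T) q.1.2 := by
  have h1 := (differentiableWithinAt_ext f q).hasFDerivWithinAt
  have h2 : HasDerivWithinAt (fun t : ℝ => (q.1.1, t)) ((0 : Fin n → ℂ), (1 : ℝ))
      (Set.Icc 0 T) q.1.2 :=
    (hasDerivWithinAt_const _ _ _).prodMk (hasDerivWithinAt_id _ _)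
  have h3 := HasFDerivWithinAt.comp_hasDerivWithinAt (l := ext f)
    (t := cylinder U T) q.1.2 h1 h2 fun t ht => ⟨q.2.1, ht⟩
  exact h3.congr (fun t ht => (hF t ht).trans (ext_apply f (timePt q t ht)).symm)
    ((hF q.1.2 q.2.2).trans (ext_apply f q).symm)

/-- At the first time at which a function vanishes its time derivative is non-positive. -/
lemma re_dt_nonpos {q : cylinder U T} {f : SmoothFn (cylinder U T)}
    (h0 : 0 < q.1.2) (hq : (ev q f).re = 0)
    (hf : ∀ t (ht : t ∈ Set.Icc 0 T), t < q.1.2 → 0 ≤ (ev (timePt q t ht) f).re) :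
    (ev q ((calculus _).dt f)).re ≤ 0 := by
  have h1 := hasDerivWithinAt_time q f (F := fun t => ext f (q.1.1, t))
    fun t ht => ext_apply f (timePt q t ht)
  have h2 : HasDerivWithinAt (fun t => (ext f (q.1.1, t)).re) (ev q ((calculus _).dt f)).re
      (Set.Icc 0 T) q.1.2 :=
    (Complex.reCLM.hasFDerivAt.comp_hasDerivWithinAt q.1.2 h1)
  have hmem : Set.Icc 0 T ∈ nhdsWithin q.1.2 (Set.Iio q.1.2) :=
    Filter.mem_of_superset (Ioo_mem_nhdsLT h0) fun t ht => ⟨ht.1.le, ht.2.le.trans q.2.2.2⟩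
  have h3 := h2.mono_of_mem_nhdsWithin hmem
  rw [hasDerivWithinAt_iff_tendsto_slope' (by simp)] at h3
  refine le_of_tendsto h3 ?_
  filter_upwards [Ioo_mem_nhdsLT h0] with t ht
  have ht' : t ∈ Set.Icc 0 T := ⟨ht.1.le, ht.2.le.trans q.2.2.2⟩
  have e1 : (ext f (q.1.1, t)).re = (ev (timePt q t ht') f).re :=
    congrArg Complex.re (ext_apply f (timePt q t ht'))
  have e2 : (ext f (q.1.1, q.1.2)).re = 0 := by rw [← hq]; exact congrArg _ (ext_apply f q)
  rw [slope_def_field, e1, e2, sub_zero]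
  exact div_nonpos_of_nonneg_of_nonpos (hf t ht' ht.2) (sub_nonpos.2 ht.2.le)

lemma second_deriv_nonneg {g g' : ℝ → ℝ} {g'' : ℝ} (hg : ∀ᶠ s in nhds 0, HasDerivAt g (g' s) s)
    (hg' : HasDerivAt g' g'' 0) (hmin : IsLocalMin g 0) : 0 ≤ g'' := by
  by_contra! hneg
  have h1 : deriv g =ᶠ[nhds 0] g' := hg.mono fun s hs => hs.deriv
  have h2 : deriv (deriv g) 0 = g'' := by rw [h1.deriv_eq, hg'.deriv]
  have h0 : deriv g 0 = 0 := hmin.deriv_eq_zero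
  have hmax := isLocalMax_of_deriv_deriv_neg (by rwa [h2]) h0 hg.self_of_nhds.continuousAt
  -- a local minimum that is also a local maximum is locally constant
  have hconst : g =ᶠ[nhds 0] fun _ => g 0 := by
    filter_upwards [hmin, hmax] with s hs hs' using le_antisymm hs' hs
  have h3 : deriv (deriv g) 0 = 0 := by
    have : deriv g =ᶠ[nhds 0] fun _ => 0 := by
      have := hconst.deriv
      simpa using this
    rw [this.deriv_eq]; simp
  rw [h2] at h3
  exact hneg.ne h3

/-- The second derivative test along a line in space. -/
lemma re_dirDeriv_dirDeriv_nonneg (hU : IsOpen U) {q : cylinder U T}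
    {f : SmoothFn (cylinder U T)}
    (hf : ∀ w (hw : w ∈ U), (ev q f).re ≤ (ev (spacePt q w hw) f).re) (v : Fin n → ℂ) :
    0 ≤ (ev q (dirDeriv (v, (0 : ℝ)) (dirDeriv (v, (0 : ℝ)) f))).re := by
  set L : ℝ → Fin n → ℂ := fun s => q.1.1 + s • v with hL
  have hLU : ∀ᶠ s in nhds (0 : ℝ), L s ∈ U := by
    have : ContinuousAt L 0 := by fun_prop
    exact this.eventually_mem (hU.mem_nhds (by simpa [hL] using q.2.1))
  have hLd : ∀ s, HasDerivAt L v s := fun s => by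
    have := ((hasDerivAt_id s).smul_const v).const_add q.1.1
    rw [one_smul] at this
    exact this
  have key : ∀ (f : SmoothFn (cylinder U T)) s (hs : L s ∈ U),
      HasDerivAt (fun s => (ext f (L s, q.1.2)).re)
        (ext (dirDeriv (v, (0 : ℝ)) f) (L s, q.1.2)).re s := by
    intro f s hs
    have h1 := hasFDerivAt_slice hU (spacePt q (L s) hs) f (F := fun w => ext f (w, q.1.2))
      fun w hw => ext_apply f (spacePt q w hw)
    have h2 := Complex.reCLM.hasFDerivAt.comp_hasDerivAt s (h1.comp_hasDerivAt s (hLd s))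
    have e := ext_apply (dirDeriv (v, (0 : ℝ)) f) (spacePt q (L s) hs)
    rw [ev_dirDeriv] at e
    rw [show ext (dirDeriv (v, (0 : ℝ)) f) (L s, q.1.2) = _ from e]
    exact h2
  have hL0 : L 0 = q.1.1 := by simp [hL]
  have h00 : L 0 ∈ U := by rw [hL0]; exact q.2.1
  have hg' := key (dirDeriv (v, (0 : ℝ)) f) 0 h00
  have hmin : IsLocalMin (fun s => (ext f (L s, q.1.2)).re) 0 := by
    filter_upwards [hLU] with s hs
    rw [hL0, ext_apply f q, show ext f (L s, q.1.2) = _ from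
      ext_apply f (spacePt q (L s) hs)]
    exact hf _ hs
  have := second_deriv_nonneg (hLU.mono fun s hs => key f s hs) hg' hmin
  rw [hL0] at this
  rwa [show ext _ (q.1.1, q.1.2) = _ from
    ext_apply (dirDeriv (v, (0 : ℝ)) (dirDeriv (v, (0 : ℝ)) f)) q] at this

/-- At a spatial minimum the trace of the complex Hessian against a Hermitian inner product is
non-negative. -/
lemma re_laplacian_nonneg (hU : IsOpen U) {q : cylinder U T}
    {f : SmoothFn (cylinder U T)}
    (hf : ∀ w (hw : w ∈ U), (ev q f).re ≤ (ev (spacePt q w hw) f).re)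
    {H Hi : Matrix (Fin n) (Fin n) ℂ} (h : IsInnerPair H Hi) :
    0 ≤ (∑ p, ∑ r, Hi r p * ev q ((calculus _).dz p ((calculus _).db r f))).re := by
  obtain ⟨C, hC⟩ := h.exists_basis
  have e : ∑ p, ∑ r, Hi r p * ev q ((calculus _).dz p ((calculus _).db r f)) =
      ∑ a, ev q (∑ p, ∑ r, (C a p * conj (C a r)) •
        (calculus _).dz p ((calculus _).db r f)) := by
    simp only [map_sum, ev_smul, hC, Matrix.mul_apply, conjTranspose_apply, Finset.sum_mul]
    conv_rhs => rw [Finset.sum_comm]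
    refine Finset.sum_congr rfl fun p _ => ?_
    rw [Finset.sum_comm]
    refine Finset.sum_congr rfl fun r _ => Finset.sum_congr rfl fun a _ => ?_
    rw [RCLike.star_def, mul_comm (conj (C r a))]
  rw [e, Complex.re_sum]
  refine Finset.sum_nonneg fun a _ => ?_
  rw [hessian_eq, ev_smul, map_add]
  have h1 := re_dirDeriv_dirDeriv_nonneg hU hf (C a)
  have h2 := re_dirDeriv_dirDeriv_nonneg hU hf (Complex.I • C a)
  have : ((1 / 4 : ℂ)) = ((1 / 4 : ℝ) : ℂ) := by norm_num
  rw [this, Complex.re_ofReal_mul, Complex.add_re]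
  positivity

end evaluation

end SmoothFn

end Calculus

/-! ### The maximum principle at a first zero -/

section Hermitian

variable {ι A : Type*} [CommRing A] [StarRing A] [Algebra ℂ A] [Fintype ι] [DecidableEq ι]
  (W : WirtingerCalculus ι A) {H Hi : Matrix ι ι A}

/-- `R_{ij̄kl̄} = -∂_i ∂_{j̄} g_{kl̄} + g^{pq̄} ∂_i g_{kq̄} ∂_{j̄} g_{pl̄}`. -/
lemma WirtingerCalculus.curvEnd_mul_metric (h2 : Hi * H = 1) (hH : Hᴴ = H) (i j : ι) :
    W.curvEnd H Hi i j * H =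
      W.conn H Hi i * H * (W.conn H Hi j)ᴴ - dM (W.db j) (dM (W.dz i) H) := by
  rw [W.dz_metric h2, dM_mul, W.db_metric h2 hH, curvEnd]
  noncomm_ring

lemma WirtingerCalculus.curvEnd_mul_metric_conjTranspose (h2 : Hi * H = 1)
    (hH : Hᴴ = H) (i j : ι) :
    (W.curvEnd H Hi i j * H)ᴴ = W.curvEnd H Hi j i * H := by
  rw [W.curvEnd_mul_metric h2 hH, W.curvEnd_mul_metric h2 hH, conjTranspose_sub,
    conjTranspose_mul, conjTranspose_mul, conjTranspose_conjTranspose, hH, ← Matrix.mul_assoc,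
    ← W.dM_dz_conjTranspose, ← W.dM_db_conjTranspose, hH, dM_comm (W.db_dz i j)]

end Hermitian

section Calculus

variable {n : ℕ}

namespace SmoothFn

section affine

variable {S : Set ((Fin n → ℂ) × ℝ)} [SmoothDomain S]

/-- The complex coordinate `zᵖ` as a smooth function. -/
def coord (S : Set ((Fin n → ℂ) × ℝ)) (p : Fin n) : SmoothFn S :=
  mk (fun q => q.1 p) (((contDiff_apply ℝ ℂ p).comp contDiff_fst).contDiffOn)

/-- Time as a smooth function. -/
def time (S : Set ((Fin n → ℂ) × ℝ)) : SmoothFn S :=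
  mk (fun q => (q.2 : ℂ)) ((Complex.ofRealCLM.contDiff.comp contDiff_snd).contDiffOn)

lemma dirDeriv_coord (v : (Fin n → ℂ) × ℝ) (p : Fin n) :
    dirDeriv v (coord S p) = algebraMap ℂ _ (v.1 p) := ext_ev fun q => by
  have h : HasFDerivWithinAt (fun q : (Fin n → ℂ) × ℝ => q.1 p)
      ((ContinuousLinearMap.proj (R := ℝ) (φ := fun _ : Fin n => ℂ) p).comp
        (ContinuousLinearMap.fst ℝ (Fin n → ℂ) ℝ)) S q :=
    ((ContinuousLinearMap.proj (R := ℝ) (φ := fun _ : Fin n => ℂ) p).comp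
        (ContinuousLinearMap.fst ℝ (Fin n → ℂ) ℝ)).hasFDerivWithinAt
  rw [ev_dirDeriv_of_hasFDerivWithinAt (fun _ => rfl) h]
  rfl

lemma dirDeriv_time (v : (Fin n → ℂ) × ℝ) :
    dirDeriv v (time S) = algebraMap ℂ _ (v.2 : ℂ) := ext_ev fun q => by
  have h : HasFDerivWithinAt (fun q : (Fin n → ℂ) × ℝ => (q.2 : ℂ))
      (Complex.ofRealCLM.comp (ContinuousLinearMap.snd ℝ (Fin n → ℂ) ℝ)) S q :=
    (Complex.ofRealCLM.comp (ContinuousLinearMap.snd ℝ (Fin n → ℂ) ℝ)).hasFDerivWithinAt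
  rw [ev_dirDeriv_of_hasFDerivWithinAt (fun _ => rfl) h]
  rfl

lemma dz_coord (i p : Fin n) :
    (calculus S).dz i (coord S p) = algebraMap ℂ _ (if p = i then 1 else 0) := by
  refine ext_ev fun q => ?_
  rw [dz_apply, coordDeriv, coordDeriv, dirDeriv_coord, dirDeriv_coord, ev_smul, map_sub, ev_smul,
    ev_algebraMap, ev_algebraMap, ev_algebraMap]
  by_cases h : p = i
  · subst h; simp; norm_num
  · simp [h]

lemma db_coord (i p : Fin n) : (calculus S).db i (coord S p) = 0 := by
  refine ext_ev fun q => ?_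
  rw [db_apply, coordDeriv, coordDeriv, dirDeriv_coord, dirDeriv_coord, ev_smul, map_add, ev_smul,
    ev_algebraMap, ev_algebraMap, map_zero]
  by_cases h : p = i
  · subst h; simp
  · simp [h]

lemma dt_coord (p : Fin n) : (calculus S).dt (coord S p) = 0 :=
  (dirDeriv_coord _ _).trans (by simp)

lemma dz_time (i : Fin n) : (calculus S).dz i (time S) = 0 := by
  simp [dz_apply, coordDeriv, dirDeriv_time]

lemma db_time (i : Fin n) : (calculus S).db i (time S) = 0 := by
  simp [db_apply, coordDeriv, dirDeriv_time]

lemma dt_time : (calculus S).dt (time S) = 1 :=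
  (dirDeriv_time _).trans (by simp)

/-- Affine functions with prescribed value and prescribed holomorphic derivatives. -/
lemma exists_affine (z : Fin n → ℂ) (a₀ : ℂ) (a : Fin n → ℂ) : ∃ f : SmoothFn S,
    (∀ q : S, q.1.1 = z → ev q f = a₀) ∧ (∀ p, (calculus S).dz p f = algebraMap ℂ _ (a p)) ∧
    (∀ p, (calculus S).db p f = 0) ∧ (calculus S).dt f = 0 := by
  refine ⟨algebraMap ℂ _ a₀ + ∑ p, a p • (coord S p - algebraMap ℂ _ (z p)), ?_, ?_, ?_, ?_⟩
  · intro q hq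
    simp only [map_add, map_sum, ev_smul, map_sub, ev_algebraMap]
    refine add_eq_left.2 (Finset.sum_eq_zero fun p _ => ?_)
    rw [show ev q (coord S p) = q.1.1 p from rfl, hq]
    simp
  · intro p
    simp only [map_add, map_sum, Derivation.map_smul, map_sub, Derivation.map_algebraMap, dz_coord]
    simp [Algebra.smul_def, apply_ite]
  · intro p
    simp only [map_add, map_sum, Derivation.map_smul, map_sub, Derivation.map_algebraMap, db_coord]
    simp
  · simp only [map_add, map_sum, Derivation.map_smul, map_sub, Derivation.map_algebraMap, dt_coord]
    simp

end affine

section maximum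

variable {U : Set (Fin n → ℂ)} {T : ℝ} [SmoothDomain (cylinder U T)]
  {H Hi : Matrix (Fin n) (Fin n) (SmoothFn (cylinder U T))}

/-- The components `R_{ij̄k}^l` of the curvature at a point of space-time. -/
def curvAt (H Hi : Matrix (Fin n) (Fin n) (SmoothFn (cylinder U T))) (q : cylinder U T)
    (i j : Fin n) : Matrix (Fin n) (Fin n) ℂ :=
  ((calculus (cylinder U T)).curvEnd H Hi i j).map (ev q)

/-- The function `c(t) g(x, x̄) (-Ric + ε g)(u, ū) + s R(u, ū, x, x̄)` with `c(t) = 1 + κ t`, whose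
positivity for `s = ±1` is preserved by the flow. -/
def barrier (H Hi : Matrix (Fin n) (Fin n) (SmoothFn (cylinder U T))) (ε κ s : ℝ)
    (q : cylinder U T) (u x : Fin n → ℂ) : ℝ :=
  (1 + κ * q.1.2) * (sesq (H.map (ev q)) x x).re *
      (sesq (ricPert (curvAt H Hi q) (H.map (ev q)) ε) u u).re
    + s * (sesq (contract u (curvAt H Hi q) * H.map (ev q)) x x).re

omit [SmoothDomain (cylinder U T)] in
lemma map_contract (q : cylinder U T) (u : Fin n → SmoothFn (cylinder U T))
    (N : Fin n → Fin n → Matrix (Fin n) (Fin n) (SmoothFn (cylinder U T))) :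
    (contract u N).map (ev q) = contract (fun i => ev q (u i)) (fun i j => (N i j).map (ev q)) := by
  simp only [contract, map_sum_ev, map_smul_ev, map_mul, ev_star, RCLike.star_def]

omit [SmoothDomain (cylinder U T)] in
/-- Evaluation of the row-vector form `x M H x*` as a sesquilinear form. -/
lemma sandwich_apply (q : cylinder U T) (x : Fin n → SmoothFn (cylinder U T))
    (M : Matrix (Fin n) (Fin n) (SmoothFn (cylinder U T))) :
    ev q ((replicateRow Unit x * M * H * (replicateRow Unit x)ᴴ) () ()) =
      sesq (M.map (ev q) * H.map (ev q)) (fun i => ev q (x i)) (fun i => ev q (x i)) := by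
  rw [← Matrix.map_mul, sesq, Matrix.mul_assoc _ M, Matrix.mul_apply, map_sum, Finset.sum_comm]
  refine Finset.sum_congr rfl fun l _ => ?_
  rw [Matrix.mul_apply, map_mul, map_sum, Finset.sum_mul]
  refine Finset.sum_congr rfl fun k _ => ?_
  rw [conjTranspose_apply, replicateRow_apply, replicateRow_apply, ev_star, map_mul, Matrix.map_apply]
  ring

/-- The tensor `c(t) (-Ric_{ij̄} + ε g_{ij̄}) 1 + s F_{ij̄}` whose contraction is the barrier. -/
def barrierTensor (H Hi : Matrix (Fin n) (Fin n) (SmoothFn (cylinder U T))) (ε κ s : ℝ)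
    (i j : Fin n) : Matrix (Fin n) (Fin n) (SmoothFn (cylinder U T)) :=
  (1 + (κ : ℂ) • time (cylinder U T)) •
    ((-((calculus (cylinder U T)).curvEnd H Hi i j).trace + (ε : ℂ) • H i j) •
      (1 : Matrix (Fin n) (Fin n) (SmoothFn (cylinder U T))))
    + algebraMap ℂ (SmoothFn (cylinder U T)) s • (calculus (cylinder U T)).curvEnd H Hi i j

omit [SmoothDomain (cylinder U T)] in
lemma ev_growth (κ : ℝ) (q : cylinder U T) :
    ev q (1 + (κ : ℂ) • time (cylinder U T)) = ((1 + κ * q.1.2 : ℝ) : ℂ) := by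
  rw [map_add, map_one, ev_smul]
  push_cast; rfl

lemma ev_ricPert (ε : ℝ) (q : cylinder U T) (i j : Fin n) :
    ev q (-((calculus (cylinder U T)).curvEnd H Hi i j).trace + (ε : ℂ) • H i j) =
      ricPert (curvAt H Hi q) (H.map (ev q)) ε i j := by
  rw [map_add, map_neg, ev_smul]
  simp only [Matrix.trace, map_sum]
  rfl

lemma map_barrierTensor (ε κ s : ℝ) (q : cylinder U T) (i j : Fin n) :
    (barrierTensor H Hi ε κ s i j).map (ev q) = (((1 + κ * q.1.2 : ℝ) : ℂ) *
        ricPert (curvAt H Hi q) (H.map (ev q)) ε i j) • (1 : Matrix (Fin n) (Fin n) ℂ) +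
        (s : ℂ) • curvAt H Hi q i j := by
  rw [barrierTensor, Matrix.map_add _ (map_add (ev q)), map_smul_ev, map_smul_ev, map_smul_ev,
    ev_growth, ev_ricPert, ev_algebraMap, Matrix.map_one _ (map_zero _) (map_one _), smul_smul]
  rfl

lemma re_sesq_barrierTensor {q : cylinder U T} (hherm : (H.map (ev q))ᴴ = H.map (ev q))
    (ε κ s : ℝ) (u x : Fin n → ℂ) :
    (sesq (contract u (fun i j => (barrierTensor H Hi ε κ s i j).map (ev q)) * H.map (ev q))
      x x).re = barrier H Hi ε κ s q u x := by
  simp only [map_barrierTensor]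
  rw [contract_add, contract_mul_smul_one, contract_smul, Matrix.add_mul, sesq_add,
    Matrix.smul_mul, Matrix.smul_mul, Matrix.one_mul, sesq_smul, sesq_smul, Complex.add_re,
    mul_assoc, Complex.re_ofReal_mul, Complex.re_ofReal_mul, Complex.mul_re,
    sesq_self_im hherm, mul_zero, sub_zero, barrier]
  ring

lemma neg_add_smul_smul_one {A ι : Type*} [CommRing A] [Algebra ℂ A] [DecidableEq ι] (ε : ℂ)
    (a b : A) : (-a + ε • b) • (1 : Matrix ι ι A) =
      algebraMap ℂ A (-1) • (a • (1 : Matrix ι ι A)) + algebraMap ℂ A ε • (b • 1) := by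
  rw [smul_smul, smul_smul, ← add_smul, map_neg, map_one, neg_one_mul, ← Algebra.smul_def]

/-- The heat operator on the barrier tensor: the growth of `c(t)` and the reaction terms. -/
lemma map_heatOp_barrierTensor (ε κ s : ℝ) (q : cylinder U T) (i j : Fin n) :
    ((calculus _).heatOp H Hi (barrierTensor H Hi ε κ s) i j).map (ev q) =
      ((κ : ℂ) * ricPert (curvAt H Hi q) (H.map (ev q)) ε i j) • (1 : Matrix (Fin n) (Fin n) ℂ)
      + (((1 + κ * q.1.2 : ℝ) : ℂ) •
        (-(((calculus _).heatOp H Hi ((calculus _).curvEnd H Hi) i j).map (ev q)).trace •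
          (1 : Matrix (Fin n) (Fin n) ℂ)
        + (ε : ℂ) • ((calculus _).heatOp H Hi (fun i j => H i j • 1) i j).map (ev q))
      + (s : ℂ) • ((calculus _).heatOp H Hi ((calculus _).curvEnd H Hi) i j).map (ev q)) := by
  set W := calculus (cylinder U T) with hW
  set c : SmoothFn (cylinder U T) := 1 + (κ : ℂ) • time (cylinder U T) with hc
  have hcz : ∀ i, W.dz i c = 0 := fun i => by
    rw [hc, map_add, Derivation.map_one_eq_zero, Derivation.map_smul, dz_time, smul_zero, add_zero]
  have hcb : ∀ i, W.db i c = 0 := fun i => by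
    rw [hc, map_add, Derivation.map_one_eq_zero, Derivation.map_smul, db_time, smul_zero, add_zero]
  have hct : W.dt c = algebraMap ℂ _ (κ : ℂ) := by
    rw [hc, map_add, Derivation.map_one_eq_zero, Derivation.map_smul, dt_time, zero_add,
      Algebra.algebraMap_eq_smul_one]
  have z1 : ∀ a : ℂ, ∀ i, W.dz i (algebraMap ℂ (SmoothFn (cylinder U T)) a) = 0 := fun a i =>
    Derivation.map_algebraMap _ _
  have z2 : ∀ a : ℂ, ∀ i, W.db i (algebraMap ℂ (SmoothFn (cylinder U T)) a) = 0 := fun a i =>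
    Derivation.map_algebraMap _ _
  have z3 : ∀ a : ℂ, W.dt (algebraMap ℂ (SmoothFn (cylinder U T)) a) = 0 := fun a =>
    Derivation.map_algebraMap _ _
  have eN : barrierTensor H Hi ε κ s = fun i j => c •
      (algebraMap ℂ (SmoothFn (cylinder U T)) (-1) • ((W.curvEnd H Hi i j).trace •
        (1 : Matrix (Fin n) (Fin n) (SmoothFn (cylinder U T))))
      + algebraMap ℂ (SmoothFn (cylinder U T)) ε • (H i j •
        (1 : Matrix (Fin n) (Fin n) (SmoothFn (cylinder U T)))))
      + algebraMap ℂ (SmoothFn (cylinder U T)) s • W.curvEnd H Hi i j := by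
    ext1 i; ext1 j
    rw [barrierTensor, neg_add_smul_smul_one]
  rw [eN, W.heatOp_add, W.heatOp_smul c hcz hcb, W.heatOp_smul _ (z1 s) (z2 s),
    W.heatOp_add, W.heatOp_smul _ (z1 _) (z2 _), W.heatOp_smul _ (z1 _) (z2 _), z3, z3, z3,
    W.heatOp_trace, hct]
  simp only [zero_smul, zero_add, Matrix.map_add _ (map_add (ev q)), map_smul_ev, ev_algebraMap,
    Matrix.map_one _ (map_zero (ev q)) (map_one (ev q)), hc, ev_growth]
  have hmt : ∀ M : Matrix (Fin n) (Fin n) (SmoothFn (cylinder U T)),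
      ev q M.trace = (M.map (ev q)).trace := fun M => by simp [Matrix.trace]
  rw [← ev_ricPert, map_add, map_neg, ev_smul]
  simp only [hmt]
  simp only [neg_smul, smul_add, smul_smul, add_smul, mul_add, mul_neg, smul_neg]
  module

set_option maxHeartbeats 1000000 in
/-- Positivity of the barrier functions cannot fail for the first time at a positive time. -/
theorem barrier_no_first_zero (hU : IsOpen U) (h1 : H * Hi = 1) (h2 : Hi * H = 1) (hH : Hᴴ = H)
    (hflow : dM (calculus _).dt H = -((calculus _).meanCurv H Hi * H))
    {q : cylinder U T} (hpos : IsInnerPair (H.map (ev q)) (Hi.map (ev q)))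
    (hherm : ∀ q' : cylinder U T, (H.map (ev q'))ᴴ = H.map (ev q'))
    {Λ : ℝ} (hΛ : 0 ≤ Λ) (bH : ∀ k l, ‖ev q (H k l)‖ ≤ Λ) (bHi : ∀ k l, ‖ev q (Hi k l)‖ ≤ Λ)
    (bF : ∀ i j k l, ‖ev q ((calculus _).curvEnd H Hi i j k l)‖ ≤ Λ)
    (bΘ : ∀ i j k l, ‖ev q ((calculus _).heatOp H Hi (fun i j => H i j • 1) i j k l)‖ ≤ Λ)
    {ε κ s : ℝ} (hε : 0 < ε) (hε1 : ε ≤ 1) (hs : |s| ≤ 1) (hκ : reactionConst n Λ < κ)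
    (hκt : κ * q.1.2 ≤ 1) (hq0 : 0 < q.1.2)
    (hpinch : Pinched (curvAt H Hi q) (H.map (ev q)) ε (1 + κ * q.1.2))
    (hspace : ∀ w hw u x, 0 ≤ barrier H Hi ε κ s (spacePt q w hw) u x)
    {u₀ x₀ : Fin n → ℂ} (hu₀ : u₀ ≠ 0) (hx₀ : x₀ ≠ 0)
    (htime : ∀ t ht, t < q.1.2 → 0 ≤ barrier H Hi ε κ s (timePt q t ht) u₀ x₀)
    (hzero : barrier H Hi ε κ s q u₀ x₀ = 0) : False := by
  -- extend `u₀` and `x₀` affinely so that they are parallel at `q`; they are constant in time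
  choose u huv huz hub hut using fun r => exists_affine (S := cylinder U T) q.1.1 (u₀ r)
    (fun p => -∑ i, u₀ i * ev q ((calculus (cylinder U T)).conn H Hi i p r))
  choose x hxv hxz hxb hxt using fun k => exists_affine (S := cylinder U T) q.1.1 (x₀ k)
    (fun p => -∑ i, x₀ i * ev q ((calculus (cylinder U T)).conn H Hi p i k))
  have hκ0 : 0 < κ := (reactionConst_nonneg (Nat.cast_nonneg n) hΛ).trans_lt hκ
  set N := barrierTensor H Hi ε κ s with hN
  set φ := (replicateRow Unit x * contract u N * H * (replicateRow Unit x)ᴴ) () () with hφ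
  have hφv : ∀ q' : cylinder U T, (ev q' φ).re =
      barrier H Hi ε κ s q' (fun i => ev q' (u i)) (fun i => ev q' (x i)) := by
    intro q'
    rw [hφ, sandwich_apply, map_contract, re_sesq_barrierTensor (hherm q')]
  have hheat : ev q ((calculus (cylinder U T)).heat Hi (replicateRow Unit x * contract u N * H * (replicateRow Unit x)ᴴ)
      () ()) = sesq (contract u₀ (fun i j => ((calculus (cylinder U T)).heatOp H Hi N i j).map (ev q)) * H.map (ev q))
        x₀ x₀ := by
    have hδ : ∀ p, (dM ((calculus (cylinder U T)).dz p) (replicateRow Unit x) +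
        replicateRow Unit x * (calculus (cylinder U T)).conn H Hi p).map (ev q) = 0 := by
      intro p
      ext a k
      rw [Matrix.map_apply, Matrix.add_apply, dM_apply, replicateRow_apply, hxz, map_add,
        ev_algebraMap, Matrix.mul_apply, map_sum]
      simp only [map_mul, replicateRow_apply, hxv _ q rfl]
      simp
    have hδ' : ∀ p, (dM ((calculus (cylinder U T)).dz p) (replicateRow Unit x) +
        replicateRow Unit x * (calculus (cylinder U T)).conn H Hi p)ᴴ.map (ev q) = 0 := by
      intro p
      ext k a
      have := congrFun (congrFun (hδ p) a) k
      rw [Matrix.map_apply] at this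
      rw [Matrix.map_apply, conjTranspose_apply, ev_star, this]
      simp
    have hxb' : ∀ p, dM ((calculus (cylinder U T)).db p) (replicateRow Unit x) = 0 := fun p => by
      ext a k; rw [dM_apply, replicateRow_apply, hxb]; rfl
    have hxt' : dM (calculus (cylinder U T)).dt (replicateRow Unit x) = 0 := by
      ext a k; rw [dM_apply, replicateRow_apply, hxt]; rfl
    have hu : ∀ p r, ev q ((calculus (cylinder U T)).dz p (u r)) = -ev q (∑ i, u i * (calculus (cylinder U T)).conn H Hi i p r) := by
      intro p r
      rw [huz, ev_algebraMap, map_sum]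
      simp only [map_mul, huv _ q rfl]
    have e1 := (calculus (cylinder U T)).ev_heat_sandwich h1 h2 hH (ev q) hflow (replicateRow Unit x) hxb' hxt' hδ hδ'
      (contract u N)
    have e2 := (calculus (cylinder U T)).ev_heat_contract (H := H) (Hi := Hi) (ev q) u (fun q r => hub r q) hut hu
      (fun p r => by rw [ev_star, ev_star, hu, map_neg]) N
    have e3 := congrFun (congrFun e1 ()) ()
    rw [Matrix.map_apply, Matrix.map_apply, sandwich_apply, e2, map_contract] at e3
    rw [e3]
    simp only [huv _ q rfl, hxv _ q rfl]
  have hreact : 0 < (ev q ((calculus (cylinder U T)).heat Hi (replicateRow Unit x * contract u N * H *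
      (replicateRow Unit x)ᴴ) () ())).re := by
    rw [hheat]
    rw [show (fun i j => ((calculus (cylinder U T)).heatOp H Hi N i j).map (ev q)) = _ from
      funext₂ (map_heatOp_barrierTensor ε κ s q)]
    have hκq : 0 ≤ κ * q.1.2 := mul_nonneg hκ0.le hq0.le
    refine Pinched.reaction_pos hpos (F := curvAt H Hi q)
      (X := fun i j => ((calculus (cylinder U T)).heatOp H Hi ((calculus (cylinder U T)).curvEnd H Hi) i j).map (ev q)) ?_ ?_ (fun k l => bH k l)
      (fun k l => bHi k l) (fun i j k l => bF i j k l) (fun i j k l => bΘ i j k l) hΛ hε hε1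
      (by linarith) (by linarith) hs hpinch (by simpa using hκ) hu₀ hx₀
    · intro i j
      have := congrArg (fun M => M.map (ev q)) ((calculus (cylinder U T)).curvEnd_mul_metric_conjTranspose h2 hH i j)
      simp only [Matrix.map_mul] at this
      rw [curvAt, curvAt, ← this, ← Matrix.map_mul]
      ext a b
      rw [conjTranspose_apply, Matrix.map_apply, Matrix.map_apply, conjTranspose_apply, ev_star]
      rfl
    · intro i j
      have := congrArg (fun M => M.map (ev q)) ((calculus (cylinder U T)).heatOp_curvEnd h1 h2 hH hflow i j)
      simp only [map_sum_ev, Matrix.map_add _ (map_add (ev q)), map_smul_ev,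
        Matrix.map_sub _ (map_sub (ev q)), Matrix.map_mul] at this
      rw [this]
      refine Finset.sum_congr rfl fun p _ => Finset.sum_congr rfl fun r _ => ?_
      rw [← Matrix.map_apply (f := ev q) (M := Hi * _), Matrix.map_mul]
      rfl
  have hle : (ev q ((calculus (cylinder U T)).heat Hi (replicateRow Unit x * contract u N * H *
      (replicateRow Unit x)ᴴ) () ())).re ≤ 0 := by
    have e : ev q ((calculus (cylinder U T)).heat Hi (replicateRow Unit x * contract u N * H *
        (replicateRow Unit x)ᴴ) () ()) = ev q ((calculus (cylinder U T)).dt φ) -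
        ∑ p, ∑ r, (Hi.map (ev q)) r p * ev q ((calculus (cylinder U T)).dz p ((calculus (cylinder U T)).db r φ)) := by
      rw [heat, Matrix.sub_apply, map_sub]
      simp only [Matrix.sum_apply, Matrix.smul_apply, map_sum, smul_eq_mul, map_mul]
      rfl
    have h0 : (ev q φ).re = 0 := by
      rw [hφv, ← hzero]; simp only [huv _ q rfl, hxv _ q rfl]
    have ht := re_dt_nonpos hq0 h0 fun t ht htq => by
      rw [hφv]
      simp only [huv _ (timePt q t ht) rfl, hxv _ (timePt q t ht) rfl]
      exact htime t ht htq
    have hL := re_laplacian_nonneg hU (f := φ) (q := q) (fun w hw => by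
      rw [h0]
      exact (hspace w hw _ _).trans_eq (hφv (spacePt q w hw)).symm) hpos
    rw [e, Complex.sub_re]
    linarith
  exact absurd hreact hle.not_gt

end maximum

end SmoothFn

end Calculus

/-! ### The curvature of a family of metrics in a chart -/

section Family

variable {n : ℕ}

/-- The components `R_{ij̄k}^l` at a point as matrices in `k, l`. -/
def curvMat (G : (Fin n → ℂ) → Matrix (Fin n) (Fin n) ℂ) (z : Fin n → ℂ) (i j : Fin n) :
    Matrix (Fin n) (Fin n) ℂ :=
  Matrix.of fun k l => curvUp G z i j k l

lemma curv_eq (G : (Fin n → ℂ) → Matrix (Fin n) (Fin n) ℂ) (z : Fin n → ℂ) (i j k l : Fin n) :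
    curv G z i j k l = (curvMat G z i j * G z) k l := by
  rw [curv, Matrix.mul_apply]
  exact Finset.sum_congr rfl fun p _ => mul_comm _ _

lemma ricci_eq {G : (Fin n → ℂ) → Matrix (Fin n) (Fin n) ℂ} {z : Fin n → ℂ}
    (hG : G z * (G z)⁻¹ = 1) (i j : Fin n) : ricci G z i j = (curvMat G z i j).trace := by
  have h : (curvMat G z i j).trace = (curvMat G z i j * G z * (G z)⁻¹).trace := by
    rw [Matrix.mul_assoc, hG, mul_one]
  rw [ricci, h, Matrix.trace]
  refine Finset.sum_congr rfl fun k _ => ?_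
  rw [diag_apply, Matrix.mul_apply]
  refine Finset.sum_congr rfl fun l _ => ?_
  rw [curv_eq, invMetric, mul_comm]

lemma metricForm_eq (G : (Fin n → ℂ) → Matrix (Fin n) (Fin n) ℂ) (z x y : Fin n → ℂ) :
    metricForm G z x y = sesq (G z) x y := rfl

lemma curvForm_eq (G : (Fin n → ℂ) → Matrix (Fin n) (Fin n) ℂ) (z u v x y : Fin n → ℂ) :
    curvForm G z u v x y =
      sesq (Matrix.of fun i j => sesq (curvMat G z i j * G z) x y) u v := by
  simp only [curvForm, sesq, Matrix.of_apply, curv_eq, Finset.sum_mul]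
  refine Finset.sum_congr rfl fun i _ => Finset.sum_congr rfl fun j _ =>
    Finset.sum_congr rfl fun k _ => Finset.sum_congr rfl fun l _ => by ring

lemma ricciForm_eq {G : (Fin n → ℂ) → Matrix (Fin n) (Fin n) ℂ} {z : Fin n → ℂ}
    (hG : G z * (G z)⁻¹ = 1) (u v : Fin n → ℂ) :
    ricciForm G z u v = sesq (Matrix.of fun i j => (curvMat G z i j).trace) u v := by
  simp only [ricciForm, sesq, ricci_eq hG, Matrix.of_apply]

/-- The barrier function of a metric at a point; see `SmoothFn.barrier`. -/
def barrierAt (G : (Fin n → ℂ) → Matrix (Fin n) (Fin n) ℂ) (c ε s : ℝ) (z u x : Fin n → ℂ) : ℝ :=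
  c * (sesq (G z) x x).re * (sesq (ricPert (curvMat G z) (G z) ε) u u).re
    + s * (sesq (contract u (curvMat G z) * G z) x x).re

namespace SmoothFn

lemma isUnit_of_ev_ne_zero {E : Type*} [NormedAddCommGroup E] [NormedSpace ℝ E] {S : Set E}
    (f : SmoothFn S) (hf : ∀ q, ev q f ≠ 0) : IsUnit f := by
  have h : ContDiffOn ℝ ∞ (fun q => (ext f q)⁻¹) S :=
    (contDiffOn_ext f).inv fun q hq => by rw [ext_apply f ⟨q, hq⟩]; exact hf _
  refine IsUnit.of_mul_eq_one (mk _ h) (ext_ev fun q => ?_)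
  rw [map_mul, map_one, ev_mk, ext_apply, mul_inv_cancel₀ (hf q)]

variable {U : Set (Fin n → ℂ)} {T : ℝ} {G : ℝ → (Fin n → ℂ) → Matrix (Fin n) (Fin n) ℂ}

/-- A smooth family of matrices on `U × [0, T]` as a matrix of smooth functions. -/
def ofFamily (hG : ∀ i j, ContDiffOn ℝ ∞ (fun q : (Fin n → ℂ) × ℝ => G q.2 q.1 i j)
    (cylinder U T)) : Matrix (Fin n) (Fin n) (SmoothFn (cylinder U T)) :=
  Matrix.of fun i j => mk _ (hG i j)

variable (hG : ∀ i j, ContDiffOn ℝ ∞ (fun q : (Fin n → ℂ) × ℝ => G q.2 q.1 i j) (cylinder U T))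
include hG

lemma map_ofFamily (q : cylinder U T) : (ofFamily hG).map (ev q) = G q.1.2 q.1.1 := rfl

variable (hdet : ∀ t ∈ Set.Icc 0 T, ∀ z ∈ U, (G t z).det ≠ 0)
include hdet

lemma isUnit_det_ofFamily : IsUnit (ofFamily hG).det := by
  refine isUnit_of_ev_ne_zero _ fun q => ?_
  rw [RingHom.map_det]
  exact hdet _ q.2.2 _ q.2.1

lemma ofFamily_mul_inv : ofFamily hG * (ofFamily hG)⁻¹ = 1 :=
  Matrix.mul_nonsing_inv _ (isUnit_det_ofFamily hG hdet)

lemma ofFamily_inv_mul : (ofFamily hG)⁻¹ * ofFamily hG = 1 :=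
  Matrix.nonsing_inv_mul _ (isUnit_det_ofFamily hG hdet)

lemma map_inv_ofFamily (q : cylinder U T) :
    ((ofFamily hG)⁻¹).map (ev q) = (G q.1.2 q.1.1)⁻¹ := by
  refine (Matrix.inv_eq_right_inv ?_).symm
  rw [← map_ofFamily hG q, ← Matrix.map_mul, ofFamily_mul_inv hG hdet,
    Matrix.map_one _ (map_zero _) (map_one _)]

variable [SmoothDomain (cylinder U T)] (hU : IsOpen U)
include hU

lemma christoffel_eq (q : cylinder U T) (i j k : Fin n) : christoffel (G q.1.2) q.1.1 i j k =
    ev q ((calculus _).conn (ofFamily hG) (ofFamily hG)⁻¹ i j k) := by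
  rw [christoffel, WirtingerCalculus.conn, Matrix.mul_apply, map_sum]
  refine Finset.sum_congr rfl fun l _ => ?_
  rw [map_mul, mul_comm, dM_apply, dz_slice hU q (ofFamily hG j l) fun w hw => rfl, invMetric,
    ← map_inv_ofFamily hG hdet, Matrix.map_apply]

lemma curvAt_ofFamily (q : cylinder U T) :
    curvAt (ofFamily hG) (ofFamily hG)⁻¹ q = curvMat (G q.1.2) q.1.1 := by
  ext i j k l
  rw [curvAt, Matrix.map_apply, curvMat, Matrix.of_apply, curvUp, curvEnd, Matrix.neg_apply,
    map_neg, dM_apply, dzbar_slice hU q ((calculus _).conn (ofFamily hG) (ofFamily hG)⁻¹ i k l)]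
  intro w hw
  exact christoffel_eq hG hdet hU (spacePt q w hw) i k l

lemma barrier_ofFamily (ε κ s : ℝ) (q : cylinder U T) (u x : Fin n → ℂ) :
    barrier (ofFamily hG) (ofFamily hG)⁻¹ ε κ s q u x =
      barrierAt (G q.1.2) (1 + κ * q.1.2) ε s q.1.1 u x := by
  rw [barrier, barrierAt, curvAt_ofFamily hG hdet hU, map_ofFamily]

lemma secondRicci_eq (q : cylinder U T) (i j : Fin n) : secondRicci (G q.1.2) q.1.1 i j =
    ev q (((calculus _).meanCurv (ofFamily hG) (ofFamily hG)⁻¹ * ofFamily hG) i j) := by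
  have h : ((calculus _).meanCurv (ofFamily hG) (ofFamily hG)⁻¹ * ofFamily hG).map (ev q) =
      (∑ k, ∑ l, (G q.1.2 q.1.1)⁻¹ l k • curvMat (G q.1.2) q.1.1 k l) * G q.1.2 q.1.1 := by
    rw [Matrix.map_mul, map_ofFamily, meanCurv]
    simp only [map_sum_ev, map_smul_ev]
    simp only [← map_inv_ofFamily hG hdet, ← curvAt_ofFamily hG hdet hU]
    rfl
  rw [← Matrix.map_apply (f := ev q)
    (M := (calculus _).meanCurv (ofFamily hG) (ofFamily hG)⁻¹ * ofFamily hG), h]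
  simp only [secondRicci, curv_eq, invMetric, Finset.sum_mul, Matrix.sum_apply, Matrix.smul_mul,
    Matrix.smul_apply, smul_eq_mul]

lemma dt_ofFamily (hflow : ∀ z ∈ U, ∀ t ∈ Set.Icc 0 T, ∀ i j,
      HasDerivWithinAt (fun s => G s z i j) (-secondRicci (G t) z i j) (Set.Icc 0 T) t)
    (hT : 0 < T) : dM (calculus _).dt (ofFamily hG) =
      -((calculus _).meanCurv (ofFamily hG) (ofFamily hG)⁻¹ * ofFamily hG) := by
  refine Matrix.ext fun i j => ext_ev fun q => ?_
  rw [dM_apply, Matrix.neg_apply, map_neg, ← secondRicci_eq hG hdet hU]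
  exact (uniqueDiffOn_Icc hT _ q.2.2).eq_deriv _
    (hasDerivWithinAt_time q (ofFamily hG i j) fun t ht => rfl) (hflow _ q.2.1 _ q.2.2 i j)

end SmoothFn

end Family

/-! ### Change of holomorphic coordinates -/

section ChangeOfCoordinates

namespace WirtingerCalculus

variable {ι A A' : Type*} [Fintype ι] [DecidableEq ι] [CommRing A] [StarRing A] [Algebra ℂ A]
  [CommRing A'] [StarRing A'] [Algebra ℂ A'] (W : WirtingerCalculus ι A)
  (W' : WirtingerCalculus ι A') {ψ : A' →+* A} {B Bi : Matrix ι ι A} {H' Hi' : Matrix ι ι A'}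

/-- The Chern curvature is a tensor: its transformation under a pull-back `ψ` along a holomorphic
map with Jacobian matrix `B`. -/
lemma curvEnd_pullback (hB : B * Bi = 1) (hBb : ∀ j, dM (W.db j) B = 0)
    (hz : ∀ i f, W.dz i (ψ f) = ∑ a, B i a * ψ (W'.dz a f))
    (hb : ∀ j f, W.db j (ψ f) = ∑ b, star (B j b) * ψ (W'.db b f))
    (h1 : H' * Hi' = 1) (i j : ι) :
    W.curvEnd (B * H'.map ψ * Bᴴ) (Biᴴ * Hi'.map ψ * Bi) i j =
      ∑ a, ∑ b, (B i a * star (B j b)) • (B * (W'.curvEnd H' Hi' a b).map ψ * Bi) := by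
  have hB' : Bi * B = 1 := mul_eq_one_comm.1 hB
  have hBB : Bᴴ * Biᴴ = 1 := by rw [← conjTranspose_mul, hB', conjTranspose_one]
  have hHH : H'.map ψ * Hi'.map ψ = 1 := by
    rw [← Matrix.map_mul, h1, Matrix.map_one _ (map_zero _) (map_one _)]
  have hzM : ∀ i (M : Matrix ι ι A'), dM (W.dz i) (M.map ψ) =
      ∑ a, B i a • (dM (W'.dz a) M).map ψ := fun i M => by
    ext k l
    simp only [dM_apply, Matrix.map_apply, hz, Matrix.sum_apply, Matrix.smul_apply, smul_eq_mul]
  have hbM : ∀ j (M : Matrix ι ι A'), dM (W.db j) (M.map ψ) =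
      ∑ b, star (B j b) • (dM (W'.db b) M).map ψ := fun i M => by
    ext k l
    simp only [dM_apply, Matrix.map_apply, hb, Matrix.sum_apply, Matrix.smul_apply, smul_eq_mul]
  have hBz : ∀ i, dM (W.dz i) Bᴴ = 0 := fun i => by
    rw [dM_dz_conjTranspose, hBb, conjTranspose_zero]
  have hBib : ∀ j, dM (W.db j) Bi = 0 := fun j => by
    rw [dM_inv hB _ hB', hBb, mul_zero, zero_mul, neg_zero]
  have hconn : W.conn (B * H'.map ψ * Bᴴ) (Biᴴ * Hi'.map ψ * Bi) i =
      dM (W.dz i) B * Bi + ∑ a, B i a • (B * (W'.conn H' Hi' a).map ψ * Bi) := by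
    have e : ∀ X : Matrix ι ι A, X * Bᴴ * (Biᴴ * Hi'.map ψ * Bi) = X * Hi'.map ψ * Bi := fun X => by
      calc X * Bᴴ * (Biᴴ * Hi'.map ψ * Bi) = X * (Bᴴ * Biᴴ) * Hi'.map ψ * Bi := by noncomm_ring
        _ = _ := by rw [hBB, mul_one]
    rw [WirtingerCalculus.conn, dM_mul, dM_mul, hBz, mul_zero, add_zero, e, hzM, add_mul, add_mul]
    congr 1
    · rw [Matrix.mul_assoc _ (H'.map ψ), hHH, mul_one]
    · simp only [Finset.mul_sum, Finset.sum_mul, Matrix.mul_smul, Matrix.smul_mul]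
      refine Finset.sum_congr rfl fun a _ => ?_
      rw [WirtingerCalculus.conn, Matrix.map_mul, Matrix.mul_assoc B]
  have hBij : ∀ a, W.db j (B i a) = 0 := fun a => congrFun (congrFun (hBb j) i) a
  rw [curvEnd, hconn, map_add, dM_mul, hBib, mul_zero, add_zero, dM_comm (W.db_dz j i), hBb,
    map_zero, zero_mul, zero_add, map_sum, ← Finset.sum_neg_distrib]
  refine Finset.sum_congr rfl fun a _ => ?_
  rw [dM_smul, hBij, zero_smul, zero_add, dM_mul, dM_mul, hBib, hBb, zero_mul, zero_add, mul_zero,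
    add_zero, hbM]
  simp only [Finset.mul_sum, Finset.sum_mul, Matrix.mul_smul, Matrix.smul_mul, Finset.smul_sum,
    smul_smul, ← Finset.sum_neg_distrib]
  refine Finset.sum_congr rfl fun b _ => ?_
  rw [curvEnd, Matrix.map_neg _ (map_neg ψ), mul_neg, neg_mul, smul_neg]

end WirtingerCalculus

section local_change

variable {n : ℕ} {V U' : Set (Fin n → ℂ)} {T : ℝ} {φ : (Fin n → ℂ) → Fin n → ℂ}

/-- The Jacobian matrix `∂_i φᵃ`. -/
def jacobian (φ : (Fin n → ℂ) → Fin n → ℂ) (z : Fin n → ℂ) : Matrix (Fin n) (Fin n) ℂ :=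
  Matrix.of fun i a => fderiv ℂ φ z (Pi.single i 1) a

/-- The real differential in terms of the Wirtinger derivatives. -/
lemma fderiv_eq_sum_wirtinger (F : (Fin n → ℂ) → ℂ) (z v : Fin n → ℂ) : fderiv ℝ F z v =
    ∑ a, (v a * ChernGeom.dz a F z + conj (v a) * ChernGeom.dzbar a F z) := by
  conv_lhs => rw [← Finset.univ_sum_single v, map_sum]
  refine Finset.sum_congr rfl fun a _ => ?_
  have e : (Pi.single a (v a) : Fin n → ℂ) =
      (v a).re • (Pi.single a 1 : Fin n → ℂ) + (v a).im • (Pi.single a Complex.I : Fin n → ℂ) := by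
    rw [← Pi.single_smul, ← Pi.single_smul, ← Pi.single_add]
    congr 1
    simp
  have hc : conj (v a) = (v a).re - (v a).im * Complex.I :=
    Complex.ext (by simp) (by simp)
  have hv := (Complex.re_add_im (v a)).symm
  rw [e, map_add, map_smul, map_smul, ChernGeom.dz, ChernGeom.dzbar, hc, Complex.real_smul,
    Complex.real_smul]
  generalize (v a).re = r at *
  generalize (v a).im = m at *
  rw [hv]
  linear_combination (m * fderiv ℝ F z (Pi.single a Complex.I)) * Complex.I_mul_I

lemma fderiv_comp_single {F : (Fin n → ℂ) → ℂ} {z : Fin n → ℂ} (hφ : DifferentiableAt ℂ φ z)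
    (hF : DifferentiableAt ℝ F (φ z)) (i : Fin n) (c : ℂ) :
    fderiv ℝ (fun w => F (φ w)) z (Pi.single i c) =
      ∑ a, (c * jacobian φ z i a * ChernGeom.dz a F (φ z) +
        conj (c * jacobian φ z i a) * ChernGeom.dzbar a F (φ z)) := by
  have h := hF.hasFDerivAt.comp z (hφ.hasFDerivAt.restrictScalars ℝ)
  have e : (Pi.single i c : Fin n → ℂ) = c • Pi.single i 1 := by
    rw [← Pi.single_smul]; simp
  rw [show (fun w => F (φ w)) = F ∘ φ from rfl, h.fderiv, ContinuousLinearMap.comp_apply,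
    ContinuousLinearMap.coe_restrictScalars', e, map_smul, fderiv_eq_sum_wirtinger]
  rfl

/-- The chain rule with a holomorphic inner function. -/
lemma dz_comp {F : (Fin n → ℂ) → ℂ} {z : Fin n → ℂ} (hφ : DifferentiableAt ℂ φ z)
    (hF : DifferentiableAt ℝ F (φ z)) (i : Fin n) :
    ChernGeom.dz i (fun w => F (φ w)) z = ∑ a, jacobian φ z i a * ChernGeom.dz a F (φ z) := by
  rw [ChernGeom.dz, fderiv_comp_single hφ hF, fderiv_comp_single hφ hF, Finset.mul_sum,
    ← Finset.sum_sub_distrib, Finset.mul_sum]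
  refine Finset.sum_congr rfl fun a _ => ?_
  rw [map_mul, map_mul, map_one, Complex.conj_I]
  linear_combination (-(1 / 2 : ℂ) * jacobian φ z i a * ChernGeom.dz a F (φ z) + (1 / 2 : ℂ) *
    conj (jacobian φ z i a) * ChernGeom.dzbar a F (φ z)) * Complex.I_mul_I

lemma dzbar_comp {F : (Fin n → ℂ) → ℂ} {z : Fin n → ℂ} (hφ : DifferentiableAt ℂ φ z)
    (hF : DifferentiableAt ℝ F (φ z)) (i : Fin n) :
    ChernGeom.dzbar i (fun w => F (φ w)) z =
      ∑ a, conj (jacobian φ z i a) * ChernGeom.dzbar a F (φ z) := by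
  rw [ChernGeom.dzbar, fderiv_comp_single hφ hF, fderiv_comp_single hφ hF, Finset.mul_sum,
    ← Finset.sum_add_distrib, Finset.mul_sum]
  refine Finset.sum_congr rfl fun a _ => ?_
  rw [map_mul, map_mul, map_one, Complex.conj_I]
  linear_combination ((1 / 2 : ℂ) * jacobian φ z i a * ChernGeom.dz a F (φ z) - (1 / 2 : ℂ) *
    conj (jacobian φ z i a) * ChernGeom.dzbar a F (φ z)) * Complex.I_mul_I

lemma dzbar_eq_zero {F : (Fin n → ℂ) → ℂ} {z : Fin n → ℂ} (hF : DifferentiableAt ℂ F z)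
    (i : Fin n) : ChernGeom.dzbar i F z = 0 := by
  rw [ChernGeom.dzbar, hF.fderiv_restrictScalars ℝ]
  have : (Pi.single i Complex.I : Fin n → ℂ) = Complex.I • Pi.single i 1 := by
    rw [← Pi.single_smul]; simp
  rw [ContinuousLinearMap.coe_restrictScalars', this, map_smul, smul_eq_mul, ← mul_assoc,
    Complex.I_mul_I]
  ring

lemma contDiffOn_jacobian (hV : IsOpen V) (hφ : ContDiffOn ℂ ω φ V) (i a : Fin n) :
    ContDiffOn ℂ ω (fun z => jacobian φ z i a) V :=
  contDiffOn_pi.1 ((hφ.fderiv_of_isOpen hV (m := ω) le_rfl).clm_apply contDiffOn_const) a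

namespace SmoothFn

/-- The pull-back of functions on `U' × [0, T]` along `φ × id`. -/
def pullback (hφ : ContDiffOn ℂ ω φ V) (hmap : Set.MapsTo φ V U') :
    SmoothFn (cylinder U' T) →+* SmoothFn (cylinder V T) :=
  have h : ∀ f : SmoothFn (cylinder U' T),
      ContDiffOn ℝ ∞ (fun q : (Fin n → ℂ) × ℝ => ext f (φ q.1, q.2)) (cylinder V T) := fun f =>
    (contDiffOn_ext f).comp (t := cylinder U' T) ((((hφ.restrict_scalars ℝ).of_le le_top).comp
      contDiffOn_fst fun q hq => hq.1).prodMk contDiffOn_snd) fun q hq => ⟨hmap hq.1, hq.2⟩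
  have hev : ∀ (f : SmoothFn (cylinder U' T)) (q : cylinder V T), ev q (mk _ (h f)) =
      ev (⟨(φ q.1.1, q.1.2), hmap q.2.1, q.2.2⟩ : cylinder U' T) f := fun f q =>
    ext_apply f ⟨(φ q.1.1, q.1.2), hmap q.2.1, q.2.2⟩
  { toFun := fun f => mk _ (h f)
    map_one' := ext_ev fun q => by rw [hev, map_one, map_one]
    map_mul' := fun f g => ext_ev fun q => by rw [hev, map_mul, map_mul, hev, hev]
    map_zero' := ext_ev fun q => by rw [hev, map_zero, map_zero]
    map_add' := fun f g => ext_ev fun q => by rw [hev, map_add, map_add, hev, hev] }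

lemma ev_pullback (hφ : ContDiffOn ℂ ω φ V) (hmap : Set.MapsTo φ V U') (q : cylinder V T)
    (f : SmoothFn (cylinder U' T)) : ev q (pullback hφ hmap f) =
      ev (⟨(φ q.1.1, q.1.2), hmap q.2.1, q.2.2⟩ : cylinder U' T) f :=
  ext_apply f ⟨(φ q.1.1, q.1.2), hmap q.2.1, q.2.2⟩

variable [SmoothDomain (cylinder V T)] [SmoothDomain (cylinder U' T)]

/-- The Jacobian matrix of `φ` as a matrix of smooth functions. -/
def jacobianFn (hV : IsOpen V) (hφ : ContDiffOn ℂ ω φ V) (T : ℝ) :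
    Matrix (Fin n) (Fin n) (SmoothFn (cylinder V T)) :=
  ofFamily (G := fun _ => jacobian φ) fun i a =>
    (((contDiffOn_jacobian hV hφ i a).restrict_scalars ℝ).of_le le_top).comp contDiffOn_fst
      fun _ hq => hq.1

lemma dz_pullback (hV : IsOpen V) (hU' : IsOpen U') (hφ : ContDiffOn ℂ ω φ V)
    (hmap : Set.MapsTo φ V U') (i : Fin n) (f : SmoothFn (cylinder U' T)) :
    (calculus _).dz i (pullback hφ hmap f) =
      ∑ a, jacobianFn hV hφ T i a * pullback hφ hmap ((calculus _).dz a f) := by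
  refine ext_ev fun q => ?_
  set q' : cylinder U' T := ⟨(φ q.1.1, q.1.2), hmap q.2.1, q.2.2⟩ with hq'
  have hF : ∀ w (hw : w ∈ U'), ext f (w, q.1.2) = ev (spacePt q' w hw) f := fun w hw =>
    ext_apply f (spacePt q' w hw)
  have hφq : DifferentiableAt ℂ φ q.1.1 :=
    (hφ.differentiableOn (by simp)).differentiableAt (hV.mem_nhds q.2.1)
  rw [← dz_slice hV q (F := fun w => ext f (φ w, q.1.2)) _ fun w hw => rfl,
    dz_comp (F := fun w => ext f (w, q.1.2)) hφq (hasFDerivAt_slice hU' q' f hF).differentiableAt]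
  simp only [map_sum, map_mul, ev_pullback]
  refine Finset.sum_congr rfl fun a _ => ?_
  rw [← dz_slice hU' q' f hF]
  rfl

lemma dzbar_pullback (hV : IsOpen V) (hU' : IsOpen U') (hφ : ContDiffOn ℂ ω φ V)
    (hmap : Set.MapsTo φ V U') (i : Fin n) (f : SmoothFn (cylinder U' T)) :
    (calculus _).db i (pullback hφ hmap f) =
      ∑ a, star (jacobianFn hV hφ T i a) * pullback hφ hmap ((calculus _).db a f) := by
  refine ext_ev fun q => ?_
  set q' : cylinder U' T := ⟨(φ q.1.1, q.1.2), hmap q.2.1, q.2.2⟩ with hq'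
  have hF : ∀ w (hw : w ∈ U'), ext f (w, q.1.2) = ev (spacePt q' w hw) f := fun w hw =>
    ext_apply f (spacePt q' w hw)
  have hφq : DifferentiableAt ℂ φ q.1.1 :=
    (hφ.differentiableOn (by simp)).differentiableAt (hV.mem_nhds q.2.1)
  rw [← dzbar_slice hV q (F := fun w => ext f (φ w, q.1.2)) _ fun w hw => rfl,
    dzbar_comp (F := fun w => ext f (w, q.1.2)) hφq
      (hasFDerivAt_slice hU' q' f hF).differentiableAt]
  simp only [map_sum, map_mul, ev_pullback]
  refine Finset.sum_congr rfl fun a _ => ?_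
  rw [← dzbar_slice hU' q' f hF]
  rfl

lemma db_jacobianFn (hV : IsOpen V) (hφ : ContDiffOn ℂ ω φ V) (j : Fin n) :
    dM ((calculus _).db j) (jacobianFn hV hφ T) = 0 := by
  refine Matrix.ext fun i a => ext_ev fun q => ?_
  rw [dM_apply, ← dzbar_slice hV q (F := fun w => jacobian φ w i a) _ fun w hw => rfl,
    dzbar_eq_zero (((contDiffOn_jacobian hV hφ i a).differentiableOn (by simp)).differentiableAt
      (hV.mem_nhds q.2.1))]
  rfl

end SmoothFn

open SmoothFn

/-- The transformation of the Chern curvature under a holomorphic change of coordinates. -/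
theorem curvMat_change (hV : IsOpen V) (hU' : IsOpen U') (hT : 0 < T)
    (hφ : ContDiffOn ℂ ω φ V) (hmap : Set.MapsTo φ V U')
    {G G' : ℝ → (Fin n → ℂ) → Matrix (Fin n) (Fin n) ℂ}
    (hG : ∀ i j, ContDiffOn ℝ ∞ (fun q : (Fin n → ℂ) × ℝ => G q.2 q.1 i j) (cylinder V T))
    (hG' : ∀ i j, ContDiffOn ℝ ∞ (fun q : (Fin n → ℂ) × ℝ => G' q.2 q.1 i j) (cylinder U' T))
    (hdet : ∀ t ∈ Set.Icc 0 T, ∀ z ∈ V, (G t z).det ≠ 0)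
    (hdet' : ∀ t ∈ Set.Icc 0 T, ∀ z ∈ U', (G' t z).det ≠ 0)
    (hrel : ∀ t ∈ Set.Icc 0 T, ∀ z ∈ V,
      G t z = jacobian φ z * G' t (φ z) * (jacobian φ z)ᴴ)
    {t : ℝ} (ht : t ∈ Set.Icc 0 T) {z : Fin n → ℂ} (hz : z ∈ V) :
    ∃ Bi, jacobian φ z * Bi = 1 ∧ ∀ i j, curvMat (G t) z i j =
      ∑ a, ∑ b, (jacobian φ z i a * conj (jacobian φ z j b)) •
        (jacobian φ z * curvMat (G' t) (φ z) a b * Bi) := by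
  have := smoothDomain_cylinder hV hT
  have := smoothDomain_cylinder hU' hT
  set B := jacobianFn hV hφ T with hBdef
  set ψ := pullback (T := T) hφ hmap with hψ
  have hH : ofFamily hG = B * (ofFamily hG').map ψ * Bᴴ := by
    refine Matrix.ext fun i j => ext_ev fun q => ?_
    have e : (B * (ofFamily hG').map ψ * Bᴴ).map (ev q) =
        jacobian φ q.1.1 * G' q.1.2 (φ q.1.1) * (jacobian φ q.1.1)ᴴ := by
      have e' : ((ofFamily hG').map ψ).map (ev q) = G' q.1.2 (φ q.1.1) := by
        ext k l
        exact ev_pullback hφ hmap q _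
      have e'' : Bᴴ.map (ev q) = (B.map (ev q))ᴴ := rfl
      rw [Matrix.map_mul, Matrix.map_mul, e', e'']
      rfl
    rw [← Matrix.map_apply (f := ev q) (M := B * _ * _), e, ← hrel _ q.2.2 _ q.2.1]
    rfl
  have hBu : IsUnit B.det := by
    have h := isUnit_det_ofFamily hG hdet
    rw [hH, Matrix.det_mul, Matrix.det_mul] at h
    exact isUnit_of_mul_isUnit_left (isUnit_of_mul_isUnit_left h)
  have hB : B * B⁻¹ = 1 := Matrix.mul_nonsing_inv _ hBu
  have hHi : (ofFamily hG)⁻¹ = (B⁻¹)ᴴ * ((ofFamily hG')⁻¹).map ψ * B⁻¹ := by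
    refine Matrix.inv_eq_right_inv ?_
    have hBB : Bᴴ * (B⁻¹)ᴴ = 1 := by
      rw [← conjTranspose_mul, Matrix.nonsing_inv_mul _ hBu, conjTranspose_one]
    have hHH : (ofFamily hG').map ψ * ((ofFamily hG')⁻¹).map ψ = 1 := by
      rw [← Matrix.map_mul, ofFamily_mul_inv hG' hdet', Matrix.map_one _ (map_zero _) (map_one _)]
    rw [hH]
    calc B * (ofFamily hG').map ψ * Bᴴ * ((B⁻¹)ᴴ * ((ofFamily hG')⁻¹).map ψ * B⁻¹)
        = B * ((ofFamily hG').map ψ * (Bᴴ * (B⁻¹)ᴴ) * ((ofFamily hG')⁻¹).map ψ) * B⁻¹ := by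
          simp only [Matrix.mul_assoc]
      _ = 1 := by rw [hBB, mul_one, hHH, mul_one, hB]
  let q : cylinder V T := ⟨(z, t), hz, ht⟩
  refine ⟨(B⁻¹).map (ev q), ?_, fun i j => ?_⟩
  · have := congrArg (fun M => M.map (ev q)) hB
    simp only [Matrix.map_mul, Matrix.map_one _ (map_zero (ev q)) (map_one (ev q))] at this
    exact this
  · have e1 := congrFun (congrFun (curvAt_ofFamily hG hdet hV q) i) j
    refine e1.symm.trans ?_
    rw [curvAt, hHi, hH, (calculus _).curvEnd_pullback (calculus _) hB (db_jacobianFn hV hφ)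
      (dz_pullback hV hU' hφ hmap) (dzbar_pullback hV hU' hφ hmap) (ofFamily_mul_inv hG' hdet')]
    simp only [map_sum_ev, map_smul_ev, map_mul, Matrix.map_mul, ev_star]
    refine Finset.sum_congr rfl fun a _ => Finset.sum_congr rfl fun b _ => ?_
    have e2 : (((calculus _).curvEnd (ofFamily hG') (ofFamily hG')⁻¹ a b).map ψ).map (ev q) =
        curvMat (G' t) (φ z) a b := by
      rw [← congrFun (congrFun (curvAt_ofFamily hG' hdet' hU' ⟨(φ z, t), hmap hz, ht⟩) a) b]
      ext k l
      exact ev_pullback hφ hmap q _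
    rw [e2]
    rfl

end local_change

end ChangeOfCoordinates

/-! ### Hermitian metrics in charts -/

section Charts

variable {n : ℕ} {M : Type*} [TopologicalSpace M] [ChartedSpace (Fin n → ℂ) M]

/-- The differential of the inverse of a chart; the tangent spaces of `M` are identified with
`ℂⁿ` by definition. -/
def chartDeriv (e : OpenPartialHomeomorph M (Fin n → ℂ)) (z : Fin n → ℂ) :
    (Fin n → ℂ) →L[ℂ] (Fin n → ℂ) :=
  mfderiv 𝓘(ℂ, Fin n → ℂ) 𝓘(ℂ, Fin n → ℂ) e.symm z

namespace HermitianMetric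

variable (g : HermitianMetric n M)

lemma form_congr {p p' : M} (h : p = p') (X Y : Fin n → ℂ) : g.form p X Y = g.form p' X Y := by
  subst h; rfl

lemma sesq_inChart (e : OpenPartialHomeomorph M (Fin n → ℂ)) (z x y : Fin n → ℂ) :
    sesq (g.inChart e z) x y = g.form (e.symm z) (chartDeriv e z x) (chartDeriv e z y) := by
  have h : ∀ x : Fin n → ℂ, chartDeriv e z x =
      ∑ i, x i • (coordVector e z i : TangentSpace 𝓘(ℂ, Fin n → ℂ) (e.symm z)) := fun x => by
    conv_lhs => rw [pi_eq_sum_univ' x, map_sum]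
    refine Finset.sum_congr rfl fun i _ => ?_
    rw [map_smul]
    congr 2
  have h' : g.form (e.symm z) (chartDeriv e z x) (chartDeriv e z y) =
      g.form (e.symm z) (∑ i, x i • (coordVector e z i)) (∑ i, y i • (coordVector e z i)) :=
    congrArg₂ (fun X Y => g.form (e.symm z) X Y) (h x) (h y)
  rw [h', LinearMap.map_sum₂]
  refine Finset.sum_congr rfl fun i _ => ?_
  rw [map_sum]
  refine Finset.sum_congr rfl fun j _ => ?_
  rw [LinearMap.map_smulₛₗ, LinearMap.map_smul₂, smul_eq_mul, smul_eq_mul, inChart,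
    localExpr, Matrix.of_apply]
  ring

lemma inChart_conjTranspose (e : OpenPartialHomeomorph M (Fin n → ℂ)) (z : Fin n → ℂ) :
    (g.inChart e z)ᴴ = g.inChart e z := by
  ext i j
  exact g.conj_symm _ _ _

variable [IsManifold 𝓘(ℂ, Fin n → ℂ) ω M]

omit g in
lemma _root_.ChernGeom.chartDeriv_injective {e : OpenPartialHomeomorph M (Fin n → ℂ)}
    (he : e ∈ atlas (Fin n → ℂ) M) {z : Fin n → ℂ} (hz : z ∈ e.target) :
    Function.Injective (chartDeriv e z) := by
  have : IsManifold 𝓘(ℂ, Fin n → ℂ) 1 M := IsManifold.of_le (n := ω) le_top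
  exact (mdifferentiable_of_mem_atlas (I := 𝓘(ℂ, Fin n → ℂ)) he).symm.mfderiv_injective hz

lemma sesq_inChart_pos {e : OpenPartialHomeomorph M (Fin n → ℂ)}
    (he : e ∈ atlas (Fin n → ℂ) M) {z : Fin n → ℂ} (hz : z ∈ e.target) (x : Fin n → ℂ)
    (hx : x ≠ 0) : 0 < (sesq (g.inChart e z) x x).re := by
  rw [sesq_inChart]
  refine g.pos _ _ fun h => hx (chartDeriv_injective he hz (h.trans (map_zero _).symm))

lemma det_inChart_ne_zero {e : OpenPartialHomeomorph M (Fin n → ℂ)}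
    (he : e ∈ atlas (Fin n → ℂ) M) {z : Fin n → ℂ} (hz : z ∈ e.target) :
    (g.inChart e z).det ≠ 0 := by
  intro h
  obtain ⟨v, hv, hv0⟩ := Matrix.exists_vecMul_eq_zero_iff.2 h
  have := g.sesq_inChart_pos he hz v hv
  rw [sesq_eq_dotProduct, Matrix.dotProduct_mulVec, hv0, zero_dotProduct] at this
  exact lt_irrefl _ this

lemma isInnerPair_inChart {e : OpenPartialHomeomorph M (Fin n → ℂ)}
    (he : e ∈ atlas (Fin n → ℂ) M) {z : Fin n → ℂ} (hz : z ∈ e.target) :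
    IsInnerPair (g.inChart e z) (g.inChart e z)⁻¹ where
  herm := g.inChart_conjTranspose e z
  pos := g.sesq_inChart_pos he hz
  mul_inv := Matrix.mul_nonsing_inv _ (isUnit_iff_ne_zero.2 (g.det_inChart_ne_zero he hz))
  inv_mul := Matrix.nonsing_inv_mul _ (isUnit_iff_ne_zero.2 (g.det_inChart_ne_zero he hz))

end HermitianMetric

section transition

variable [IsManifold 𝓘(ℂ, Fin n → ℂ) ω M] {e e' : OpenPartialHomeomorph M (Fin n → ℂ)}
  (he : e ∈ atlas (Fin n → ℂ) M) (he' : e' ∈ atlas (Fin n → ℂ) M)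
include he he'

lemma contDiffOn_transition : ContDiffOn ℂ ω (e.symm.trans e') (e.symm.trans e').source := by
  rw [← contMDiffOn_iff_contDiffOn]
  exact (contMDiffOn_of_mem_maximalAtlas (I := 𝓘(ℂ, Fin n → ℂ)) (n := ω)
    (IsManifold.subset_maximalAtlas he')).comp
    ((contMDiffOn_symm_of_mem_maximalAtlas (I := 𝓘(ℂ, Fin n → ℂ)) (n := ω)
    (IsManifold.subset_maximalAtlas he)).mono fun z hz => hz.1) fun z hz => hz.2

lemma chartDeriv_transition {z : Fin n → ℂ} (hz : z ∈ (e.symm.trans e').source) (v : Fin n → ℂ) :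
    chartDeriv e z v = chartDeriv e' (e.symm.trans e' z) (fderiv ℂ (e.symm.trans e') z v) := by
  have : IsManifold 𝓘(ℂ, Fin n → ℂ) 1 M := IsManifold.of_le (n := ω) le_top
  have hz' : e.symm.trans e' z ∈ e'.target := e'.map_source hz.2
  have h1 : HasMFDerivAt 𝓘(ℂ, Fin n → ℂ) 𝓘(ℂ, Fin n → ℂ) e'.symm (e.symm.trans e' z)
      (chartDeriv e' (e.symm.trans e' z)) :=
    ((mdifferentiable_of_mem_atlas (I := 𝓘(ℂ, Fin n → ℂ)) he').symm.mdifferentiableAt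
      hz').hasMFDerivAt
  have h2 : HasMFDerivAt 𝓘(ℂ, Fin n → ℂ) 𝓘(ℂ, Fin n → ℂ) (e.symm.trans e') z
      (fderiv ℂ (e.symm.trans e') z) :=
    (((contDiffOn_transition he he').differentiableOn (by simp)).differentiableAt
      ((e.symm.trans e').open_source.mem_nhds hz)).hasFDerivAt.hasMFDerivAt
  have h3 := h1.comp z h2
  have h4 : (e'.symm ∘ (e.symm.trans e')) =ᶠ[nhds z] e.symm := by
    filter_upwards [(e.symm.trans e').open_source.mem_nhds hz] with w hw
    exact e'.left_inv hw.2
  exact DFunLike.congr_fun (h3.congr_of_eventuallyEq h4.symm).mfderiv v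

lemma HermitianMetric.inChart_transition (g : HermitianMetric n M) {z : Fin n → ℂ}
    (hz : z ∈ (e.symm.trans e').source) :
    g.inChart e z = jacobian (e.symm.trans e') z * g.inChart e' (e.symm.trans e' z) *
      (jacobian (e.symm.trans e') z)ᴴ := by
  ext i j
  rw [← sesq_single (g.inChart e z), ← sesq_single (jacobian _ z * _ * _), ← sesq_vecMul,
    g.sesq_inChart, g.sesq_inChart]
  have hrow : ∀ i, (Pi.single i 1 : Fin n → ℂ) ᵥ* jacobian (e.symm.trans e') z =
      fderiv ℂ (e.symm.trans e') z (Pi.single i 1) := fun i => by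
    ext a
    rw [Matrix.single_one_vecMul]
    rfl
  rw [hrow, hrow, ← chartDeriv_transition he he' hz, ← chartDeriv_transition he he' hz]
  exact g.form_congr (e'.left_inv hz.2).symm _ _

end transition

end Charts

open SmoothFn

/-! ### The barrier on the manifold -/

section Barrier

variable {n : ℕ}

lemma contract_smul_vec (a : ℂ) (u : Fin n → ℂ) (F : Fin n → Fin n → Matrix (Fin n) (Fin n) ℂ) :
    contract (a • u) F = ((‖a‖ ^ 2 : ℝ) : ℂ) • contract u F := by
  simp only [contract, Finset.smul_sum, smul_smul]
  refine Finset.sum_congr rfl fun i _ => Finset.sum_congr rfl fun j _ => ?_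
  congr 1
  rw [Complex.ofReal_pow, ← Complex.mul_conj', Pi.smul_apply, Pi.smul_apply, smul_eq_mul,
    smul_eq_mul, star_mul', RCLike.star_def]
  ring

lemma sesq_smul_self (a : ℂ) (A : Matrix (Fin n) (Fin n) ℂ) (x : Fin n → ℂ) :
    sesq A (a • x) (a • x) = ((‖a‖ ^ 2 : ℝ) : ℂ) * sesq A x x := by
  rw [sesq_smul_left, sesq_smul_right, Complex.ofReal_pow, ← Complex.mul_conj']
  ring

lemma barrierAt_smul (G : (Fin n → ℂ) → Matrix (Fin n) (Fin n) ℂ) (c ε s : ℝ) (z : Fin n → ℂ)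
    (a b : ℂ) (u x : Fin n → ℂ) : barrierAt G c ε s z (a • u) (b • x) =
      ‖a‖ ^ 2 * ‖b‖ ^ 2 * barrierAt G c ε s z u x := by
  simp only [barrierAt, sesq_smul_self, contract_smul_vec, Matrix.smul_mul, sesq_smul,
    Complex.re_ofReal_mul]
  ring

/-- A barrier that is negative somewhere is negative at unit vectors. -/
lemma exists_unit_of_barrierAt_neg {G : (Fin n → ℂ) → Matrix (Fin n) (Fin n) ℂ} {c ε s : ℝ}
    {z u x : Fin n → ℂ} (h : barrierAt G c ε s z u x < 0) :
    ∃ u' ∈ Metric.sphere (0 : Fin n → ℂ) 1, ∃ x' ∈ Metric.sphere (0 : Fin n → ℂ) 1,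
      barrierAt G c ε s z u' x' < 0 := by
  have hu : u ≠ 0 := fun h0 => by
    have := barrierAt_smul G c ε s z 0 1 u x
    rw [zero_smul, ← h0, one_smul] at this
    rw [this] at h
    simp at h
  have hx : x ≠ 0 := fun h0 => by
    have := barrierAt_smul G c ε s z 1 0 u x
    rw [zero_smul, ← h0, one_smul] at this
    rw [this] at h
    simp at h
  have hn : ∀ v : Fin n → ℂ, v ≠ 0 → ((‖v‖⁻¹ : ℝ) : ℂ) • v ∈ Metric.sphere (0 : Fin n → ℂ) 1 :=
    fun v hv => by
      rw [mem_sphere_zero_iff_norm, norm_smul, Complex.norm_real, norm_inv, norm_norm,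
        inv_mul_cancel₀ (norm_ne_zero_iff.2 hv)]
  refine ⟨_, hn u hu, _, hn x hx, ?_⟩
  rw [barrierAt_smul]
  have h1 : 0 < ‖u‖ := norm_pos_iff.2 hu
  have h2 : 0 < ‖x‖ := norm_pos_iff.2 hx
  refine mul_neg_of_pos_of_neg ?_ h
  rw [Complex.norm_real, Complex.norm_real, norm_inv, norm_inv, norm_norm, norm_norm]
  positivity

/-- The barrier is invariant under the tensorial transformation rules. -/
lemma barrierAt_change {G G' : (Fin n → ℂ) → Matrix (Fin n) (Fin n) ℂ} {z z' : Fin n → ℂ}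
    {B Bi : Matrix (Fin n) (Fin n) ℂ} (hB : B * Bi = 1) (hG : G z = B * G' z' * Bᴴ)
    (hF : ∀ i j, curvMat G z i j =
      ∑ a, ∑ b, (B i a * conj (B j b)) • (B * curvMat G' z' a b * Bi)) (c ε s : ℝ)
    (u x : Fin n → ℂ) :
    barrierAt G c ε s z u x = barrierAt G' c ε s z' (u ᵥ* B) (x ᵥ* B) := by
  have hB' : Bi * B = 1 := mul_eq_one_comm.1 hB
  have h1 : contract u (curvMat G z) = B * contract (u ᵥ* B) (curvMat G' z') * Bi := by
    have e : contract u (curvMat G z) = ∑ a, ∑ b, (∑ i, ∑ j, u i * star (u j) *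
        (B i a * conj (B j b))) • (B * curvMat G' z' a b * Bi) := by
      simp only [contract, hF, Finset.smul_sum, smul_smul, Finset.sum_smul]
      exact sum_comm_pairs _
    rw [e, contract, Finset.mul_sum, Finset.sum_mul]
    refine Finset.sum_congr rfl fun a _ => ?_
    rw [Finset.mul_sum, Finset.sum_mul]
    refine Finset.sum_congr rfl fun b _ => ?_
    rw [Matrix.mul_smul, Matrix.smul_mul]
    congr 1
    simp only [vecMul, dotProduct, star_sum, Finset.sum_mul_sum, star_mul', RCLike.star_def]
    refine Finset.sum_congr rfl fun i _ => Finset.sum_congr rfl fun j _ => by ring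
  have h2 : ∀ y, sesq (contract u (curvMat G z) * G z) y y =
      sesq (contract (u ᵥ* B) (curvMat G' z') * G' z') (y ᵥ* B) (y ᵥ* B) := fun y => by
    rw [sesq_vecMul, h1, hG]
    congr 1
    calc B * contract (u ᵥ* B) (curvMat G' z') * Bi * (B * G' z' * Bᴴ)
        = B * contract (u ᵥ* B) (curvMat G' z') * (Bi * B) * G' z' * Bᴴ := by noncomm_ring
      _ = _ := by rw [hB', mul_one]; noncomm_ring
  have h3 : (contract u (curvMat G z)).trace = (contract (u ᵥ* B) (curvMat G' z')).trace := by
    rw [h1, Matrix.trace_mul_comm, ← Matrix.mul_assoc, hB', one_mul]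
  have h4 : ∀ y, sesq (G z) y y = sesq (G' z') (y ᵥ* B) (y ᵥ* B) := fun y => by
    rw [sesq_vecMul, hG]
  simp only [barrierAt, sesq_ricPert, h2, h3, h4]

/-- A metric with non-positive Griffiths curvature satisfies the barrier condition strictly. -/
lemma barrierAt_pos_of_griffiths {G : (Fin n → ℂ) → Matrix (Fin n) (Fin n) ℂ} {z : Fin n → ℂ}
    (hG : IsInnerPair (G z) (G z)⁻¹)
    (hF : ∀ i j, (curvMat G z i j * G z)ᴴ = curvMat G z j i * G z) {κ : ℝ} (hκ : κ ≤ 0)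
    (hgr : ∀ X Y, (curvForm G z X X Y Y).re ≤ κ * (bForm G z X X Y Y).re)
    {ε s : ℝ} (hε : 0 < ε) (hs : |s| ≤ 1) {u x : Fin n → ℂ} (hu : u ≠ 0) (hx : x ≠ 0) :
    0 < barrierAt G 1 ε s z u x := by
  -- `A` is the Hermitian form `R(u, ū, ·, ·)`, non-positive by hypothesis
  set A := contract u (curvMat G z) * G z with hA
  have hAe : A = contract u (fun i j => curvMat G z i j * G z) := by
    simp only [hA, contract, Finset.sum_mul, Matrix.smul_mul]
  have hAh : (-A)ᴴ = -A := by
    rw [conjTranspose_neg, hAe, contract_conjTranspose hF]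
  have hAn : ∀ y, (sesq A y y).re ≤ 0 := fun y => by
    have h1 := hgr u y
    rw [curvForm_eq, ← sesq_contract, ← hAe] at h1
    refine h1.trans (mul_nonpos_of_nonpos_of_nonneg hκ ?_)
    have h2 : bForm G z u u y y = sesq (G z) u u * sesq (G z) y y +
        ((‖sesq (G z) u y‖ ^ 2 : ℝ) : ℂ) := by
      rw [bForm, metricForm_eq, metricForm_eq, metricForm_eq, metricForm_eq,
        ← conj_sesq hG.herm u y, Complex.mul_conj', Complex.ofReal_pow]
    rw [h2, Complex.add_re, Complex.ofReal_re, Complex.mul_re, sesq_self_im hG.herm, zero_mul,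
      sub_zero]
    exact add_nonneg (mul_nonneg (hG.nonneg u) (hG.nonneg y)) (sq_nonneg _)
  have h3 := hG.sesq_le_trace hAh (fun y => by
    rw [sesq_neg, Complex.neg_re]; linarith [hAn y]) x
  rw [sesq_neg, Complex.neg_re, neg_mul, trace_neg, Complex.neg_re, hA, Matrix.mul_assoc,
    hG.mul_inv, mul_one, ← hA] at h3
  have h4 := mul_pos (mul_pos hε (hG.pos u hu)) (hG.pos x hx)
  have h5 : |s * (sesq A x x).re| ≤ -(sesq A x x).re := by
    rw [abs_mul, abs_of_nonpos (hAn x)]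
    exact mul_le_of_le_one_left (by linarith [hAn x]) hs
  have h6 := neg_abs_le (s * (sesq A x x).re)
  rw [barrierAt, sesq_ricPert, ← hA]
  nlinarith

end Barrier

section Flow

variable {n : ℕ} {M : Type*} [TopologicalSpace M] [ChartedSpace (Fin n → ℂ) M]
  [IsManifold 𝓘(ℂ, Fin n → ℂ) ω M] {g₀ : HermitianMetric n M} {T : ℝ} {g : ℝ → HermitianMetric n M}
  (hg : IsHermitianCurvatureFlow g₀ T g) {e e' : OpenPartialHomeomorph M (Fin n → ℂ)}
  (he : e ∈ atlas (Fin n → ℂ) M) (he' : e' ∈ atlas (Fin n → ℂ) M)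

/-- The matrix of the evolving metric in a chart. -/
def IsHermitianCurvatureFlow.matrix : Matrix (Fin n) (Fin n) (SmoothFn (cylinder e.target T)) :=
  ofFamily (G := fun t => (g t).inChart e) (hg.smooth e he)

include hg he

omit [IsManifold 𝓘(ℂ, Fin n → ℂ) ω M] in
lemma IsHermitianCurvatureFlow.matrix_conjTranspose : (hg.matrix he)ᴴ = hg.matrix he :=
  Matrix.ext fun i j => ext_ev fun q =>
    congrFun (congrFun ((g q.1.2).inChart_conjTranspose e q.1.1) i) j

omit hg in
variable (g) in
lemma det_family_ne_zero : ∀ t ∈ Set.Icc 0 T, ∀ z ∈ e.target,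
    ((g t).inChart e z).det ≠ 0 := fun t _ _ hz => (g t).det_inChart_ne_zero he hz

lemma IsHermitianCurvatureFlow.dt_matrix (hT : 0 < T) [SmoothDomain (cylinder e.target T)] :
    dM (calculus _).dt (hg.matrix he) =
      -((calculus _).meanCurv (hg.matrix he) (hg.matrix he)⁻¹ * hg.matrix he) :=
  dt_ofFamily (G := fun t => (g t).inChart e) (hg.smooth e he) (det_family_ne_zero g he) e.open_target
    (fun z hz t ht i j => by
      have := hg.evolution e he (e.symm z) (e.map_target hz) t ht i j
      rwa [e.right_inv hz] at this) hT

lemma IsHermitianCurvatureFlow.curvMat_conjTranspose (hT : 0 < T) {t : ℝ} (ht : t ∈ Set.Icc 0 T)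
    {z : Fin n → ℂ} (hz : z ∈ e.target) (i j : Fin n) :
    (curvMat ((g t).inChart e) z i j * (g t).inChart e z)ᴴ =
      curvMat ((g t).inChart e) z j i * (g t).inChart e z := by
  have := smoothDomain_cylinder e.open_target hT
  let q : cylinder e.target T := ⟨(z, t), hz, ht⟩
  have h := congrArg (fun N => N.map (ev q)) ((calculus _).curvEnd_mul_metric_conjTranspose
    (ofFamily_inv_mul (hg.smooth e he) (det_family_ne_zero g he)) (hg.matrix_conjTranspose he) i j)
  have hc := fun i j => congrFun (congrFun
    (curvAt_ofFamily (hg.smooth e he) (det_family_ne_zero g he) e.open_target q) i) j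
  have h2 : ∀ i j, ((calculus _).curvEnd (hg.matrix he) (hg.matrix he)⁻¹ i j *
      hg.matrix he).map (ev q) = curvMat ((g t).inChart e) z i j * (g t).inChart e z :=
    fun i j => by
      rw [Matrix.map_mul]
      exact congrArg₂ _ (hc i j) rfl
  rw [← h2, ← h2]
  exact h

include he' in
/-- The barriers in different charts correspond to each other. -/
lemma IsHermitianCurvatureFlow.barrierAt_chart_change (hT : 0 < T) {t : ℝ}
    (ht : t ∈ Set.Icc 0 T) {p : M} (hp : p ∈ e.source) (hp' : p ∈ e'.source) :
    ∃ B : Matrix (Fin n) (Fin n) ℂ, ∀ c ε s u x, barrierAt ((g t).inChart e) c ε s (e p) u x =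
      barrierAt ((g t).inChart e') c ε s (e' p) (u ᵥ* B) (x ᵥ* B) := by
  have hz : e p ∈ (e.symm.trans e').source :=
    ⟨e.map_source hp, show e.symm (e p) ∈ e'.source by rwa [e.left_inv hp]⟩
  have hzp : e.symm.trans e' (e p) = e' p := congrArg e' (e.left_inv hp)
  have hsub : (e.symm.trans e').source ⊆ e.target := fun z hz => hz.1
  obtain ⟨Bi, hB, hF⟩ := curvMat_change (e.symm.trans e').open_source e'.open_target hT
    (contDiffOn_transition he he') (fun z hz => e'.map_source hz.2)
    (G := fun t => (g t).inChart e) (G' := fun t => (g t).inChart e')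
    (fun i j => (hg.smooth e he i j).mono (Set.prod_mono hsub le_rfl)) (hg.smooth e' he')
    (fun t ht z hz => det_family_ne_zero g he t ht z (hsub hz)) (det_family_ne_zero g he')
    (fun t _ z hz => (g t).inChart_transition he he' hz) ht hz
  refine ⟨_, fun c ε s u x => barrierAt_change hB ?_ ?_ c ε s u x⟩
  · rw [← hzp]; exact (g t).inChart_transition he he' hz
  · rw [← hzp]; exact hF

end Flow

/-! ### Compactness and the first zero of the barrier -/

section Compactness

variable {n : ℕ}

section continuity

variable {X : Type*} [TopologicalSpace X]

lemma continuous_sesq {A : X → Matrix (Fin n) (Fin n) ℂ} {x y : X → Fin n → ℂ}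
    (hA : Continuous A) (hx : Continuous x) (hy : Continuous y) :
    Continuous fun w => sesq (A w) (x w) (y w) := by
  simp only [sesq_eq_dotProduct]
  exact hx.dotProduct (hA.matrix_mulVec hy.star)

lemma continuous_contract {u : X → Fin n → ℂ} {F : X → Fin n → Fin n → Matrix (Fin n) (Fin n) ℂ}
    (hu : Continuous u) (hF : ∀ i j, Continuous fun w => F w i j) :
    Continuous fun w => contract (u w) (F w) := by
  unfold contract
  refine continuous_finsetSum _ fun i _ => continuous_finsetSum _ fun j _ => ?_
  exact (((continuous_apply i).comp hu).mul ((continuous_apply j).comp hu).star).smul (hF i j)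

variable {U : Set (Fin n → ℂ)} {T : ℝ} [SmoothDomain (cylinder U T)]

omit [SmoothDomain (cylinder U T)] in
lemma continuous_map_ev (N : Matrix (Fin n) (Fin n) (SmoothFn (cylinder U T)))
    {q : X → cylinder U T} (hq : Continuous q) : Continuous fun w => N.map (ev (q w)) :=
  continuous_matrix fun i j => (continuous_ev (N i j)).comp hq

lemma continuous_barrier (H Hi : Matrix (Fin n) (Fin n) (SmoothFn (cylinder U T))) (ε κ s : ℝ)
    {q : X → cylinder U T} {u x : X → Fin n → ℂ} (hq : Continuous q) (hu : Continuous u)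
    (hx : Continuous x) : Continuous fun w => barrier H Hi ε κ s (q w) (u w) (x w) := by
  have hF : ∀ i j, Continuous fun w => curvAt H Hi (q w) i j := fun i j => continuous_map_ev _ hq
  have hH : Continuous fun w => H.map (ev (q w)) := continuous_map_ev _ hq
  have ht : Continuous fun w => (q w).1.2 := continuous_snd.comp (continuous_subtype_val.comp hq)
  have hr : Continuous fun w => ricPert (curvAt H Hi (q w)) (H.map (ev (q w))) ε :=
    continuous_matrix fun i j => ((hF i j).matrix_trace.neg).add
      (continuous_const.mul (hH.matrix_elem i j))
  have hc : Continuous fun w => contract (u w) (curvAt H Hi (q w)) := continuous_contract hu hF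
  exact (((continuous_const.add (continuous_const.mul ht)).mul
    (Complex.continuous_re.comp (continuous_sesq hH hx hx))).mul
    (Complex.continuous_re.comp (continuous_sesq hr hu hu))).add
    (continuous_const.mul (Complex.continuous_re.comp (continuous_sesq (hc.matrix_mul hH) hx hx)))

omit [SmoothDomain (cylinder U T)] in
lemma isCompact_space_preimage {K : Set (Fin n → ℂ)} (hK : IsCompact K) (hKU : K ⊆ U) :
    IsCompact {q : cylinder U T | q.1.1 ∈ K} := by
  rw [Subtype.isCompact_iff]
  convert hK.prod (isCompact_Icc (a := (0 : ℝ)) (b := T)) using 1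
  ext q
  constructor
  · rintro ⟨q', hq', rfl⟩
    exact ⟨hq', q'.2.2⟩
  · rintro ⟨h1, h2⟩
    exact ⟨⟨q, hKU h1, h2⟩, h1, rfl⟩

omit [SmoothDomain (cylinder U T)] in
lemma exists_norm_ev_le {α : Type*} [Finite α] (f : α → SmoothFn (cylinder U T))
    {K : Set (Fin n → ℂ)} (hK : IsCompact K) (hKU : K ⊆ U) :
    ∃ C : ℝ, ∀ a, ∀ q : cylinder U T, q.1.1 ∈ K → ‖ev q (f a)‖ ≤ C := by
  choose C hC using fun a => (isCompact_space_preimage (T := T) hK hKU).exists_bound_of_continuousOn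
    (continuous_ev (f a)).continuousOn
  obtain ⟨B, hB⟩ := Finite.exists_le C
  exact ⟨B, fun a q hq => (hC a q hq).trans (hB a)⟩

end continuity

variable {M : Type*} [TopologicalSpace M] [ChartedSpace (Fin n → ℂ) M]

variable (n M) in
/-- A compact manifold is covered by finitely many compact sets contained in charts. -/
lemma exists_compact_cover [CompactSpace M] : ∃ (A : Finset M) (K : M → Set (Fin n → ℂ)),
    (∀ a, IsCompact (K a) ∧ K a ⊆ (chartAt (Fin n → ℂ) a).target) ∧
    ∀ p, ∃ a ∈ A, p ∈ (chartAt (Fin n → ℂ) a).source ∧ chartAt (Fin n → ℂ) a p ∈ K a := by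
  have h : ∀ a : M, ∃ K, IsCompact K ∧ K ⊆ (chartAt (Fin n → ℂ) a).target ∧
      K ∈ nhds (chartAt (Fin n → ℂ) a a) := fun a => by
    obtain ⟨K, h1, h2, h3⟩ := local_compact_nhds ((chartAt (Fin n → ℂ) a).open_target.mem_nhds
      (mem_chart_target _ a))
    exact ⟨K, h3, h2, h1⟩
  choose K hK hKt hKn using h
  have hn : ∀ a : M, (chartAt (Fin n → ℂ) a).source ∩ chartAt (Fin n → ℂ) a ⁻¹' K a ∈ nhds a :=
    fun a => Filter.inter_mem (chart_source_mem_nhds _ a)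
      (((chartAt (Fin n → ℂ) a).continuousAt (mem_chart_source _ a)).preimage_mem_nhds (hKn a))
  obtain ⟨A, -, hA⟩ := isCompact_univ.elim_nhds_subcover _ fun a _ => hn a
  refine ⟨A, K, fun a => ⟨hK a, hKt a⟩, fun p => ?_⟩
  obtain ⟨a, ha, hp⟩ := Set.mem_iUnion₂.1 (hA (Set.mem_univ p))
  exact ⟨a, ha, hp⟩

variable [IsManifold 𝓘(ℂ, Fin n → ℂ) ω M] {g₀ : HermitianMetric n M} {T : ℝ}
  {g : ℝ → HermitianMetric n M}

/-- The barriers of the metric `g`, with both signs and in all charts, are non-negative. -/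
def BarrierNonneg (g : HermitianMetric n M) (c ε : ℝ) : Prop :=
  ∀ s : ℝ, |s| = 1 → ∀ e ∈ atlas (Fin n → ℂ) M, ∀ p ∈ e.source, ∀ u x : Fin n → ℂ,
    0 ≤ barrierAt (g.inChart e) c ε s (e p) u x

omit [IsManifold 𝓘(ℂ, Fin n → ℂ) ω M] in
lemma BarrierNonneg.pinched {g : HermitianMetric n M} {c ε : ℝ} (h : BarrierNonneg g c ε)
    {e : OpenPartialHomeomorph M (Fin n → ℂ)} (he : e ∈ atlas (Fin n → ℂ) M) {z : Fin n → ℂ}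
    (hz : z ∈ e.target) : Pinched (curvMat (g.inChart e) z) (g.inChart e z) ε c := by
  intro u x
  have h1 := h 1 (by simp) e he (e.symm z) (e.map_target hz) u x
  have h2 := h (-1) (by simp) e he (e.symm z) (e.map_target hz) u x
  rw [e.right_inv hz, barrierAt] at h1 h2
  exact abs_le.2 ⟨by linarith, by linarith⟩

variable (hg : IsHermitianCurvatureFlow g₀ T g)
include hg

omit [IsManifold 𝓘(ℂ, Fin n → ℂ) ω M] in
/-- Bounds for all quantities that enter the reaction constant. -/
lemma IsHermitianCurvatureFlow.exists_bounds
    {e : OpenPartialHomeomorph M (Fin n → ℂ)} (he : e ∈ atlas (Fin n → ℂ) M)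
    [SmoothDomain (cylinder e.target T)] {K : Set (Fin n → ℂ)} (hK : IsCompact K)
    (hKU : K ⊆ e.target) : ∃ Λ : ℝ, ∀ q : cylinder e.target T, q.1.1 ∈ K →
      (∀ k l, ‖ev q (hg.matrix he k l)‖ ≤ Λ) ∧ (∀ k l, ‖ev q ((hg.matrix he)⁻¹ k l)‖ ≤ Λ) ∧
      (∀ i j k l, ‖ev q ((calculus _).curvEnd (hg.matrix he) (hg.matrix he)⁻¹ i j k l)‖ ≤ Λ) ∧
      (∀ i j k l, ‖ev q ((calculus _).heatOp (hg.matrix he) (hg.matrix he)⁻¹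
        (fun i j => hg.matrix he i j • 1) i j k l)‖ ≤ Λ) := by
  obtain ⟨C₁, h₁⟩ := exists_norm_ev_le (fun a : Fin n × Fin n => hg.matrix he a.1 a.2) hK hKU
  obtain ⟨C₂, h₂⟩ := exists_norm_ev_le (fun a : Fin n × Fin n => (hg.matrix he)⁻¹ a.1 a.2) hK hKU
  obtain ⟨C₃, h₃⟩ := exists_norm_ev_le (fun a : (Fin n × Fin n) × Fin n × Fin n =>
    (calculus _).curvEnd (hg.matrix he) (hg.matrix he)⁻¹ a.1.1 a.1.2 a.2.1 a.2.2) hK hKU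
  obtain ⟨C₄, h₄⟩ := exists_norm_ev_le (fun a : (Fin n × Fin n) × Fin n × Fin n =>
    (calculus _).heatOp (hg.matrix he) (hg.matrix he)⁻¹
        (fun i j => hg.matrix he i j • 1) a.1.1 a.1.2 a.2.1 a.2.2) hK hKU
  refine ⟨max (max C₁ C₂) (max C₃ C₄), fun q hq => ⟨fun k l => ?_, fun k l => ?_,
    fun i j k l => ?_, fun i j k l => ?_⟩⟩
  · exact (h₁ (k, l) q hq).trans (by simp)
  · exact (h₂ (k, l) q hq).trans (by simp)
  · exact (h₃ ((i, j), k, l) q hq).trans (by simp)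
  · exact (h₄ ((i, j), k, l) q hq).trans (by simp)

lemma IsHermitianCurvatureFlow.barrier_matrix {e : OpenPartialHomeomorph M (Fin n → ℂ)}
    (he : e ∈ atlas (Fin n → ℂ) M) [SmoothDomain (cylinder e.target T)] (ε κ s : ℝ)
    (q : cylinder e.target T) (u x : Fin n → ℂ) :
    barrier (hg.matrix he) (hg.matrix he)⁻¹ ε κ s q u x =
      barrierAt ((g q.1.2).inChart e) (1 + κ * q.1.2) ε s q.1.1 u x :=
  barrier_ofFamily (G := fun t => (g t).inChart e) (hg.smooth e he) (det_family_ne_zero g he)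
    e.open_target ε κ s q u x

lemma IsHermitianCurvatureFlow.continuousOn_barrierAt (hT : 0 < T)
    {e : OpenPartialHomeomorph M (Fin n → ℂ)} (he : e ∈ atlas (Fin n → ℂ) M) {z : Fin n → ℂ}
    (hz : z ∈ e.target) (ε κ s : ℝ) (u x : Fin n → ℂ) :
    ContinuousOn (fun t => barrierAt ((g t).inChart e) (1 + κ * t) ε s z u x) (Set.Icc 0 T) := by
  have := smoothDomain_cylinder e.open_target hT
  rw [continuousOn_iff_continuous_domRestrict]
  let q : Set.Icc 0 T → cylinder e.target T := fun t => ⟨(z, t), hz, t.2⟩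
  have hq : Continuous q := by fun_prop
  refine (continuous_barrier (hg.matrix he) (hg.matrix he)⁻¹ ε κ s hq continuous_const
    continuous_const (u := fun _ => u) (x := fun _ => x)).congr fun t => ?_
  exact hg.barrier_matrix he ε κ s (q t) u x

/-- The times at which a barrier fails to be positive over a compact part of a chart. -/
lemma IsHermitianCurvatureFlow.isCompact_bad_times (hT : 0 < T)
    {e : OpenPartialHomeomorph M (Fin n → ℂ)} (he : e ∈ atlas (Fin n → ℂ) M)
    {K : Set (Fin n → ℂ)} (hK : IsCompact K) (hKU : K ⊆ e.target) {t₀ : ℝ} (ht₀ : t₀ ≤ T)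
    (ε κ s : ℝ) :
    IsCompact {t ∈ Set.Icc 0 t₀ | ∃ z ∈ K, ∃ u ∈ Metric.sphere (0 : Fin n → ℂ) 1,
      ∃ x ∈ Metric.sphere (0 : Fin n → ℂ) 1,
        barrierAt ((g t).inChart e) (1 + κ * t) ε s z u x ≤ 0} := by
  have := smoothDomain_cylinder e.open_target hT
  have hc := (isCompact_space_preimage (T := T) hK hKU).prod
    ((isCompact_sphere (0 : Fin n → ℂ) 1).prod (isCompact_sphere (0 : Fin n → ℂ) 1))
  have hΦ := continuous_barrier (hg.matrix he) (hg.matrix he)⁻¹ ε κ s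
    (X := cylinder e.target T × (Fin n → ℂ) × (Fin n → ℂ)) continuous_fst
    (continuous_fst.comp continuous_snd) (continuous_snd.comp continuous_snd)
  have hτ : Continuous fun w : cylinder e.target T × (Fin n → ℂ) × (Fin n → ℂ) => w.1.1.2 :=
    continuous_snd.comp (continuous_subtype_val.comp continuous_fst)
  have h := ((hc.inter_right (isClosed_le hΦ (continuous_const (y := (0 : ℝ))))).inter_right
    (isClosed_le hτ (continuous_const (y := t₀)))).image hτ
  convert h using 1
  ext t
  constructor
  · rintro ⟨ht, z, hz, u, hu, x, hx, hle⟩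
    refine ⟨(⟨(z, t), hKU hz, ht.1, ht.2.trans ht₀⟩, u, x), ⟨⟨⟨hz, hu, hx⟩, ?_⟩, ht.2⟩, rfl⟩
    exact (hg.barrier_matrix he ε κ s ⟨(z, t), hKU hz, ht.1, ht.2.trans ht₀⟩ u x).trans_le hle
  · rintro ⟨⟨q, u, x⟩, ⟨⟨⟨hz, hu, hx⟩, hle⟩, ht⟩, rfl⟩
    refine ⟨⟨q.2.2.1, ht⟩, q.1.1, hz, u, hu, x, hx, ?_⟩
    exact (hg.barrier_matrix he ε κ s q u x).symm.trans_le hle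

/-- The barriers stay non-negative as long as their growth rate dominates the reaction. -/
theorem IsHermitianCurvatureFlow.barrierNonneg (hT : 0 < T) (hg₀ : g₀.GriffithsNonpos)
    {A : Finset M} {K : M → Set (Fin n → ℂ)}
    (hK : ∀ a, IsCompact (K a) ∧ K a ⊆ (chartAt (Fin n → ℂ) a).target)
    (hcov : ∀ p, ∃ a ∈ A, p ∈ (chartAt (Fin n → ℂ) a).source ∧ chartAt (Fin n → ℂ) a p ∈ K a)
    {Λ κ t₀ ε : ℝ} (hΛ : 0 ≤ Λ)
    (hbd : ∀ a ∈ A, ∀ [SmoothDomain (cylinder (chartAt (Fin n → ℂ) a).target T)],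
      ∀ q : cylinder (chartAt (Fin n → ℂ) a).target T, q.1.1 ∈ K a →
      (∀ k l, ‖ev q (hg.matrix (chart_mem_atlas _ a) k l)‖ ≤ Λ) ∧
      (∀ k l, ‖ev q ((hg.matrix (chart_mem_atlas _ a))⁻¹ k l)‖ ≤ Λ) ∧
      (∀ i j k l, ‖ev q ((calculus _).curvEnd (hg.matrix (chart_mem_atlas _ a))
        (hg.matrix (chart_mem_atlas _ a))⁻¹ i j k l)‖ ≤ Λ) ∧
      (∀ i j k l, ‖ev q ((calculus _).heatOp (hg.matrix (chart_mem_atlas _ a))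
        (hg.matrix (chart_mem_atlas _ a))⁻¹
        (fun i j => hg.matrix (chart_mem_atlas _ a) i j • 1) i j k l)‖ ≤ Λ))
    (hκ : reactionConst n Λ < κ) (ht₀ : t₀ ≤ T) (hκt₀ : κ * t₀ ≤ 1) (hε : 0 < ε) (hε1 : ε ≤ 1) :
    ∀ t ∈ Set.Icc 0 t₀, BarrierNonneg (g t) (1 + κ * t) ε := by
  have hκ0 : 0 < κ := (reactionConst_nonneg (Nat.cast_nonneg n) hΛ).trans_lt hκ
  have hchart : ∀ a : M, chartAt (Fin n → ℂ) a ∈ atlas (Fin n → ℂ) M := fun a =>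
    chart_mem_atlas _ a
  set bad : M → ℝ → Set ℝ := fun a s =>
    {t ∈ Set.Icc 0 t₀ | ∃ z ∈ K a, ∃ u ∈ Metric.sphere (0 : Fin n → ℂ) 1,
      ∃ x ∈ Metric.sphere (0 : Fin n → ℂ) 1,
        barrierAt ((g t).inChart (chartAt (Fin n → ℂ) a)) (1 + κ * t) ε s z u x ≤ 0} with hbad
  set B : Set ℝ := ⋃ a ∈ A, (bad a 1 ∪ bad a (-1)) with hB
  have hBc : IsCompact B := A.isCompact_biUnion fun a _ =>
    (hg.isCompact_bad_times hT (hchart a) (hK a).1 (hK a).2 ht₀ ε κ 1).union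
      (hg.isCompact_bad_times hT (hchart a) (hK a).1 (hK a).2 ht₀ ε κ (-1))
  have hBmem : ∀ a ∈ A, ∀ s : ℝ, |s| = 1 → bad a s ⊆ B := by
    intro a ha s hs t ht
    refine Set.mem_iUnion₂.2 ⟨a, ha, ?_⟩
    rcases eq_or_eq_neg_of_abs_eq hs with rfl | rfl
    · exact Or.inl ht
    · exact Or.inr ht
  have hnot : ∀ t ∈ Set.Icc 0 t₀, t ∉ B → BarrierNonneg (g t) (1 + κ * t) ε := by
    intro t ht htB s hs e he p hp u x
    by_contra! hneg
    obtain ⟨a, ha, hpa, hpK⟩ := hcov p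
    obtain ⟨C, hC⟩ := hg.barrierAt_chart_change he (hchart a) hT ⟨ht.1, ht.2.trans ht₀⟩ hp hpa
    rw [hC] at hneg
    obtain ⟨u', hu', x', hx', hneg'⟩ := exists_unit_of_barrierAt_neg hneg
    exact htB (hBmem a ha s hs ⟨ht, _, hpK, u', hu', x', hx', hneg'.le⟩)
  by_contra! hcon
  obtain ⟨t', ht', hcon'⟩ := hcon
  have hne : B.Nonempty := ⟨t', by_contra fun h => hcon' (hnot t' ht' h)⟩
  obtain ⟨t₁, ht₁B, hmin⟩ := hBc.exists_isLeast hne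
  obtain ⟨a, ha, hta⟩ := Set.mem_iUnion₂.1 ht₁B
  obtain ⟨s, hs, ht₁, z, hzK, u₀, hu₀, x₀, hx₀, hle⟩ : ∃ s : ℝ, |s| = 1 ∧ t₁ ∈ bad a s := by
    rcases hta with h | h
    · exact ⟨1, by simp, h⟩
    · exact ⟨-1, by simp, h⟩
  have hz := (hK a).2 hzK
  have ht₁T : t₁ ∈ Set.Icc 0 T := ⟨ht₁.1, ht₁.2.trans ht₀⟩
  have hu₀' : u₀ ≠ 0 := ne_zero_of_mem_unit_sphere ⟨u₀, hu₀⟩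
  have hx₀' : x₀ ≠ 0 := ne_zero_of_mem_unit_sphere ⟨x₀, hx₀⟩
  -- the barriers are positive at time zero
  have hpos : 0 < t₁ := by
    refine lt_of_le_of_ne ht₁.1 fun h0 => ?_
    obtain ⟨κ₀, hκ₀, hgr⟩ := hg₀
    have hp := (chartAt (Fin n → ℂ) a).map_target hz
    have h1 := barrierAt_pos_of_griffiths ((g 0).isInnerPair_inChart (hchart a) hz)
      (hg.curvMat_conjTranspose (hchart a) hT ⟨le_rfl, hT.le⟩ hz) (hκ₀ _)
      (fun X Y => by
        have := hgr _ (hchart a) _ hp X Y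
        rwa [(chartAt (Fin n → ℂ) a).right_inv hz, ← hg.initial] at this) hε hs.le hu₀' hx₀'
    rw [← h0, mul_zero, add_zero] at hle
    exact hle.not_gt h1
  -- `t₁` is the first bad time, so the barriers are non-negative before `t₁` and, by continuity, at it
  have hlt : ∀ t ∈ Set.Icc 0 T, t < t₁ → BarrierNonneg (g t) (1 + κ * t) ε := fun t ht htt =>
    hnot t ⟨ht.1, htt.le.trans ht₁.2⟩ fun h => (hmin h).not_gt htt
  have hat : BarrierNonneg (g t₁) (1 + κ * t₁) ε := by
    intro s hs e he p hp u x
    have hc := (hg.continuousOn_barrierAt hT he (e.map_source hp) ε κ s u x t₁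
      ht₁T).mono_of_mem_nhdsWithin (s := Set.Iio t₁) (Filter.mem_of_superset (Ioo_mem_nhdsLT hpos)
        fun t ht => ⟨ht.1.le, ht.2.le.trans ht₁T.2⟩)
    refine ge_of_tendsto hc ?_
    filter_upwards [Ioo_mem_nhdsLT hpos] with t ht
    exact hlt t ⟨ht.1.le, ht.2.le.trans ht₁T.2⟩ ht.2 s hs e he p hp u x
  have := smoothDomain_cylinder (chartAt (Fin n → ℂ) a).open_target hT
  let q : cylinder (chartAt (Fin n → ℂ) a).target T := ⟨(z, t₁), hz, ht₁T⟩
  obtain ⟨b₁, b₂, b₃, b₄⟩ := hbd a ha q hzK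
  have hnn : ∀ (q' : cylinder (chartAt (Fin n → ℂ) a).target T),
      BarrierNonneg (g q'.1.2) (1 + κ * q'.1.2) ε → ∀ u x,
      0 ≤ barrier (hg.matrix (hchart a)) (hg.matrix (hchart a))⁻¹ ε κ s q' u x := by
    intro q' h u x
    rw [hg.barrier_matrix]
    have := h s hs _ (hchart a) _ ((chartAt (Fin n → ℂ) a).map_target q'.2.1) u x
    rwa [(chartAt (Fin n → ℂ) a).right_inv q'.2.1] at this
  refine barrier_no_first_zero (chartAt (Fin n → ℂ) a).open_target
    (ofFamily_mul_inv _ (det_family_ne_zero g (hchart a)))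
    (ofFamily_inv_mul _ (det_family_ne_zero g (hchart a)))
    (hg.matrix_conjTranspose (hchart a)) (hg.dt_matrix (hchart a) hT) (q := q) ?_
    (fun q' => (g q'.1.2).inChart_conjTranspose _ _) hΛ b₁ b₂ b₃ b₄ hε hε1 hs.le hκ
    ((mul_le_mul_of_nonneg_left ht₁.2 hκ0.le).trans hκt₀) hpos ?_
    (fun w hw u x => hnn (spacePt q w hw) hat u x) hu₀' hx₀'
    (fun t ht htt => hnn (timePt q t ht) (hlt t ht htt) u₀ x₀) ?_
  · have := (g t₁).isInnerPair_inChart (hchart a) hz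
    rwa [← map_inv_ofFamily (G := fun t => (g t).inChart (chartAt (Fin n → ℂ) a))
      (hg.smooth _ (hchart a)) (det_family_ne_zero g (hchart a)) q] at this
  · have := hat.pinched (hchart a) hz
    rwa [← curvAt_ofFamily (G := fun t => (g t).inChart (chartAt (Fin n → ℂ) a))
      (hg.smooth _ (hchart a)) (det_family_ne_zero g (hchart a))
      (chartAt (Fin n → ℂ) a).open_target q] at this
  · exact le_antisymm ((hg.barrier_matrix (hchart a) ε κ s q u₀ x₀).trans_le hle)
      (hnn q hat u₀ x₀)

end Compactness

/-! ### The curvature bounds -/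

lemma le_of_forall_small {r a b : ℝ} (h : ∀ ε : ℝ, 0 < ε → ε ≤ 1 → r ≤ a + ε * b) : r ≤ a := by
  have hc : Filter.Tendsto (fun ε : ℝ => a + ε * b) (nhdsWithin 0 (Set.Ioi 0)) (nhds a) := by
    have : Continuous fun ε : ℝ => a + ε * b := by fun_prop
    simpa using (this.tendsto 0).mono_left nhdsWithin_le_nhds
  refine ge_of_tendsto hc ?_
  filter_upwards [Ioc_mem_nhdsGT (zero_lt_one' ℝ)] with ε hε
  exact h ε hε.1 hε.2

section

variable {n : ℕ} {M : Type*} [TopologicalSpace M] [ChartedSpace (Fin n → ℂ) M]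

/-- The limit `ε → 0` of the pinching condition. -/
lemma pinched_zero {g : HermitianMetric n M} {c : ℝ}
    (h : ∀ ε : ℝ, 0 < ε → ε ≤ 1 → BarrierNonneg g c ε)
    {e : OpenPartialHomeomorph M (Fin n → ℂ)} (he : e ∈ atlas (Fin n → ℂ) M) {z : Fin n → ℂ}
    (hz : z ∈ e.target) : Pinched (curvMat (g.inChart e) z) (g.inChart e z) 0 c := by
  intro u x
  refine le_of_forall_small (b := c * (sesq (g.inChart e z) x x).re *
    (sesq (g.inChart e z) u u).re) fun ε hε hε1 => ?_
  refine ((h ε hε hε1).pinched he hz u x).trans_eq ?_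
  rw [sesq_ricPert, sesq_ricPert]
  ring

variable [IsManifold 𝓘(ℂ, Fin n → ℂ) ω M] {g : HermitianMetric n M} {c : ℝ}

lemma re_ricciForm {e : OpenPartialHomeomorph M (Fin n → ℂ)} (he : e ∈ atlas (Fin n → ℂ) M)
    {z : Fin n → ℂ} (hz : z ∈ e.target) (u : Fin n → ℂ) :
    (ricciForm (g.inChart e) z u u).re =
      -(sesq (ricPert (curvMat (g.inChart e) z) (g.inChart e z) 0) u u).re := by
  rw [ricciForm_eq (g.isInnerPair_inChart he hz).mul_inv, sesq_ricPert, trace_contract]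
  ring

lemma ricciNonpos_of_pinched (hc : 0 ≤ c) (h : ∀ e ∈ atlas (Fin n → ℂ) M, ∀ z ∈ e.target,
    Pinched (curvMat (g.inChart e) z) (g.inChart e z) 0 c) : g.RicciNonpos := by
  intro e he p hp u
  have hz := e.map_source hp
  rw [re_ricciForm he hz, neg_nonpos]
  exact (h e he _ hz).nonneg (g.isInnerPair_inChart he hz) le_rfl hc u

lemma curvatureBound_of_pinched (hc : 0 ≤ c) (h : ∀ e ∈ atlas (Fin n → ℂ) M, ∀ z ∈ e.target,
    Pinched (curvMat (g.inChart e) z) (g.inChart e z) 0 c)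
    (hF : ∀ e ∈ atlas (Fin n → ℂ) M, ∀ z ∈ e.target, ∀ i j,
      (curvMat (g.inChart e) z i j * g.inChart e z)ᴴ = curvMat (g.inChart e) z j i * g.inChart e z)
    {b : ℝ} (hb : c ^ 2 ≤ b) : g.CurvatureBound b := by
  intro e he p hp x u v hx
  have hz := e.map_source hp
  have h1 := (h e he _ hz).norm_mixed_sq_le (hF e he _ hz) u v x
  have h2 := (h e he _ hz).nonneg (g.isInnerPair_inChart he hz) le_rfl hc
  rw [metricForm_eq] at hx
  rw [hx, Complex.one_re, mul_one] at h1
  rw [curvForm_eq, re_ricciForm he hz, re_ricciForm he hz, mul_assoc, neg_mul_neg]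
  exact h1.trans (mul_le_mul_of_nonneg_right hb (mul_nonneg (h2 u) (h2 v)))

end

/-- Here `κ` is a reaction constant of the geometry on `M × [0, T]`, the time interval is the one on
which `t ≤ 1` and `κ t ≤ 1`, and `K = 2 κ + κ²`. -/
theorem exists_ricciNonpos_curvatureBound {n : ℕ} {M : Type*} [TopologicalSpace M] [CompactSpace M]
    [ChartedSpace (Fin n → ℂ) M] [IsManifold 𝓘(ℂ, Fin n → ℂ) ω M]
    (g₀ : ChernGeom.HermitianMetric n M) (T : ℝ) (hT : 0 < T)
    (g : ℝ → ChernGeom.HermitianMetric n M)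
    (hg : ChernGeom.IsHermitianCurvatureFlow g₀ T g)
    (hg₀ : g₀.GriffithsNonpos) :
    ∃ t₀ K : ℝ, 0 < t₀ ∧ t₀ ≤ T ∧ 0 < K ∧
      ∀ t ∈ Set.Icc 0 t₀, (g t).RicciNonpos ∧ (g t).CurvatureBound (1 + K * t) := by
  obtain ⟨A, K, hK, hcov⟩ := exists_compact_cover n M
  choose Λ hΛ using fun a : M =>
    have := smoothDomain_cylinder (chartAt (Fin n → ℂ) a).open_target hT
    hg.exists_bounds (chart_mem_atlas _ a) (hK a).1 (hK a).2
  obtain ⟨Λ', hΛ'⟩ := Finite.exists_le fun a : A => Λ a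
  set L := max Λ' 0 with hL
  have hle : ∀ a ∈ A, Λ a ≤ L := fun a ha => (hΛ' ⟨a, ha⟩).trans (le_max_left _ _)
  set κ := reactionConst n L + 1 with hκ
  have hκ0 : 0 < κ := by
    have := reactionConst_nonneg (Nat.cast_nonneg n) (le_max_right Λ' 0)
    positivity
  set t₀ := min T (min 1 κ⁻¹) with ht₀
  have ht₀T : t₀ ≤ T := min_le_left _ _
  have ht₀1 : t₀ ≤ 1 := (min_le_right _ _).trans (min_le_left _ _)
  have hκt₀ : κ * t₀ ≤ 1 := by
    have h : t₀ ≤ κ⁻¹ := (min_le_right _ _).trans (min_le_right _ _)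
    calc κ * t₀ ≤ κ * κ⁻¹ := mul_le_mul_of_nonneg_left h hκ0.le
      _ = 1 := mul_inv_cancel₀ hκ0.ne'
  refine ⟨t₀, 2 * κ + κ ^ 2, lt_min hT (lt_min one_pos (inv_pos.2 hκ0)), ht₀T, by positivity,
    fun t ht => ?_⟩
  have hbar : ∀ ε : ℝ, 0 < ε → ε ≤ 1 → BarrierNonneg (g t) (1 + κ * t) ε := fun ε hε hε1 =>
    hg.barrierNonneg hT hg₀ hK hcov (le_max_right Λ' 0) (fun a ha _ q hq => by
      obtain ⟨b₁, b₂, b₃, b₄⟩ := hΛ a q hq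
      exact ⟨fun k l => (b₁ k l).trans (hle a ha), fun k l => (b₂ k l).trans (hle a ha),
        fun i j k l => (b₃ i j k l).trans (hle a ha), fun i j k l => (b₄ i j k l).trans (hle a ha)⟩)
      (lt_add_one _) ht₀T hκt₀ hε hε1 t ht
  have hc : 0 ≤ 1 + κ * t := add_nonneg zero_le_one (mul_nonneg hκ0.le ht.1)
  have hpin : ∀ e ∈ atlas (Fin n → ℂ) M, ∀ z ∈ e.target,
      Pinched (curvMat ((g t).inChart e) z) ((g t).inChart e z) 0 (1 + κ * t) :=
    fun e he z hz => pinched_zero hbar he hz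
  refine ⟨ricciNonpos_of_pinched hc hpin, curvatureBound_of_pinched hc hpin
    (fun e he z hz => hg.curvMat_conjTranspose he hT ⟨ht.1, ht.2.trans ht₀T⟩ hz) ?_⟩
  -- `(1 + κ t)² = 1 + 2 κ t + κ² t²` and `t² ≤ t`
  have ht1 : t ≤ 1 := ht.2.trans ht₀1
  nlinarith [mul_nonneg (sq_nonneg κ) (mul_nonneg ht.1 (sub_nonneg.2 ht1))]

end ChernGeom

end

theorem proposition4p2 {n : ℕ} {M : Type*} [TopologicalSpace M] [T2Space M] [CompactSpace M]
    [ChartedSpace (Fin n → ℂ) M] [IsManifold 𝓘(ℂ, Fin n → ℂ) ω M]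
    (g₀ : ChernGeom.HermitianMetric n M) (T : ℝ) (hT : 0 < T)
    (g : ℝ → ChernGeom.HermitianMetric n M)
    (hg : ChernGeom.IsHermitianCurvatureFlow g₀ T g)
    (hg₀ : g₀.GriffithsNonpos) :
    ∃ t₀ K : ℝ, 0 < t₀ ∧ t₀ ≤ T ∧ 0 < K ∧
      ∀ t ∈ Set.Icc 0 t₀, (g t).RicciNonpos ∧ (g t).CurvatureBound (1 + K * t) :=
  ChernGeom.exists_ricciNonpos_curvatureBound g₀ T hT g hg hg₀
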